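/- **Setting.** Let $p\ge 1$, let $\Theta\subseteq\mathbb R^p$, $g:\mathbb R^k\times\Theta\to\mathbb R^r$, and let $F$ be a probability law on $\mathbb R^k$ with $E_F[g(X,\theta_0)]=0$. Write $G_x(\theta)=\partial g(x,\theta)/\partial\theta^T$, $S_{11}=E_F[g(X,\theta_0)g(X,\theta_0)^T]$, $S_{12}=E_F[G_X(\theta_0)]$ and $V(\theta_0)=(S_{12}^TS_{11}^{-1}S_{12})^{-1}$. Assume: i) $S_{11}$ is positive definite and $\operatorname{rank}S_{12}=p$; and on some open neighbourhood $U\subseteq\Theta$ of $\theta_0$: ii) $\|g(x,\theta)\|^3\le K_1(x)$; iii) $G_x(\theta)$ is continuous in $\theta$ and $\|G_x(\theta)\|\le K_2(x)$; iv) $\partial G_x(\theta)/\partial\theta$ is continuous in $\theta$ and $\|\partial G_x(\theta)/\partial\theta\|\le K_3(x)$; here $K_1,K_2,K_3$ are $F$-integrable. For data $X_1,\dots,X_n$ let $t(\theta)\in\mathbb R^r$ be a solution of $\sum_i g(X_i,\theta)/(1+t(\theta)^Tg(X_i,\theta))=0$ with all $1+t(\theta)^Tg(X_i,\theta)>0$,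 let $p_i(\theta)=n^{-1}(1+t(\theta)^Tg(X_i,\theta))^{-1}$, and let $\ell_{E,n}(\theta)=-\sum_i\log(1+t(\theta)^Tg(X_i,\theta))$ ($=-\infty$ if there is no solution). Let $\Phi$ be the class of convex $\phi:(0,\infty)\to\mathbb R$ with $\phi(1)=\phi'(1)=0$ and $\phi''(1)>0$, and put $$S_n^\phi(\theta,\theta_0)=\frac{2n}{\phi''(1)}\sum_{i=1}^n p_i(\theta_0)\,\phi\!\left(\frac{p_i(\theta)}{p_i(\theta_0)}\right).$$ **Theorem.** There is $\rho_0>0$, depending only on the objects above, such that the following holds. Let $f\in\mathbb R^p$ be such that $\theta_n=\theta_0+n^{-1/2}f\in\Theta$ for all $n\ge1$. For each $n$ let $X_1,\dots,X_n$ be i.i.d. with law $F_n$ on $\mathbb R^k$, where $E_{F_n}[g(X,\theta_n)]=0$, $F_n(B)\to F(B)$ for every Borel set $B$ (as is the case when the laws $F_n^{\otimes n}$ are contiguous to $F^{\otimes n}$), and $K_1,K_2$ are $F_n$-integrable with $E_{F_n}[K_j(X)]\to E_F[K_j(X)]$ for $j=1,2$. Let $\rho_n\le\rho_0$ be real numbers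 with $\sqrt n\,\rho_n\to\infty$, and let $\widehat\theta_{E,n}$ be an empirical maximum likelihood estimator near $\theta_0$: with probability tending to one it maximizes $\ell_{E,n}$ over $\{\theta\in\Theta:\|\theta-\theta_0\|\le\rho_n\}$. Then, for every $\phi\in\Phi$, $S_n^\phi(\widehat\theta_{E,n},\theta_0)$ converges in law to the noncentral chi-squared distribution $\chi^2_p(\delta)$ with $p$ degrees of freedom and noncentrality parameter $\delta=f^TV(\theta_0)^{-1}f$. Consequently, if $\chi^2_{p,\alpha}$ denotes the $(1-\alpha)$-quantile of $\chi^2_p$, $0<\alpha<1$, then $$\Pr\bigl(S_n^\phi(\widehat\theta_{E,n},\theta_0)>\chi^2_{p,\alpha}\bigr)\longrightarrow 1-F_{\chi^2_p(\delta)}(\chi^2_{p,\alpha}),$$ where $F_{\chi^2_p(\delta)}$ is the distribution function of $\chi^2_p(\delta)$; this second approximation to the power does not depend on $\phi$. -/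

import Mathlib

open MeasureTheory ProbabilityTheory Filter Topology
open scoped Matrix

namespace EmpPhi

/-- `EuclideanSpace ℝ (Fin d)`. -/
abbrev E (d : ℕ) : Type := EuclideanSpace ℝ (Fin d)

/-! ### Noncentral chi-squared distribution -/

/-- The noncentral chi-squared law with `p` degrees of freedom and noncentrality `δ`: the law of
`Z₁² + ⋯ + Z_p²` with independent `Z₁ ∼ N(√δ, 1)` and `Z₂, …, Z_p ∼ N(0, 1)`. -/
noncomputable def noncentralChiSq (p : ℕ) (δ : ℝ) : Measure ℝ :=
  (Measure.pi fun i : Fin p => gaussianReal (if i.val = 0 then √δ else 0) 1).map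
    fun z => ∑ i, z i ^ 2

instance (p : ℕ) (δ : ℝ) : IsProbabilityMeasure (noncentralChiSq p δ) :=
  Measure.isProbabilityMeasure_map
    (Measurable.aemeasurable (f := fun z : Fin p → ℝ => ∑ i, z i ^ 2) (by fun_prop))

/-- The central chi-squared law with `p` degrees of freedom. -/
noncomputable def chiSq (p : ℕ) : Measure ℝ := noncentralChiSq p 0

/-! ### Empirical likelihood

Here `y i` stands for `g(Xᵢ, θ)`. -/

/-- `t` solves the Lagrange system `∑ᵢ yᵢ / (1 + tᵀyᵢ) = 0` with positive weights
`1 / (1 + tᵀyᵢ)`. -/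
def IsMultiplier {n r : ℕ} (y : Fin n → E r) (t : E r) : Prop :=
  (∀ i, 0 < 1 + inner ℝ t (y i)) ∧ ∑ i, (1 + inner ℝ t (y i))⁻¹ • y i = 0

/-- The maximization of `∑ᵢ log pᵢ` over positive probability vectors `p` subject to
`∑ᵢ pᵢ yᵢ = 0` is solvable. -/
def HasMultiplier {n r : ℕ} (y : Fin n → E r) : Prop := ∃ t, IsMultiplier y t

open Classical in
/-- The multiplier `t` (zero where there is none). When there are several, the numbers `tᵀyᵢ`
are the same for all of them, because the maximizing `p` is unique. -/
noncomputable def multiplier {n r : ℕ} (y : Fin n → E r) : E r :=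
  if h : HasMultiplier y then h.choose else 0

/-- The weights `pᵢ = 1 / (n (1 + tᵀyᵢ))`. -/
noncomputable def elWeight {n r : ℕ} (y : Fin n → E r) (i : Fin n) : ℝ :=
  (n : ℝ)⁻¹ * (1 + inner ℝ (multiplier y) (y i))⁻¹

/-- The kernel `ℓ = - ∑ᵢ log (1 + tᵀyᵢ)` of the empirical log-likelihood. It is meaningful where
`HasMultiplier y`; elsewhere the empirical log-likelihood is `-∞`. -/
noncomputable def elLogLik {n r : ℕ} (y : Fin n → E r) : ℝ :=
  -∑ i, Real.log (1 + inner ℝ (multiplier y) (y i))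

/-- `θhat` maximizes the empirical log-likelihood of the sample `x` over the parameter set `A`.
Parameters without a multiplier have log-likelihood `-∞` and do not compete. -/
def IsEMLE {k p r n : ℕ} (g : E k → E p → E r) (x : Fin n → E k) (A : Set (E p))
    (θhat : E p) : Prop :=
  θhat ∈ A ∧ HasMultiplier (fun i => g (x i) θhat) ∧
    ∀ θ ∈ A, HasMultiplier (fun i => g (x i) θ) →
      elLogLik (fun i => g (x i) θ) ≤ elLogLik (fun i => g (x i) θhat)

/-! ### Phi-divergences -/

/-- The class `Φ`: convex `φ` on `(0, ∞)` with `φ(1) = φ'(1) = 0` and `φ''(1) > 0`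
(where `φ''(1)` exists, so that `φ` is differentiable near `1`). -/
structure PhiClass (φ : ℝ → ℝ) : Prop where
  convexOn : ConvexOn ℝ (Set.Ioi 0) φ
  map_one : φ 1 = 0
  differentiable_near : ∀ᶠ x in 𝓝 (1 : ℝ), DifferentiableAt ℝ φ x
  deriv_one : deriv φ 1 = 0
  differentiableAt_deriv : DifferentiableAt ℝ (deriv φ) 1
  deriv2_pos : 0 < deriv (deriv φ) 1

/-- The divergence `D_φ(P, Q) = ∑ᵢ qᵢ φ(pᵢ / qᵢ)`. -/
noncomputable def phiDiv {n : ℕ} (φ : ℝ → ℝ) (P Q : Fin n → ℝ) : ℝ :=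
  ∑ i, Q i * φ (P i / Q i)

/-- The empirical phi-divergence test statistic
`S_n^φ(θhat, θ₀) = (2 n / φ''(1)) D_φ(F_{n,θhat}, F_{n,θ₀})`. -/
noncomputable def testStat {k p r n : ℕ} (φ : ℝ → ℝ) (g : E k → E p → E r)
    (x : Fin n → E k) (θhat θ₀ : E p) : ℝ :=
  2 * n / deriv (deriv φ) 1 *
    phiDiv φ (elWeight fun i => g (x i) θhat) (elWeight fun i => g (x i) θ₀)

/-! ### Population quantities and regularity conditions -/

/-- `S₁₁(θ) = E_F[g(X,θ) g(X,θ)ᵀ]`. -/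
noncomputable def S11 {k p r : ℕ} (g : E k → E p → E r) (F : Measure (E k)) (θ : E p) :
    Matrix (Fin r) (Fin r) ℝ :=
  Matrix.of fun i j => ∫ x, g x θ i * g x θ j ∂F

/-- `S₁₂(θ) = E_F[G_X(θ)]`, with `G_x(θ) = ∂g(x,θ)/∂θᵀ`, an `r × p` matrix. -/
noncomputable def S12 {k p r : ℕ} (g : E k → E p → E r) (F : Measure (E k)) (θ : E p) :
    Matrix (Fin r) (Fin p) ℝ :=
  Matrix.of fun i j => ∫ x, fderiv ℝ (g x) θ (EuclideanSpace.single j 1) i ∂F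

/-- `V(θ) = (S₁₂(θ)ᵀ S₁₁(θ)⁻¹ S₁₂(θ))⁻¹`. -/
noncomputable def V {k p r : ℕ} (g : E k → E p → E r) (F : Measure (E k)) (θ : E p) :
    Matrix (Fin p) (Fin p) ℝ :=
  ((S12 g F θ)ᵀ * (S11 g F θ)⁻¹ * S12 g F θ)⁻¹

/-- The noncentrality parameter `δ = fᵀ V(θ₀)⁻¹ f`. -/
noncomputable def ncp {k p r : ℕ} (g : E k → E p → E r) (F : Measure (E k)) (θ₀ f : E p) : ℝ :=
  f.ofLp ⬝ᵥ ((V g F θ₀)⁻¹ *ᵥ f.ofLp)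

/-- The model at `θ₀` and the regularity conditions on the neighbourhood `U` of `θ₀`, with
envelopes `K₁` of `‖g‖³`, `K₂` of `‖∂g/∂θ‖` and `K₃` of `‖∂²g/∂θ²‖`. -/
structure Regular {k p r : ℕ} (g : E k → E p → E r) (F : Measure (E k)) (θ₀ : E p)
    (U : Set (E p)) (K₁ K₂ K₃ : E k → ℝ) : Prop where
  isOpen : IsOpen U
  mem : θ₀ ∈ U
  measurable : ∀ θ ∈ U, Measurable fun x => g x θ
  unbiased : ∫ x, g x θ₀ ∂F = 0
  posDef : (S11 g F θ₀).PosDef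
  rank_eq : (S12 g F θ₀).rank = p
  contDiff : ∀ x, ContDiffOn ℝ 2 (g x) U
  measurable_K₁ : Measurable K₁
  measurable_K₂ : Measurable K₂
  measurable_K₃ : Measurable K₃
  integrable_K₁ : Integrable K₁ F
  integrable_K₂ : Integrable K₂ F
  integrable_K₃ : Integrable K₃ F
  bound_g : ∀ x, ∀ θ ∈ U, ‖g x θ‖ ^ 3 ≤ K₁ x
  bound_G : ∀ x, ∀ θ ∈ U, ‖fderiv ℝ (g x) θ‖ ≤ K₂ x
  bound_dG : ∀ x, ∀ θ ∈ U, ‖fderiv ℝ (fderiv ℝ (g x)) θ‖ ≤ K₃ x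

/-- The Pitman sequence `θ_n = θ₀ + n^{-1/2} f`. -/
noncomputable def localParam {p : ℕ} (θ₀ f : E p) (n : ℕ) : E p := θ₀ + (√(n : ℝ))⁻¹ • f

/-- The laws `Fn n` of one observation under the local alternatives `θ = θ_n`: the
estimating functions are unbiased at `θ_n`, and `Fn n` approaches `F` setwise and in the
expectations of the envelopes of `‖g‖³` and `‖∂g/∂θ‖`. -/
structure LocalAlternatives {k p r : ℕ} (g : E k → E p → E r) (F : Measure (E k)) (θ₀ f : E p)
    (K₁ K₂ : E k → ℝ) (Fn : ℕ → Measure (E k)) : Prop where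
  unbiased : ∀ n, ∫ x, g x (localParam θ₀ f n) ∂(Fn n) = 0
  setwise : ∀ B, MeasurableSet B → Tendsto (fun n => Fn n B) atTop (𝓝 (F B))
  integrable_K₁ : ∀ n, Integrable K₁ (Fn n)
  integrable_K₂ : ∀ n, Integrable K₂ (Fn n)
  tendsto_K₁ : Tendsto (fun n => ∫ x, K₁ x ∂(Fn n)) atTop (𝓝 (∫ x, K₁ x ∂F))
  tendsto_K₂ : Tendsto (fun n => ∫ x, K₂ x ∂(Fn n)) atTop (𝓝 (∫ x, K₂ x ∂F))

end EmpPhi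

/-! Write `W` for `√n` times the sample mean of `g(Xᵢ, θ₀)`, `S = S₁₁`, `D = S₁₂`, `J = DᵀS⁻¹D`. The
divergence statistic is asymptotically a fixed quadratic form in `W`; the form does not involve `φ`,
and the limit law is that of the form evaluated at a Gaussian vector.

Probability is separated from analysis by the filter `probFilter` on the disjoint union of the
sample spaces: "eventually" means "with probability tending to one", and `Tendsto` means convergence
in probability. `SampleLimits` lists what is needed from laws of large numbers, together with a
bound `‖W‖ ≤ M`. The expansions are then deterministic statements along a filter. The bound on `W`
is imposed by restricting the filter, and `eventually_probFilter_of_tight` removes it because `W`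
converges in law.

Consistency at rate `n^{-1/2}` comes from duality. The multiplier maximizes `t ↦ ∑ log (1 + tᵀyᵢ)`,
so a test vector of length `n^{-1/2}` along the sample mean of `g(Xᵢ, θhat)` shows that a large mean
would make the likelihood at `θhat` worse than at `θ₀`. Since `D` is injective and the derivative
oscillates little on the `ρ₀`-ball, a small mean forces `θhat` close to `θ₀`
(`eventually_norm_emle_le`). At scale `n^{-1/2}`, `-2ℓ` at `θ₀ + n^{-1/2}h` is `(W + Dh)ᵀS⁻¹(W + Dh)
+ o(1)`. This is minimized at `h = NW` with `N = -J⁻¹DᵀS⁻¹`, and comparison with this minimizer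
gives `√n(θhat - θ₀) = NW + o(1)` (`tendsto_emle_sub`).

In the statistic, `φ(u) ≈ φ''(1)(u-1)²/2` turns each summand into the squared difference of `tᵀg` at
the two parameters. The multipliers satisfy `√n(t(θ₀) - t(θhat)) = -S⁻¹DNW + o(1)`, so the sum is
`(DNW)ᵀS⁻¹(DNW) + o(1) = ‖LNW‖² + o(1)`, where `LᵀL = J` (`tendsto_testStat_sub`).

Under the local alternatives the estimating functions are unbiased at `θ₀ + n^{-1/2}f`, so `W`
converges in law to `N(-Df, S)`. As `ND = -1` and `NSNᵀ = J⁻¹`, the vector `LNW` has limit `N(Lf,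
1)`. Its squared norm has the law `χ²_p(fᵀJf)`. -/

namespace EmpPhi

/-! ### Sample means -/

/-- The sample mean `n⁻¹ ∑ᵢ yᵢ`. -/
noncomputable def sampleMean {n : ℕ} {H : Type*} [AddCommGroup H] [Module ℝ H]
    (y : Fin n → H) : H :=
  (n : ℝ)⁻¹ • ∑ j, y j

/-- The empirical second moment operator `v ↦ n⁻¹ ∑ᵢ ⟪yᵢ, v⟫ yᵢ`. -/
noncomputable def sampleSecond {n r : ℕ} (y : Fin n → E r) : E r →L[ℝ] E r :=
  sampleMean fun j => (innerSL ℝ (y j)).smulRight (y j)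

section sampleMean
variable {n : ℕ} {H : Type*}

lemma sampleMean_map {H' : Type*} [AddCommGroup H] [Module ℝ H] [AddCommGroup H'] [Module ℝ H']
    (L : H →ₗ[ℝ] H') (y : Fin n → H) : L (sampleMean y) = sampleMean fun j => L (y j) := by
  simp [sampleMean]

lemma sampleMean_add [AddCommGroup H] [Module ℝ H] (y z : Fin n → H) :
    sampleMean (fun j => y j + z j) = sampleMean y + sampleMean z := by
  simp [sampleMean, Finset.sum_add_distrib]

lemma sampleMean_sub [AddCommGroup H] [Module ℝ H] (y z : Fin n → H) :
    sampleMean (fun j => y j - z j) = sampleMean y - sampleMean z := by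
  simp [sampleMean, Finset.sum_sub_distrib, smul_sub]

lemma sampleMean_mul_left (c : ℝ) (y : Fin n → ℝ) :
    sampleMean (fun j => c * y j) = c * sampleMean y := by
  simp [sampleMean, ← Finset.mul_sum]; ring

lemma sampleMean_const (hn : 0 < n) (c : ℝ) : sampleMean (fun _ : Fin n => c) = c := by
  have : (n : ℝ) ≠ 0 := by positivity
  simp [sampleMean]; field_simp

lemma sampleMean_mono {y z : Fin n → ℝ} (h : ∀ j, y j ≤ z j) : sampleMean y ≤ sampleMean z := by
  simp only [sampleMean, smul_eq_mul]
  gcongr with j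
  exact h j

lemma sampleMean_nonneg {y : Fin n → ℝ} (h : ∀ j, 0 ≤ y j) : 0 ≤ sampleMean y := by
  simp only [sampleMean, smul_eq_mul]
  have := Finset.sum_nonneg fun j (_ : j ∈ Finset.univ) => h j
  positivity

lemma norm_sampleMean_le [NormedAddCommGroup H] [NormedSpace ℝ H] (y : Fin n → H) :
    ‖sampleMean y‖ ≤ sampleMean fun j => ‖y j‖ := by
  simp only [sampleMean, norm_smul, norm_inv, Real.norm_natCast, smul_eq_mul]
  gcongr
  exact norm_sum_le _ _

lemma mul_sampleMean (hn : 0 < n) (y : Fin n → ℝ) : (n : ℝ) * sampleMean y = ∑ j, y j := by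
  have : (n : ℝ) ≠ 0 := by positivity
  simp [sampleMean]; field_simp

lemma le_mul_sampleMean {y : Fin n → ℝ} (h : ∀ j, 0 ≤ y j) (j : Fin n) :
    y j ≤ n * sampleMean y := by
  rw [mul_sampleMean (Fin.pos j)]
  exact Finset.single_le_sum (fun i _ => h i) (Finset.mem_univ j)

lemma inner_sampleMean {r : ℕ} (t : E r) (y : Fin n → E r) :
    inner ℝ t (sampleMean y) = sampleMean fun j => inner ℝ t (y j) :=
  sampleMean_map (innerSL ℝ t).toLinearMap y

lemma sampleSecond_apply {r : ℕ} (y : Fin n → E r) (t : E r) :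
    sampleSecond y t = sampleMean fun j => inner ℝ t (y j) • y j := by
  simp [sampleSecond, sampleMean, real_inner_comm]

lemma inner_sampleSecond {r : ℕ} (y : Fin n → E r) (t : E r) :
    inner ℝ t (sampleSecond y t) = sampleMean fun j => inner ℝ t (y j) ^ 2 := by
  rw [sampleSecond_apply, inner_sampleMean]
  simp [inner_smul_right, pow_two]

end sampleMean

/-! ### Logarithm bounds -/

lemma abs_log_one_add_sub_le {a : ℝ} (h : |a| ≤ 1 / 2) :
    |Real.log (1 + a) - (a - a ^ 2 / 2)| ≤ 2 * |a| ^ 3 := by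
  have := Real.abs_log_sub_add_sum_range_le (x := -a) (by rw [abs_neg]; linarith) 2
  simp only [Finset.sum_range_succ, Finset.sum_range_zero, abs_neg, sub_neg_eq_add] at this
  norm_num at this
  have h2 : |a| ^ 3 / (1 - |a|) ≤ 2 * |a| ^ 3 := by
    rw [div_le_iff₀ (by linarith)]
    have : 0 ≤ |a| ^ 3 := by positivity
    nlinarith
  refine le_trans (le_of_eq ?_) (this.trans h2)
  congr 1; ring

/-- The cubic remainder is at most `2 · (1/12) a² = a²/6`, which weakens the coefficient `1/2` to
`1/3`. With `1/4` in place of `1/12` a lower bound with coefficient `1` is left. -/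
lemma log_one_add_le_sub_sq {a : ℝ} (h : |a| ≤ 1 / 12) : Real.log (1 + a) ≤ a - a ^ 2 / 3 := by
  have h1 := (abs_le.1 (abs_log_one_add_sub_le (a := a) (by linarith))).2
  have h2 : |a| ^ 3 ≤ 1 / 12 * a ^ 2 := by
    rw [pow_succ, sq_abs, mul_comm]; gcongr
  linarith

lemma sub_sq_le_log_one_add {a : ℝ} (h : |a| ≤ 1 / 4) : a - a ^ 2 ≤ Real.log (1 + a) := by
  have h1 := (abs_le.1 (abs_log_one_add_sub_le (a := a) (by linarith))).1
  have h2 : |a| ^ 3 ≤ 1 / 4 * a ^ 2 := by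
    rw [pow_succ, sq_abs, mul_comm]; gcongr
  linarith

/-! ### Multipliers of a fixed sample -/

section multiplier
variable {n r : ℕ} {y : Fin n → E r}

lemma isMultiplier_multiplier (h : HasMultiplier y) : IsMultiplier y (multiplier y) := by
  rw [multiplier, dif_pos h]; exact h.choose_spec

/-- Duality: the multiplier maximizes the concave function `t ↦ ∑ᵢ log (1 + tᵀyᵢ)`. -/
lemma IsMultiplier.sum_log_le {t s : E r} (ht : IsMultiplier y t)
    (hs : ∀ j, 0 < 1 + inner ℝ s (y j)) :
    ∑ j, Real.log (1 + inner ℝ s (y j)) ≤ ∑ j, Real.log (1 + inner ℝ t (y j)) := by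
  have h0 : ∑ j, (1 + inner ℝ t (y j))⁻¹ * inner ℝ (s - t) (y j) = 0 := by
    have := congrArg (inner ℝ (s - t)) ht.2
    simpa [inner_sum, inner_smul_right] using this
  rw [← sub_nonpos, ← Finset.sum_sub_distrib, ← h0]
  refine Finset.sum_le_sum fun j _ => ?_
  have hj := ht.1 j
  rw [← Real.log_div (hs j).ne' hj.ne']
  refine (Real.log_le_sub_one_of_pos (div_pos (hs j) hj)).trans (le_of_eq ?_)
  rw [inner_sub_left]; field_simp; ring

/-- Pairing both Lagrange systems with `s - t` and subtracting gives a vanishing sum of nonnegative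
terms, so `s - t` is orthogonal to every `yⱼ`, and coercivity makes it zero. This identifies the
arbitrarily chosen `multiplier` with the small one constructed by maximization. -/
lemma IsMultiplier.unique {t s : E r} (ht : IsMultiplier y t) (hs : IsMultiplier y s)
    {c : ℝ} (hc : 0 < c) (hn : 0 < n)
    (hy : ∀ v, c * ‖v‖ ^ 2 ≤ inner ℝ v (sampleSecond y v)) : t = s := by
  have h0 : ∑ j,
      inner ℝ (s - t) (y j) ^ 2 / ((1 + inner ℝ t (y j)) * (1 + inner ℝ s (y j))) = 0 := by
    have h1 := congrArg (inner ℝ (s - t)) ht.2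
    have h2 := congrArg (inner ℝ (s - t)) hs.2
    simp only [inner_sum, inner_smul_right, inner_zero_right] at h1 h2
    rw [← sub_zero (0 : ℝ)]
    nth_rewrite 1 [← h1]
    rw [← h2, ← Finset.sum_sub_distrib]
    refine Finset.sum_congr rfl fun j _ => ?_
    have a := (ht.1 j).ne'
    have b := (hs.1 j).ne'
    rw [inner_sub_left]; field_simp; ring
  have hz : ∀ j, inner ℝ (s - t) (y j) = 0 := by
    intro j
    have := (Finset.sum_eq_zero_iff_of_nonneg (fun j _ => div_nonneg (sq_nonneg _)
      (mul_pos (ht.1 j) (hs.1 j)).le)).1 h0 j (Finset.mem_univ j)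
    rw [div_eq_zero_iff] at this
    rcases this with h | h
    · simpa using h
    · exact absurd h (mul_pos (ht.1 j) (hs.1 j)).ne'
  have := hy (s - t)
  rw [inner_sampleSecond] at this
  simp only [hz] at this
  rw [sampleMean_const hn] at this
  have h3 : ‖s - t‖ ^ 2 ≤ 0 := by
    by_contra! h
    have := mul_pos hc h
    linarith
  have h4 : ‖s - t‖ = 0 := by nlinarith [norm_nonneg (s - t)]
  exact (sub_eq_zero.1 (norm_eq_zero.1 h4)).symm

lemma abs_inner_le_of_norm_le {t z : E r} {R b c : ℝ} (ht : ‖t‖ ≤ R) (hz : ‖z‖ ≤ b)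
    (h : R * b ≤ c) : |inner ℝ t z| ≤ c :=
  (abs_real_inner_le_norm t z).trans ((mul_le_mul ht hz (norm_nonneg _)
    ((norm_nonneg _).trans ht)).trans h)

/-- A sample whose mean is small relative to the least eigenvalue of its second moment operator
has a multiplier, of controlled size. -/
lemma exists_isMultiplier {b c R : ℝ} (hn : 0 < n) (hb : ∀ j, ‖y j‖ ≤ b) (hR : 0 < R)
    (hRb : R * b ≤ 1 / 12) (hy : ∀ v, c * ‖v‖ ^ 2 ≤ inner ℝ v (sampleSecond y v))
    (hm : ‖sampleMean y‖ < c * R / 3) : ∃ t, IsMultiplier y t ∧ ‖t‖ < R := by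
  have hn' : (0 : ℝ) < n := by positivity
  have habs : ∀ t ∈ Metric.closedBall (0 : E r) R, ∀ j, |inner ℝ t (y j)| ≤ 1 / 12 := fun t ht j =>
    abs_inner_le_of_norm_le (by simpa using ht) (hb j) hRb
  have hpos : ∀ t ∈ Metric.closedBall (0 : E r) R, ∀ j, 0 < 1 + inner ℝ t (y j) := fun t ht j => by
    have := (abs_le.1 (habs t ht j)).1; linarith
  have hcont : ContinuousOn (fun t => ∑ j, Real.log (1 + inner ℝ t (y j)))
      (Metric.closedBall (0 : E r) R) := by
    refine continuousOn_finsetSum _ fun j _ => ContinuousOn.log (by fun_prop) fun t ht => ?_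
    exact (hpos t ht j).ne'
  obtain ⟨t, htm, hmax⟩ := (isCompact_closedBall (0 : E r) R).exists_isMaxOn
    ⟨0, by simp [hR.le]⟩ hcont
  -- The maximum over the ball is at least the value `0` at the origin, whereas on the sphere the
  -- value is at most `n (R ‖ȳ‖ - cR²/3) < 0`. So the maximizer is interior, and its critical point
  -- equation is the Lagrange system.
  have hnorm : ‖t‖ < R := by
    refine lt_of_le_of_ne (by simpa using htm) fun hEq => ?_
    have h0 : 0 ≤ ∑ j, Real.log (1 + inner ℝ t (y j)) := by
      simpa using hmax (show (0 : E r) ∈ _ by simp [hR.le])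
    have h1 : ∑ j, Real.log (1 + inner ℝ t (y j)) ≤
        n * (inner ℝ t (sampleMean y) - inner ℝ t (sampleSecond y t) / 3) := by
      rw [inner_sampleMean, inner_sampleSecond, mul_sub, ← mul_div_assoc, mul_sampleMean hn,
        mul_sampleMean hn, Finset.sum_div, ← Finset.sum_sub_distrib]
      exact Finset.sum_le_sum fun j _ => log_one_add_le_sub_sq (habs t htm j)
    have h2 : inner ℝ t (sampleMean y) - inner ℝ t (sampleSecond y t) / 3 < 0 := by
      have h3 := real_inner_le_norm t (sampleMean y)
      have h4 := hy t
      rw [hEq] at h3 h4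
      have : R * ‖sampleMean y‖ < R * (c * R / 3) := by gcongr
      nlinarith
    nlinarith
  refine ⟨t, ⟨hpos t htm, ?_⟩, hnorm⟩
  have hloc : IsLocalMax (fun t => ∑ j, Real.log (1 + inner ℝ t (y j))) t :=
    hmax.isLocalMax (Metric.closedBall_mem_nhds_of_mem (by simpa using hnorm))
  have hderiv : HasFDerivAt (fun t => ∑ j, Real.log (1 + inner ℝ t (y j)))
      (∑ j, (1 + inner ℝ t (y j))⁻¹ • innerSL ℝ (y j)) t := by
    refine HasFDerivAt.fun_sum fun j _ => HasFDerivAt.log ?_ (hpos t htm j).ne'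
    have : (fun x : E r => 1 + inner ℝ x (y j)) = fun x => 1 + innerSL ℝ (y j) x := by
      ext x; simp [real_inner_comm]
    rw [this]
    exact ((innerSL ℝ (y j)).hasFDerivAt).const_add 1
  have hz := hloc.hasFDerivAt_eq_zero hderiv
  refine ext_inner_right ℝ fun v => ?_
  have := congrArg (fun L : E r →L[ℝ] ℝ => L v) hz
  simpa [sum_inner, inner_smul_left] using this

/-- Insert `1/(1+a) = 1 - a + a²/(1+a)` with `a = tᵀyⱼ` into the Lagrange system; the last term is
cubic in `yⱼ`, and `1/(1+a) ≤ 2`. -/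
lemma IsMultiplier.norm_sampleMean_sub_le {t : E r} (ht : IsMultiplier y t)
    (hs : ∀ j, |inner ℝ t (y j)| ≤ 1 / 2) :
    ‖sampleMean y - sampleSecond y t‖ ≤ 2 * ‖t‖ ^ 2 * sampleMean fun j => ‖y j‖ ^ 3 := by
  have h0 : sampleMean (fun j => (1 + inner ℝ t (y j))⁻¹ • y j) = 0 := by
    simp [sampleMean, ht.2]
  have h1 : sampleMean y - sampleSecond y t =
      -sampleMean fun j => ((1 + inner ℝ t (y j))⁻¹ * inner ℝ t (y j) ^ 2) • y j := by
    rw [sampleSecond_apply, ← sampleMean_sub, eq_neg_iff_add_eq_zero, ← sampleMean_add, ← h0]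
    congr 1
    ext1 j
    have := (ht.1 j).ne'
    have h2 : (1 + inner ℝ t (y j))⁻¹ =
        1 - inner ℝ t (y j) + (1 + inner ℝ t (y j))⁻¹ * inner ℝ t (y j) ^ 2 := by
      field_simp; ring
    nth_rewrite 2 [h2]
    rw [add_smul, sub_smul, one_smul]
  rw [h1, norm_neg, ← sampleMean_mul_left]
  refine (norm_sampleMean_le _).trans (sampleMean_mono fun j => ?_)
  have hp := ht.1 j
  have hinv : (1 + inner ℝ t (y j))⁻¹ ≤ 2 := by
    have := (abs_le.1 (hs j)).1
    rw [inv_le_comm₀ hp (by norm_num)]; linarith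
  rw [norm_smul, Real.norm_eq_abs, abs_of_nonneg (by positivity)]
  have hsq : inner ℝ t (y j) ^ 2 ≤ (‖t‖ * ‖y j‖) ^ 2 :=
    sq_le_sq' (by linarith [neg_le_of_abs_le (abs_real_inner_le_norm t (y j))])
      (real_inner_le_norm _ _)
  calc _ ≤ 2 * (‖t‖ * ‖y j‖) ^ 2 * ‖y j‖ := by gcongr
    _ = _ := by ring

lemma abs_sum_log_sub_le {t : E r} (hn : 0 < n) (hs : ∀ j, |inner ℝ t (y j)| ≤ 1 / 2) :
    |2 * ∑ j, Real.log (1 + inner ℝ t (y j)) -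
      n * (2 * inner ℝ t (sampleMean y) - inner ℝ t (sampleSecond y t))| ≤
      4 * n * ‖t‖ ^ 3 * sampleMean fun j => ‖y j‖ ^ 3 := by
  rw [inner_sampleMean, inner_sampleSecond, mul_sub, mul_left_comm, mul_sampleMean hn,
    mul_sampleMean hn, mul_assoc, mul_assoc, mul_left_comm (n : ℝ), mul_sampleMean hn,
    Finset.mul_sum, Finset.mul_sum, ← Finset.sum_sub_distrib, ← Finset.sum_sub_distrib,
    Finset.mul_sum, Finset.mul_sum]
  refine (Finset.abs_sum_le_sum_abs _ _).trans (Finset.sum_le_sum fun j _ => ?_)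
  have h1 := abs_log_one_add_sub_le (hs j)
  have h2 : |inner ℝ t (y j)| ^ 3 ≤ (‖t‖ * ‖y j‖) ^ 3 := by
    gcongr; exact abs_real_inner_le_norm t (y j)
  have h3 : 2 * Real.log (1 + inner ℝ t (y j)) - (2 * inner ℝ t (y j) - inner ℝ t (y j) ^ 2) =
      2 * (Real.log (1 + inner ℝ t (y j)) - (inner ℝ t (y j) - inner ℝ t (y j) ^ 2 / 2)) := by ring
  rw [h3, abs_mul, abs_two]
  nlinarith

end multiplier

/-! ### Asymptotics of the multiplier along a filter -/

/-- A continuous function does not separate bounded functions whose difference tends to zero. -/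
lemma tendsto_sub_of_continuous {I X Y : Type*} {l : Filter I} [NormedAddCommGroup X]
    [ProperSpace X] [SeminormedAddCommGroup Y] {F : X → Y} (hF : Continuous F) {a b : I → X} {M : ℝ}
    (hb : ∀ᶠ i in l, ‖b i‖ ≤ M) (hab : Tendsto (fun i => a i - b i) l (𝓝 0)) :
    Tendsto (fun i => F (a i) - F (b i)) l (𝓝 0) := by
  have hu := (isCompact_closedBall (0 : X) (M + 1)).uniformContinuousOn_of_continuous
    hF.continuousOn
  rw [Metric.uniformContinuousOn_iff] at hu
  rw [Metric.tendsto_nhds] at hab ⊢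
  intro ε hε
  obtain ⟨δ, hδ, h⟩ := hu ε hε
  filter_upwards [hb, hab (min δ 1) (by positivity)] with i h1 h2
  rw [dist_zero_right] at h2 ⊢
  have ha : ‖a i‖ ≤ M + 1 := by
    have := norm_add_le (b i) (a i - b i)
    rw [add_sub_cancel] at this
    linarith [min_le_right δ 1]
  rw [← dist_eq_norm]
  refine h _ (by simpa using ha) _ (by simp; linarith) ?_
  rw [dist_eq_norm]
  exact h2.trans_le (min_le_left _ _)

section array
variable {I : Type*} {l : Filter I} {n : I → ℕ} {r : ℕ} {y : ∀ i, Fin (n i) → E r}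
  {S Sinv : E r →L[ℝ] E r} {c C M : ℝ}

lemma tendsto_sqrt_atTop (hn : Tendsto n l atTop) : Tendsto (fun i => √(n i : ℝ)) l atTop :=
  Real.tendsto_sqrt_atTop.comp (tendsto_natCast_atTop_atTop.comp hn)

lemma tendsto_const_div_sqrt (hn : Tendsto n l atTop) (a : ℝ) :
    Tendsto (fun i => a / √(n i : ℝ)) l (𝓝 0) :=
  (tendsto_sqrt_atTop hn).const_div_atTop a

lemma eventually_pos (hn : Tendsto n l atTop) : ∀ᶠ i in l, 0 < n i := hn.eventually_gt_atTop 0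

/-- Bounded third moments make the maximum of a sample of smaller order than `√n`. -/
lemma eventually_norm_le (hn : Tendsto n l atTop)
    (h3 : ∀ᶠ i in l, sampleMean (fun j => ‖y i j‖ ^ 3) ≤ C) {ε : ℝ} (hε : 0 < ε) :
    ∀ᶠ i in l, ∀ j, ‖y i j‖ ≤ ε * √(n i : ℝ) := by
  filter_upwards [h3, (tendsto_sqrt_atTop hn).eventually_ge_atTop (C / ε ^ 3)] with i h1 h2 j
  refine (pow_le_pow_iff_left₀ (norm_nonneg _) (by positivity) three_ne_zero).1 ?_
  -- Each `‖yⱼ‖³` is at most the whole sum, hence at most `nC`, and `nC ≤ ε³ n^{3/2}` once `√n ≥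
  -- C/ε³`.
  have h4 := le_mul_sampleMean (y := fun j => ‖y i j‖ ^ 3) (fun j => by positivity) j
  have h5 : (n i : ℝ) = √(n i : ℝ) ^ 2 := (Real.sq_sqrt (by positivity)).symm
  rw [div_le_iff₀ (by positivity)] at h2
  calc ‖y i j‖ ^ 3 ≤ n i * sampleMean fun j => ‖y i j‖ ^ 3 := h4
    _ ≤ n i * (√(n i : ℝ) * ε ^ 3) := by gcongr; exact h1.trans h2
    _ = _ := by nth_rewrite 1 [h5]; ring

lemma eventually_coercive (hS : Tendsto (fun i => sampleSecond (y i)) l (𝓝 S)) (hc : 0 < c)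
    (hSc : ∀ v, c * ‖v‖ ^ 2 ≤ inner ℝ v (S v)) :
    ∀ᶠ i in l, ∀ v, c / 2 * ‖v‖ ^ 2 ≤ inner ℝ v (sampleSecond (y i) v) := by
  filter_upwards [(Metric.tendsto_nhds.1 hS) (c / 2) (by positivity)] with i hi v
  rw [dist_eq_norm] at hi
  have h1 : ‖inner ℝ v ((sampleSecond (y i) - S) v)‖ ≤ ‖v‖ * (c / 2 * ‖v‖) :=
    (norm_inner_le_norm _ _).trans (by
      gcongr; exact (ContinuousLinearMap.le_opNorm _ _).trans (by gcongr))
  rw [sub_apply, inner_sub_right, Real.norm_eq_abs] at h1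
  have := (abs_le.1 h1).1
  nlinarith [hSc v]

/-- Existence, size and uniqueness of the multiplier. -/
lemma eventually_hasMultiplier (hn : Tendsto n l atTop)
    (h3 : ∀ᶠ i in l, sampleMean (fun j => ‖y i j‖ ^ 3) ≤ C)
    (hS : Tendsto (fun i => sampleSecond (y i)) l (𝓝 S)) (hc : 0 < c)
    (hSc : ∀ v, c * ‖v‖ ^ 2 ≤ inner ℝ v (S v))
    (hm : ∀ᶠ i in l, ‖√(n i : ℝ) • sampleMean (y i)‖ ≤ M) :
    ∃ R, 0 < R ∧ ∀ᶠ i in l, IsMultiplier (y i) (multiplier (y i)) ∧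
      ‖√(n i : ℝ) • multiplier (y i)‖ ≤ R ∧
      ∀ j, |inner ℝ (multiplier (y i)) (y i j)| ≤ 1 / 2 := by
  -- With coercivity constant `c/2` and radius `R/√n`, the threshold in `exists_isMultiplier` is
  -- `(c/2)(R/√n)/3 = (|M|+1)/√n`, which exceeds the norm of the sample mean.
  set R := 6 * (|M| + 1) / c with hR
  have hRpos : 0 < R := by positivity
  refine ⟨R, hRpos, ?_⟩
  filter_upwards [hm, eventually_pos hn, eventually_coercive hS hc hSc,
    eventually_norm_le hn h3 (ε := 1 / (12 * R)) (by positivity)] with i h1 h0 h2 h4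
  have hs : 0 < √(n i : ℝ) := by positivity
  have hRb : R / √(n i : ℝ) * (1 / (12 * R) * √(n i : ℝ)) ≤ 1 / 12 := by
    field_simp; norm_num
  obtain ⟨t, ht, htR⟩ := exists_isMultiplier (c := c / 2) (R := R / √(n i : ℝ)) h0 h4
    (by positivity) hRb h2 (by
      rw [norm_smul, Real.norm_of_nonneg hs.le] at h1
      rw [← mul_lt_mul_iff_right₀ hs]
      refine h1.trans_lt ?_
      have : √(n i : ℝ) * (c / 2 * (R / √(n i : ℝ)) / 3) = |M| + 1 := by
        rw [hR]; field_simp; norm_num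
      rw [this]
      linarith [le_abs_self M])
  have hm := isMultiplier_multiplier ⟨t, ht⟩
  rw [hm.unique ht (c := c / 2) (by positivity) h0 h2]
  refine ⟨ht, ?_, fun j => abs_inner_le_of_norm_le htR.le (h4 j) (hRb.trans (by norm_num))⟩
  rw [norm_smul, Real.norm_of_nonneg hs.le]
  rw [lt_div_iff₀ hs] at htR
  linarith

/-- `√n t = S⁻¹ √n ȳ + o(1)` for the multiplier `t`. -/
lemma tendsto_multiplier_sub (hn : Tendsto n l atTop)
    (h3 : ∀ᶠ i in l, sampleMean (fun j => ‖y i j‖ ^ 3) ≤ C)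
    (hS : Tendsto (fun i => sampleSecond (y i)) l (𝓝 S)) (hc : 0 < c)
    (hSc : ∀ v, c * ‖v‖ ^ 2 ≤ inner ℝ v (S v)) (hinv : ∀ v, Sinv (S v) = v)
    (hm : ∀ᶠ i in l, ‖√(n i : ℝ) • sampleMean (y i)‖ ≤ M) :
    Tendsto (fun i => √(n i : ℝ) • multiplier (y i) - Sinv (√(n i : ℝ) • sampleMean (y i)))
      l (𝓝 0) := by
  obtain ⟨R, hR, hev⟩ := eventually_hasMultiplier hn h3 hS hc hSc hm
  have h1 : Tendsto (fun i => √(n i : ℝ) • sampleMean (y i) -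
      sampleSecond (y i) (√(n i : ℝ) • multiplier (y i))) l (𝓝 0) := by
    refine squeeze_zero_norm' ?_ (tendsto_const_div_sqrt hn (2 * R ^ 2 * C))
    filter_upwards [hev, h3, eventually_pos hn] with i hi h3i h0
    have hs : 0 < √(n i : ℝ) := by positivity
    have := hi.1.norm_sampleMean_sub_le hi.2.2
    rw [map_smul, ← smul_sub, norm_smul, Real.norm_of_nonneg hs.le, le_div_iff₀ hs]
    have h4 := hi.2.1
    rw [norm_smul, Real.norm_of_nonneg hs.le] at h4
    have hC : 0 ≤ sampleMean fun j => ‖y i j‖ ^ 3 := sampleMean_nonneg fun j => by positivity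
    calc _ ≤ √(n i : ℝ) * (2 * ‖multiplier (y i)‖ ^ 2 * C) * √(n i : ℝ) := by
          gcongr; exact this.trans (by gcongr)
      _ = 2 * (√(n i : ℝ) * ‖multiplier (y i)‖) ^ 2 * C := by ring
      _ ≤ _ := by have := hC.trans h3i; gcongr
  have h2 : Tendsto (fun i => (S - sampleSecond (y i)) (√(n i : ℝ) • multiplier (y i)))
      l (𝓝 0) := by
    refine squeeze_zero_norm' (a := fun i => ‖S - sampleSecond (y i)‖ * R) ?_ ?_
    · filter_upwards [hev] with i hi
      exact (ContinuousLinearMap.le_opNorm _ _).trans (by gcongr; exact hi.2.1)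
    · have : Tendsto (fun i => S - sampleSecond (y i)) l (𝓝 0) := by
        simpa using hS.const_sub S
      simpa using this.norm.mul_const R
  have h5 := (Sinv.continuous.tendsto 0).comp (h2.sub h1 |>.trans (by simp))
  simp only [map_zero] at h5
  refine h5.congr fun i => ?_
  simp only [Function.comp, sub_apply]
  rw [← hinv (√(n i : ℝ) • multiplier (y i))]
  simp only [hinv, map_sub]
  abel

/-- The empirical likelihood ratio is asymptotically a quadratic form in `√n ȳ`. -/
lemma tendsto_elLogLik_sub (hn : Tendsto n l atTop)
    (h3 : ∀ᶠ i in l, sampleMean (fun j => ‖y i j‖ ^ 3) ≤ C)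
    (hS : Tendsto (fun i => sampleSecond (y i)) l (𝓝 S)) (hc : 0 < c)
    (hSc : ∀ v, c * ‖v‖ ^ 2 ≤ inner ℝ v (S v)) (hinv : ∀ v, Sinv (S v) = v)
    (hinv' : ∀ v, S (Sinv v) = v)
    (hm : ∀ᶠ i in l, ‖√(n i : ℝ) • sampleMean (y i)‖ ≤ M) :
    Tendsto (fun i => -2 * elLogLik (y i) - inner ℝ (√(n i : ℝ) • sampleMean (y i))
      (Sinv (√(n i : ℝ) • sampleMean (y i)))) l (𝓝 0) := by
  obtain ⟨R, hR, hev⟩ := eventually_hasMultiplier hn h3 hS hc hSc hm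
  set τ := fun i => √(n i : ℝ) • multiplier (y i) with hτ
  set γ := fun i => √(n i : ℝ) • sampleMean (y i) with hγ
  have h1 : Tendsto (fun i => -2 * elLogLik (y i) -
      (2 * inner ℝ (τ i) (γ i) - inner ℝ (τ i) (sampleSecond (y i) (τ i)))) l (𝓝 0) := by
    refine squeeze_zero_norm' ?_ (tendsto_const_div_sqrt hn (4 * R ^ 3 * C))
    filter_upwards [hev, h3, eventually_pos hn] with i hi h3i h0
    have hs : 0 < √(n i : ℝ) := by positivity
    have h4 := hi.2.1
    rw [norm_smul, Real.norm_of_nonneg hs.le] at h4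
    have hC : 0 ≤ sampleMean fun j => ‖y i j‖ ^ 3 := sampleMean_nonneg fun j => by positivity
    have h5 := abs_sum_log_sub_le h0 hi.2.2
    have hsq : √(n i : ℝ) * √(n i : ℝ) = n i := Real.mul_self_sqrt (by positivity)
    have h6 : (n i : ℝ) * (2 * inner ℝ (multiplier (y i)) (sampleMean (y i)) -
        inner ℝ (multiplier (y i)) (sampleSecond (y i) (multiplier (y i)))) =
        2 * inner ℝ (τ i) (γ i) - inner ℝ (τ i) (sampleSecond (y i) (τ i)) := by
      simp only [hτ, hγ, map_smul, real_inner_smul_left, real_inner_smul_right]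
      linear_combination -(2 * inner ℝ (multiplier (y i)) (sampleMean (y i)) -
        inner ℝ (multiplier (y i)) (sampleSecond (y i) (multiplier (y i)))) * hsq
    rw [h6] at h5
    have h7 : -2 * elLogLik (y i) =
        2 * ∑ j, Real.log (1 + inner ℝ (multiplier (y i)) (y i j)) := by
      rw [elLogLik]; ring
    rw [h7, Real.norm_eq_abs, le_div_iff₀ hs]
    calc _ ≤ (4 * n i * ‖multiplier (y i)‖ ^ 3 * C) * √(n i : ℝ) := by
          gcongr; exact h5.trans (by gcongr)
      _ = 4 * (√(n i : ℝ) * ‖multiplier (y i)‖) ^ 3 * C := by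
          linear_combination -4 * ‖multiplier (y i)‖ ^ 3 * C * √(n i : ℝ) * hsq
      _ ≤ _ := by have := hC.trans h3i; gcongr
  have h2 := tendsto_multiplier_sub hn h3 hS hc hSc hinv hm
  have hprop : ProperSpace (E r →L[ℝ] E r) := FiniteDimensional.proper ℝ _
  have h8 := tendsto_sub_of_continuous (X := E r × E r × (E r →L[ℝ] E r)) (l := l)
    (F := fun x => 2 * inner ℝ x.1 x.2.1 - inner ℝ x.1 (x.2.2 x.1)) (by fun_prop)
    (a := fun i => (τ i, γ i, sampleSecond (y i))) (b := fun i => (Sinv (γ i), γ i, S))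
    (M := max (‖Sinv‖ * M) (max M ‖S‖)) (by
      filter_upwards [hm] with i hi
      simp only [Prod.norm_mk]
      gcongr
      exact (Sinv.le_opNorm _).trans (by gcongr))
    (by
      have : Tendsto (fun i => sampleSecond (y i) - S) l (𝓝 0) := by
        simpa using hS.sub_const S
      simp only [Prod.mk_sub_mk, sub_self]
      exact h2.prodMk_nhds (tendsto_const_nhds (x := (0 : E r)).prodMk_nhds this))
  refine ((h1.add h8).congr fun i => ?_).trans (by simp)
  simp only [hinv']
  rw [real_inner_comm (γ i) (Sinv (γ i))]
  ring

end array

/-! ### Pointwise consequences of the regularity conditions -/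

section pointwise
variable {k p r : ℕ} {g : E k → E p → E r} {F : Measure (E k)} {θ₀ θ : E p}
  {U : Set (E p)} {K₁ K₂ K₃ : E k → ℝ} {ρ : ℝ}

/-- A bound for the oscillation of `∂g/∂θ` on the ball of radius `ρ` around `θ₀`. -/
noncomputable def modulus (K₂ K₃ : E k → ℝ) (ρ : ℝ) (x : E k) : ℝ := min (2 * K₂ x) (ρ * K₃ x)

namespace Regular
variable (h : Regular g F θ₀ U K₁ K₂ K₃)
include h

lemma K₁_nonneg (x : E k) : 0 ≤ K₁ x := le_trans (by positivity) (h.bound_g x θ₀ h.mem)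

lemma K₂_nonneg (x : E k) : 0 ≤ K₂ x := le_trans (by positivity) (h.bound_G x θ₀ h.mem)

lemma K₃_nonneg (x : E k) : 0 ≤ K₃ x := le_trans (by positivity) (h.bound_dG x θ₀ h.mem)

lemma hasFDerivAt (x : E k) (hθ : θ ∈ U) : HasFDerivAt (g x) (fderiv ℝ (g x) θ) θ :=
  (((h.contDiff x).differentiableOn two_ne_zero).differentiableAt
    (h.isOpen.mem_nhds hθ)).hasFDerivAt

lemma hasFDerivAt_fderiv (x : E k) (hθ : θ ∈ U) :
    HasFDerivAt (fderiv ℝ (g x)) (fderiv ℝ (fderiv ℝ (g x)) θ) θ := by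
  have h1 : ContDiffOn ℝ 1 (fderiv ℝ (g x)) U :=
    (h.contDiff x).fderiv_of_isOpen h.isOpen (by norm_num)
  exact ((h1.differentiableOn one_ne_zero).differentiableAt (h.isOpen.mem_nhds hθ)).hasFDerivAt

lemma norm_sub_le (hρ : Metric.closedBall θ₀ ρ ⊆ U) (x : E k) (hθ : θ ∈ Metric.closedBall θ₀ ρ) :
    ‖g x θ - g x θ₀‖ ≤ K₂ x * ‖θ - θ₀‖ := by
  have h0 : 0 ≤ ρ := dist_nonneg.trans hθ
  exact (convex_closedBall θ₀ ρ).norm_image_sub_le_of_norm_hasFDerivWithin_le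
    (fun z hz => (h.hasFDerivAt x (hρ hz)).hasFDerivWithinAt)
    (fun z hz => h.bound_G x z (hρ hz)) (by simpa using h0) hθ

/-- The minimum serves two purposes: `2K₂` is an envelope whose means under the alternatives
converge, whereas `K₃` is integrable only under the limit law; `ρK₃` makes the limiting mean small
with `ρ`. -/
lemma norm_fderiv_sub_le (hρ : Metric.closedBall θ₀ ρ ⊆ U) (x : E k)
    (hθ : θ ∈ Metric.closedBall θ₀ ρ) :
    ‖fderiv ℝ (g x) θ - fderiv ℝ (g x) θ₀‖ ≤ modulus K₂ K₃ ρ x := by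
  have h0 : 0 ≤ ρ := dist_nonneg.trans hθ
  refine le_min ?_ ?_
  · refine (_root_.norm_sub_le _ _).trans ?_
    linarith [h.bound_G x θ (hρ hθ), h.bound_G x θ₀ h.mem]
  · refine ((convex_closedBall θ₀ ρ).norm_image_sub_le_of_norm_hasFDerivWithin_le
      (fun z hz => (h.hasFDerivAt_fderiv x (hρ hz)).hasFDerivWithinAt)
      (fun z hz => h.bound_dG x z (hρ hz)) (by simpa using h0) hθ).trans ?_
    rw [mul_comm]
    have := h.K₃_nonneg x
    gcongr
    simpa [dist_eq_norm] using hθ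

lemma norm_sub_sub_le (hρ : Metric.closedBall θ₀ ρ ⊆ U) (x : E k)
    (hθ : θ ∈ Metric.closedBall θ₀ ρ) :
    ‖g x θ - g x θ₀ - fderiv ℝ (g x) θ₀ (θ - θ₀)‖ ≤ modulus K₂ K₃ ρ x * ‖θ - θ₀‖ := by
  have h0 : 0 ≤ ρ := dist_nonneg.trans hθ
  exact (convex_closedBall θ₀ ρ).norm_image_sub_le_of_norm_hasFDerivWithin_le'
    (fun z hz => (h.hasFDerivAt x (hρ hz)).hasFDerivWithinAt)
    (fun z hz => h.norm_fderiv_sub_le hρ x hz) (by simpa using h0) hθ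

lemma norm_sq_le (x : E k) (hθ : θ ∈ U) : ‖g x θ‖ ^ 2 ≤ 1 + K₁ x := by
  have h1 := h.bound_g x θ hθ
  have h2 := norm_nonneg (g x θ)
  rcases le_total (‖g x θ‖) 1 with h3 | h3
  · nlinarith [h.K₁_nonneg x]
  · nlinarith [sq_nonneg ‖g x θ‖, pow_le_pow_right₀ h3 (show 2 ≤ 3 by norm_num)]

lemma norm_sampleMean_sub_sub_le {n : ℕ} (hρ : Metric.closedBall θ₀ ρ ⊆ U) (x : Fin n → E k)
    (hθ : θ ∈ Metric.closedBall θ₀ ρ) :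
    ‖sampleMean (fun j => g (x j) θ) - sampleMean (fun j => g (x j) θ₀) -
      sampleMean (fun j => fderiv ℝ (g (x j)) θ₀) (θ - θ₀)‖ ≤
      sampleMean (fun j => modulus K₂ K₃ ρ (x j)) * ‖θ - θ₀‖ := by
  have h1 : sampleMean (fun j => fderiv ℝ (g (x j)) θ₀) (θ - θ₀) =
      sampleMean fun j => fderiv ℝ (g (x j)) θ₀ (θ - θ₀) :=
    sampleMean_map (ContinuousLinearMap.apply ℝ (E r) (θ - θ₀)).toLinearMap _
  rw [h1, ← sampleMean_sub, ← sampleMean_sub, mul_comm, ← sampleMean_mul_left]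
  refine (norm_sampleMean_le _).trans (sampleMean_mono fun j => ?_)
  rw [mul_comm]
  exact h.norm_sub_sub_le hρ _ hθ

end Regular

end pointwise

/-! ### Asymptotics near the true parameter along a filter -/

/-- The limit behaviour of the samples `x i` along a filter: convergence or boundedness of the
sample means of the estimating function, of its derivative, and of the envelopes. -/
structure SampleLimits {I : Type*} {k p r : ℕ} (g : E k → E p → E r) (θ₀ : E p)
    (K₁ K₂ K₃ : E k → ℝ) (l : Filter I) (n : I → ℕ) (x : ∀ i, Fin (n i) → E k)
    (S : E r →L[ℝ] E r) (D : E p →L[ℝ] E r) (κ C M : ℝ) : Prop where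
  size : Tendsto n l atTop
  mean_K₁ : ∀ᶠ i in l, sampleMean (fun j => K₁ (x i j)) ≤ C
  mean_K₂ : ∀ᶠ i in l, sampleMean (fun j => K₂ (x i j)) ≤ C
  second : Tendsto (fun i => sampleSecond fun j => g (x i j) θ₀) l (𝓝 S)
  deriv : Tendsto (fun i => sampleMean fun j => fderiv ℝ (g (x i j)) θ₀) l (𝓝 D)
  -- In the application `κ` is the mean of `K₃` under `F`, and `ε` absorbs the fluctuation of the
  -- sample mean.
  mean_modulus : ∀ ρ > 0, ∀ ε > 0,
    ∀ᶠ i in l, sampleMean (fun j => modulus K₂ K₃ ρ (x i j)) ≤ ρ * κ + ε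
  bounded : ∀ᶠ i in l, ‖√(n i : ℝ) • sampleMean fun j => g (x i j) θ₀‖ ≤ M

namespace SampleLimits
variable {I : Type*} {k p r : ℕ} {g : E k → E p → E r} {θ₀ : E p}
    {K₁ K₂ K₃ : E k → ℝ} {l : Filter I} {n : I → ℕ} {x : ∀ i, Fin (n i) → E k}
    {S Sinv : E r →L[ℝ] E r} {D : E p →L[ℝ] E r} {κ C M M' c : ℝ}
    {F : Measure (E k)} {U : Set (E p)} {θ : I → E p}

lemma eventually_mem_closedBall (hs : SampleLimits g θ₀ K₁ K₂ K₃ l n x S D κ C M)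
    (hθ : ∀ᶠ i in l, ‖√(n i : ℝ) • (θ i - θ₀)‖ ≤ M') {ρ : ℝ} (hρ : 0 < ρ) :
    ∀ᶠ i in l, θ i ∈ Metric.closedBall θ₀ ρ := by
  filter_upwards [hθ, eventually_pos hs.size,
    (tendsto_const_div_sqrt hs.size M').eventually_le_const hρ] with i h1 h0 h2
  have hs : 0 < √(n i : ℝ) := by positivity
  rw [norm_smul, Real.norm_of_nonneg hs.le, mul_comm, ← le_div_iff₀ hs] at h1
  rw [Metric.mem_closedBall, dist_eq_norm]
  exact h1.trans h2

lemma eventually_mean_norm_pow (hs : SampleLimits g θ₀ K₁ K₂ K₃ l n x S D κ C M)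
    (h : Regular g F θ₀ U K₁ K₂ K₃) (hU : ∀ᶠ i in l, θ i ∈ U) :
    ∀ᶠ i in l, sampleMean (fun j => ‖g (x i j) (θ i)‖ ^ 3) ≤ C := by
  filter_upwards [hU, hs.mean_K₁] with i h1 h2
  exact (sampleMean_mono fun j => h.bound_g _ _ h1).trans h2

lemma eventually_norm_le (hs : SampleLimits g θ₀ K₁ K₂ K₃ l n x S D κ C M)
    (h : Regular g F θ₀ U K₁ K₂ K₃) (hU : ∀ᶠ i in l, θ i ∈ U) {ε : ℝ} (hε : 0 < ε) :
    ∀ᶠ i in l, ∀ j, ‖g (x i j) (θ i)‖ ≤ ε * √(n i : ℝ) :=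
  EmpPhi.eventually_norm_le hs.size (hs.eventually_mean_norm_pow h hU) hε

/-- The maximum of `‖g‖` over the sample is `o(√n)`, while the increments are at most `K₂ ‖θ - θ₀‖`
with `‖θ - θ₀‖ = O(n^{-1/2})`. Thus only the mean of `K₂` enters, and no integrability of the
product `‖g‖ K₂` is needed. -/
lemma tendsto_mean_mul_norm_sub (hs : SampleLimits g θ₀ K₁ K₂ K₃ l n x S D κ C M)
    (h : Regular g F θ₀ U K₁ K₂ K₃) (hθ : ∀ᶠ i in l, ‖√(n i : ℝ) • (θ i - θ₀)‖ ≤ M') :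
    Tendsto (fun i => sampleMean fun j => (‖g (x i j) (θ i)‖ + ‖g (x i j) θ₀‖) *
      ‖g (x i j) (θ i) - g (x i j) θ₀‖) l (𝓝 0) := by
  obtain ⟨ρ, hρ, hρU⟩ := Metric.nhds_basis_closedBall.mem_iff.1 (h.isOpen.mem_nhds h.mem)
  have hball := hs.eventually_mem_closedBall hθ hρ
  have hmem : ∀ᶠ i in l, θ i ∈ U := hball.mono fun i hi => hρU hi
  refine Metric.tendsto_nhds.2 fun ε hε => ?_
  set η := ε / (4 * (|C| + 1) * (|M'| + 1)) with hη
  have hηpos : 0 < η := by positivity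
  filter_upwards [hθ, hs.eventually_norm_le h hmem hηpos,
    hs.eventually_norm_le h (θ := fun _ => θ₀) (Eventually.of_forall fun _ => h.mem) hηpos,
    hball, hs.mean_K₂] with i h1 h2 h3 h4 h5
  have hnn : 0 ≤ sampleMean fun j => (‖g (x i j) (θ i)‖ + ‖g (x i j) θ₀‖) *
      ‖g (x i j) (θ i) - g (x i j) θ₀‖ := sampleMean_nonneg fun j => by positivity
  rw [Real.dist_eq, sub_zero, abs_of_nonneg hnn]
  rw [norm_smul, Real.norm_of_nonneg (Real.sqrt_nonneg _)] at h1
  have hK : 0 ≤ sampleMean fun j => K₂ (x i j) := sampleMean_nonneg fun j => h.K₂_nonneg _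
  calc _ ≤ sampleMean fun j => (2 * η * √(n i : ℝ) * ‖θ i - θ₀‖) * K₂ (x i j) := by
        refine sampleMean_mono fun j => ?_
        have := h.K₂_nonneg (x i j)
        calc _ ≤ (η * √(n i : ℝ) + η * √(n i : ℝ)) * (K₂ (x i j) * ‖θ i - θ₀‖) := by
              gcongr
              exacts [h2 j, h3 j, h.norm_sub_le hρU _ h4]
          _ = _ := by ring
    _ = 2 * η * (√(n i : ℝ) * ‖θ i - θ₀‖) * sampleMean fun j => K₂ (x i j) := by
        rw [sampleMean_mul_left]; ring
    _ ≤ 2 * η * (|M'| + 1) * (|C| + 1) := by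
        gcongr
        · linarith [le_abs_self M']
        · linarith [le_abs_self C]
    _ = ε / 2 := by rw [hη]; field_simp; norm_num
    _ < ε := by linarith

lemma tendsto_mean_norm_sub_sq (hs : SampleLimits g θ₀ K₁ K₂ K₃ l n x S D κ C M)
    (h : Regular g F θ₀ U K₁ K₂ K₃) (hθ : ∀ᶠ i in l, ‖√(n i : ℝ) • (θ i - θ₀)‖ ≤ M') :
    Tendsto (fun i => sampleMean fun j => ‖g (x i j) (θ i) - g (x i j) θ₀‖ ^ 2) l (𝓝 0) :=
  squeeze_zero (fun i => sampleMean_nonneg fun j => by positivity)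
    (fun i => sampleMean_mono fun j => by
      rw [pow_two]; gcongr; exact norm_sub_le _ _) (hs.tendsto_mean_mul_norm_sub h hθ)

/-- The splitting `a ⊗ a - b ⊗ b = a ⊗ (a - b) + (a - b) ⊗ b` bounds the change of the second moment
operator by the mean just estimated. -/
lemma tendsto_sampleSecond (hs : SampleLimits g θ₀ K₁ K₂ K₃ l n x S D κ C M)
    (h : Regular g F θ₀ U K₁ K₂ K₃) (hθ : ∀ᶠ i in l, ‖√(n i : ℝ) • (θ i - θ₀)‖ ≤ M') :
    Tendsto (fun i => sampleSecond fun j => g (x i j) (θ i)) l (𝓝 S) := by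
  have h1 : Tendsto (fun i => (sampleSecond fun j => g (x i j) (θ i)) -
      sampleSecond fun j => g (x i j) θ₀) l (𝓝 0) := by
    refine squeeze_zero_norm (fun i => ?_) (hs.tendsto_mean_mul_norm_sub h hθ)
    rw [sampleSecond, sampleSecond, ← sampleMean_sub]
    refine (norm_sampleMean_le _).trans (sampleMean_mono fun j => ?_)
    set a := g (x i j) (θ i)
    set b := g (x i j) θ₀
    have : (innerSL ℝ a).smulRight a - (innerSL ℝ b).smulRight b =
        (innerSL ℝ a).smulRight (a - b) + (innerSL ℝ (a - b)).smulRight b := by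
      ext1 v
      simp [smul_sub, sub_smul]
    rw [this]
    refine (norm_add_le _ _).trans (le_of_eq ?_)
    simp only [ContinuousLinearMap.norm_smulRight_apply, innerSL_apply_norm]
    ring
  simpa using h1.add hs.second

/-- Local linearity of the estimating equations. -/
lemma tendsto_sampleMean_sub (hs : SampleLimits g θ₀ K₁ K₂ K₃ l n x S D κ C M)
    (h : Regular g F θ₀ U K₁ K₂ K₃) (hκ : 0 ≤ κ)
    (hθ : ∀ᶠ i in l, ‖√(n i : ℝ) • (θ i - θ₀)‖ ≤ M') :
    Tendsto (fun i => √(n i : ℝ) • sampleMean (fun j => g (x i j) (θ i)) -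
      (√(n i : ℝ) • sampleMean (fun j => g (x i j) θ₀) + D (√(n i : ℝ) • (θ i - θ₀))))
      l (𝓝 0) := by
  obtain ⟨ρ, hρ, hρU⟩ := Metric.nhds_basis_closedBall.mem_iff.1 (h.isOpen.mem_nhds h.mem)
  refine Metric.tendsto_nhds.2 fun ε hε => ?_
  -- Three errors of size `η ‖√n(θ - θ₀)‖` occur: `δκ`, the slack in the mean modulus, and the
  -- distance from the mean derivative to `D`. Together they stay below `3ε/4`.
  set η := ε / (4 * (|M'| + 1)) with hη
  have hηpos : 0 < η := by positivity
  set δ := min ρ (η / (κ + 1)) with hδ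
  have hδpos : 0 < δ := by positivity
  have hδη : δ * κ ≤ η := by
    calc δ * κ ≤ η / (κ + 1) * (κ + 1) := by gcongr; exacts [min_le_right _ _, by linarith]
      _ = η := by field_simp
  filter_upwards [hθ, hs.eventually_mem_closedBall hθ hδpos, hs.mean_modulus δ hδpos η hηpos,
    (Metric.tendsto_nhds.1 hs.deriv) η hηpos] with i h1 h2 h3 h4
  rw [dist_eq_norm] at h4
  rw [dist_zero_right]
  set s := √(n i : ℝ)
  have hs0 : 0 ≤ s := Real.sqrt_nonneg _
  have h5 := h.norm_sampleMean_sub_sub_le ((Metric.closedBall_subset_closedBall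
    (min_le_left _ _)).trans hρU) (x i) h2
  set G := sampleMean fun j => fderiv ℝ (g (x i j)) θ₀
  set a := sampleMean fun j => g (x i j) (θ i)
  set b := sampleMean fun j => g (x i j) θ₀
  have h6 : s • a - (s • b + D (s • (θ i - θ₀))) =
      s • (a - b - G (θ i - θ₀)) + (G - D) (s • (θ i - θ₀)) := by
    rw [sub_apply, map_smul G, smul_sub s (a - b), smul_sub s a b]; abel
  rw [h6]
  have h7 : ‖s • (a - b - G (θ i - θ₀))‖ ≤ 2 * η * ‖s • (θ i - θ₀)‖ := by
    rw [norm_smul, norm_smul, mul_left_comm]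
    gcongr
    exact h5.trans (by gcongr; linarith)
  have h8 : ‖(G - D) (s • (θ i - θ₀))‖ ≤ η * ‖s • (θ i - θ₀)‖ :=
    (ContinuousLinearMap.le_opNorm _ _).trans (by gcongr)
  calc _ ≤ 2 * η * ‖s • (θ i - θ₀)‖ + η * ‖s • (θ i - θ₀)‖ :=
        (norm_add_le _ _).trans (add_le_add h7 h8)
    _ = 3 * η * ‖s • (θ i - θ₀)‖ := by ring
    _ ≤ 3 * η * (|M'| + 1) := by gcongr; linarith [le_abs_self M']
    _ = 3 / 4 * ε := by rw [hη]; field_simp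
    _ < ε := by linarith

lemma eventually_norm_sampleMean_le (hs : SampleLimits g θ₀ K₁ K₂ K₃ l n x S D κ C M)
    (h : Regular g F θ₀ U K₁ K₂ K₃) (hκ : 0 ≤ κ)
    (hθ : ∀ᶠ i in l, ‖√(n i : ℝ) • (θ i - θ₀)‖ ≤ M') :
    ∀ᶠ i in l, ‖√(n i : ℝ) • sampleMean (fun j => g (x i j) (θ i))‖ ≤ 1 + (M + ‖D‖ * M') := by
  filter_upwards [(Metric.tendsto_nhds.1 (hs.tendsto_sampleMean_sub h hκ hθ)) 1 one_pos, hθ,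
    hs.bounded] with i h1 h2 h3
  rw [dist_zero_right] at h1
  refine (norm_le_norm_sub_add _ (√(n i : ℝ) • sampleMean (fun j => g (x i j) θ₀) +
    D (√(n i : ℝ) • (θ i - θ₀)))).trans (add_le_add h1.le ?_)
  exact (norm_add_le _ _).trans (add_le_add h3
    ((ContinuousLinearMap.le_opNorm _ _).trans (by gcongr)))

lemma eventually_mem (hs : SampleLimits g θ₀ K₁ K₂ K₃ l n x S D κ C M)
    (h : Regular g F θ₀ U K₁ K₂ K₃) (hθ : ∀ᶠ i in l, ‖√(n i : ℝ) • (θ i - θ₀)‖ ≤ M') :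
    ∀ᶠ i in l, θ i ∈ U := by
  obtain ⟨ρ, hρ, hρU⟩ := Metric.nhds_basis_closedBall.mem_iff.1 (h.isOpen.mem_nhds h.mem)
  exact (hs.eventually_mem_closedBall hθ hρ).mono fun i hi => hρU hi

/-- Local quadratic expansion of the empirical likelihood. -/
lemma tendsto_elLogLik (hs : SampleLimits g θ₀ K₁ K₂ K₃ l n x S D κ C M)
    (h : Regular g F θ₀ U K₁ K₂ K₃) (hκ : 0 ≤ κ) (hc : 0 < c)
    (hSc : ∀ v, c * ‖v‖ ^ 2 ≤ inner ℝ v (S v)) (hinv : ∀ v, Sinv (S v) = v)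
    (hinv' : ∀ v, S (Sinv v) = v)
    (hθ : ∀ᶠ i in l, ‖√(n i : ℝ) • (θ i - θ₀)‖ ≤ M') :
    Tendsto (fun i => -2 * elLogLik (fun j => g (x i j) (θ i)) -
      inner ℝ (√(n i : ℝ) • sampleMean (fun j => g (x i j) θ₀) + D (√(n i : ℝ) • (θ i - θ₀)))
      (Sinv (√(n i : ℝ) • sampleMean (fun j => g (x i j) θ₀) + D (√(n i : ℝ) • (θ i - θ₀)))))
      l (𝓝 0) := by
  have h1 := tendsto_elLogLik_sub hs.size
    (hs.eventually_mean_norm_pow h (hs.eventually_mem h hθ)) (hs.tendsto_sampleSecond h hθ) hc hSc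
    hinv hinv' (hs.eventually_norm_sampleMean_le h hκ hθ)
  have h2 := tendsto_sub_of_continuous (X := E r) (l := l)
    (F := fun v => inner ℝ v (Sinv v)) (by fun_prop) (M := M + ‖D‖ * M') (by
      filter_upwards [hs.bounded, hθ] with i h3 h4
      exact (norm_add_le _ _).trans (add_le_add h3
        ((ContinuousLinearMap.le_opNorm _ _).trans (by gcongr))))
    (hs.tendsto_sampleMean_sub h hκ hθ)
  refine ((h1.add h2).congr fun i => ?_).trans (by simp)
  ring

/-- Root-`n` consistency of the localized empirical maximum likelihood estimator. -/
lemma eventually_norm_emle_le (hs : SampleLimits g θ₀ K₁ K₂ K₃ l n x S D κ C M)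
    (h : Regular g F θ₀ U K₁ K₂ K₃) (hκ : 0 ≤ κ) (hc : 0 < c)
    (hSc : ∀ v, c * ‖v‖ ^ 2 ≤ inner ℝ v (S v)) (hinv : ∀ v, Sinv (S v) = v)
    (hinv' : ∀ v, S (Sinv v) = v) {ρ₀ c₀ : ℝ} (hρ₀ : 0 < ρ₀) (hρU : Metric.closedBall θ₀ ρ₀ ⊆ U)
    (hc₀ : 0 < c₀) (hD : ∀ v, c₀ * ‖v‖ ≤ ‖D v‖) (hρκ : ρ₀ * κ ≤ c₀ / 4)
    (hθball : ∀ᶠ i in l, θ i ∈ Metric.closedBall θ₀ ρ₀)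
    (hθmul : ∀ᶠ i in l, HasMultiplier fun j => g (x i j) (θ i))
    (hle : ∀ᶠ i in l, elLogLik (fun j => g (x i j) θ₀) ≤ elLogLik (fun j => g (x i j) (θ i))) :
    ∃ M', ∀ᶠ i in l, ‖√(n i : ℝ) • (θ i - θ₀)‖ ≤ M' := by
  have hU : ∀ᶠ i in l, θ i ∈ U := hθball.mono fun i hi => hρU hi
  have h1 := hs.tendsto_elLogLik h hκ hc hSc hinv hinv' (θ := fun _ => θ₀) (M' := 0)
    (Eventually.of_forall fun i => by simp)
  simp only [sub_self, smul_zero, map_zero, add_zero] at h1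
  set A := 1 + M * (‖Sinv‖ * M) with hA
  have hl0 : ∀ᶠ i in l, -2 * elLogLik (fun j => g (x i j) θ₀) ≤ A := by
    filter_upwards [(Metric.tendsto_nhds.1 h1) 1 one_pos, hs.bounded] with i h2 h3
    rw [dist_zero_right, Real.norm_eq_abs] at h2
    have h4 := (abs_lt.1 h2).2
    set W := √(n i : ℝ) • sampleMean (fun j => g (x i j) θ₀)
    have h5 : inner ℝ W (Sinv W) ≤ M * (‖Sinv‖ * M) :=
      (real_inner_le_norm _ _).trans (mul_le_mul h3 ((Sinv.le_opNorm _).trans (by gcongr))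
        (norm_nonneg _) ((norm_nonneg _).trans h3))
    linarith
  refine ⟨2 * (A / 2 + (1 + C) + M) / c₀, ?_⟩
  filter_upwards [hl0, hs.bounded, hθball, hθmul, hle, hs.mean_K₁, eventually_pos hs.size,
    hs.eventually_norm_le h hU (ε := 1 / 4) (by norm_num),
    hs.mean_modulus ρ₀ hρ₀ (c₀ / 8) (by positivity),
    (Metric.tendsto_nhds.1 hs.deriv) (c₀ / 8) (by positivity)] with i i1 i2 i3 i4 i5 i6 i7 i8 i9 i10
  set s := √(n i : ℝ) with hsdef
  have hs0 : 0 < s := by positivity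
  have hss : s * s = n i := Real.mul_self_sqrt (by positivity)
  set a := sampleMean fun j => g (x i j) (θ i) with ha
  -- The log-likelihood at `θhat` is no worse than at `θ₀`, so the dual maximum there is at most
  -- `A/2`; any admissible test vector bounds it from below.
  have hbound : s * ‖a‖ ≤ A / 2 + (1 + C) := by
    -- The test vector has the direction of `a` and length `n^{-1/2}`, so that `|tᵀg| ≤ 1/4` by the
    -- maximum bound; for `a = 0` it is zero, since `0⁻¹ = 0`. Its linear gain is `√n ‖a‖` and its
    -- quadratic loss at most `1 + C`.
    set t := (s⁻¹ * ‖a‖⁻¹) • a with ht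
    have htn : ‖t‖ ≤ s⁻¹ := by
      rw [ht, norm_smul, norm_mul, norm_inv, norm_inv, norm_norm, Real.norm_of_nonneg hs0.le,
        mul_assoc]
      exact mul_le_of_le_one_right (by positivity) inv_mul_le_one
    have habs : ∀ j, |inner ℝ t (g (x i j) (θ i))| ≤ 1 / 4 := fun j =>
      abs_inner_le_of_norm_le htn (i8 j) (by field_simp; rfl)
    have h2 := (isMultiplier_multiplier i4).sum_log_le (s := t) fun j => by
      linarith [(abs_le.1 (habs j)).1]
    have h3 : n i * (inner ℝ t a - inner ℝ t (sampleSecond (fun j => g (x i j) (θ i)) t)) ≤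
        ∑ j, Real.log (1 + inner ℝ t (g (x i j) (θ i))) := by
      rw [inner_sampleMean, inner_sampleSecond, mul_sub, mul_sampleMean i7,
        mul_sampleMean i7, ← Finset.sum_sub_distrib]
      exact Finset.sum_le_sum fun j _ => sub_sq_le_log_one_add (habs j)
    have h4 : inner ℝ t a = s⁻¹ * ‖a‖ := by
      rw [ht, real_inner_smul_left, real_inner_self_eq_norm_sq]
      rcases eq_or_ne ‖a‖ 0 with h0 | h0
      · simp [h0]
      · field_simp
    have h5 : inner ℝ t (sampleSecond (fun j => g (x i j) (θ i)) t) ≤ s⁻¹ ^ 2 * (1 + C) := by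
      rw [inner_sampleSecond]
      calc _ ≤ sampleMean fun j => s⁻¹ ^ 2 * (1 + K₁ (x i j)) := by
            refine sampleMean_mono fun j => ?_
            have h6 := abs_real_inner_le_norm t (g (x i j) (θ i))
            have h7 := h.norm_sq_le (x i j) (hρU i3)
            calc _ = |inner ℝ t (g (x i j) (θ i))| ^ 2 := (sq_abs _).symm
              _ ≤ (‖t‖ * ‖g (x i j) (θ i)‖) ^ 2 := by gcongr
              _ = ‖t‖ ^ 2 * ‖g (x i j) (θ i)‖ ^ 2 := by ring
              _ ≤ _ := by gcongr
        _ ≤ _ := by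
            rw [sampleMean_mul_left, sampleMean_add, sampleMean_const i7]
            gcongr
    have h6 : ∑ j, Real.log (1 + inner ℝ (multiplier fun j => g (x i j) (θ i))
        (g (x i j) (θ i))) ≤ A / 2 := by
      have : elLogLik (fun j => g (x i j) (θ i)) = -∑ j, Real.log (1 + inner ℝ
        (multiplier fun j => g (x i j) (θ i)) (g (x i j) (θ i))) := rfl
      linarith
    have h7 : s * ‖a‖ - (1 + C) ≤ n i * (inner ℝ t a -
        inner ℝ t (sampleSecond (fun j => g (x i j) (θ i)) t)) := by
      rw [h4, ← hss]
      calc _ = s * s * (s⁻¹ * ‖a‖ - s⁻¹ ^ 2 * (1 + C)) := by field_simp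
        _ ≤ _ := by gcongr
    linarith
  have h2 := h.norm_sampleMean_sub_sub_le hρU (x i) i3
  rw [dist_eq_norm] at i10
  set G := sampleMean fun j => fderiv ℝ (g (x i j)) θ₀
  set b := sampleMean fun j => g (x i j) θ₀
  have h3 : D (θ i - θ₀) = a - b - (a - b - G (θ i - θ₀)) - (G - D) (θ i - θ₀) := by
    simp only [sub_apply]; abel
  -- The mean modulus is at most `ρ₀κ + c₀/8 ≤ 3c₀/8`, and `G - D` contributes `c₀/8`. The total
  -- `c₀/2` is half the lower bound `c₀` of `D`, so the error is absorbed on the left.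
  have h4 : ‖D (θ i - θ₀)‖ ≤ ‖a‖ + ‖b‖ + 3 / 8 * c₀ * ‖θ i - θ₀‖ + c₀ / 8 * ‖θ i - θ₀‖ := by
    rw [h3]
    refine (norm_sub_le _ _).trans (add_le_add ((norm_sub_le _ _).trans
      (add_le_add (norm_sub_le _ _) (h2.trans ?_))) ?_)
    · gcongr; linarith
    · exact (ContinuousLinearMap.le_opNorm _ _).trans (by gcongr)
  have h5 : c₀ / 2 * ‖θ i - θ₀‖ ≤ ‖a‖ + ‖b‖ := by linarith [hD (θ i - θ₀)]
  rw [norm_smul, Real.norm_of_nonneg hs0.le] at i2 ⊢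
  rw [le_div_iff₀ hc₀]
  have : s * (c₀ / 2 * ‖θ i - θ₀‖) ≤ s * (‖a‖ + ‖b‖) := by gcongr
  linarith

/-- Asymptotic linearity of the localized empirical maximum likelihood estimator. -/
lemma tendsto_emle_sub (hs : SampleLimits g θ₀ K₁ K₂ K₃ l n x S D κ C M)
    (h : Regular g F θ₀ U K₁ K₂ K₃) (hκ : 0 ≤ κ) (hc : 0 < c)
    (hSc : ∀ v, c * ‖v‖ ^ 2 ≤ inner ℝ v (S v)) (hinv : ∀ v, Sinv (S v) = v)
    (hinv' : ∀ v, S (Sinv v) = v) (hsym : ∀ u v, inner ℝ u (Sinv v) = inner ℝ v (Sinv u))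
    {N : E r →L[ℝ] E p} (hN : ∀ v w, inner ℝ (D v) (Sinv (w + D (N w))) = 0)
    {c₁ : ℝ} (hc₁ : 0 < c₁) (hD₁ : ∀ v, c₁ * ‖v‖ ^ 2 ≤ inner ℝ (D v) (Sinv (D v)))
    (hθ : ∀ᶠ i in l, ‖√(n i : ℝ) • (θ i - θ₀)‖ ≤ M') {A : I → Set (E p)}
    (hA : ∀ R, ∀ᶠ i in l, ∀ θ, ‖√(n i : ℝ) • (θ - θ₀)‖ ≤ R → θ ∈ A i)
    (hEMLE : ∀ᶠ i in l, IsEMLE g (x i) (A i) (θ i)) :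
    Tendsto (fun i => √(n i : ℝ) • (θ i - θ₀) -
      N (√(n i : ℝ) • sampleMean fun j => g (x i j) θ₀)) l (𝓝 0) := by
  set W := fun i => √(n i : ℝ) • sampleMean fun j => g (x i j) θ₀ with hW
  set q : E p → E r → ℝ := fun h w => inner ℝ (w + D h) (Sinv (w + D h)) with hq
  -- `N w` satisfies the normal equations, so the cross term in the square completed around it
  -- vanishes.
  have hqq : ∀ v w, q v w - q (N w) w = inner ℝ (D (v - N w)) (Sinv (D (v - N w))) := by
    intro v w
    have e1 : w + D v = (w + D (N w)) + D (v - N w) := by rw [map_sub]; abel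
    simp only [hq]
    rw [e1, map_add Sinv, inner_add_left, inner_add_right, inner_add_right,
      hsym (w + D (N w)) (D (v - N w)), hN]
    ring
  -- The minimizer of the limiting quadratic form, used as a competitor of the estimator.
  set θs : I → E p := fun i => θ₀ + (√(n i : ℝ))⁻¹ • N (W i) with hθs
  have hθs1 : ∀ᶠ i in l, √(n i : ℝ) • (θs i - θ₀) = N (W i) := by
    filter_upwards [eventually_pos hs.size] with i hi
    have : √(n i : ℝ) ≠ 0 := by positivity
    simp [hθs, smul_smul, this]
  have hθs2 : ∀ᶠ i in l, ‖√(n i : ℝ) • (θs i - θ₀)‖ ≤ ‖N‖ * M := by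
    filter_upwards [hθs1, hs.bounded] with i h1 h2
    rw [h1]
    exact (N.le_opNorm _).trans (by gcongr)
  have t1 := hs.tendsto_elLogLik h hκ hc hSc hinv hinv' hθ
  have t2 := hs.tendsto_elLogLik h hκ hc hSc hinv hinv' hθs2
  have hmul := (eventually_hasMultiplier hs.size
    (hs.eventually_mean_norm_pow h (hs.eventually_mem h hθs2)) (hs.tendsto_sampleSecond h hθs2)
    hc hSc (hs.eventually_norm_sampleMean_le h hκ hθs2)).choose_spec.2
  have t3 := t2.sub t1
  rw [sub_zero] at t3
  -- The excess of the quadratic form at the estimator over its minimum dominates `c₁` times this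
  -- square. The estimator has the larger likelihood, so the excess is at most the difference of the
  -- two expansion errors.
  have t4 : Tendsto (fun i => ‖√(n i : ℝ) • (θ i - θ₀) - N (W i)‖ ^ 2) l (𝓝 0) := by
    have t5 := t3.const_mul (c₁⁻¹)
    rw [mul_zero] at t5
    refine tendsto_of_tendsto_of_tendsto_of_le_of_le' tendsto_const_nhds t5
      (Eventually.of_forall fun i => by positivity) ?_
    filter_upwards [hθs1, hθs2, hmul, hEMLE, hA (‖N‖ * M)] with i i1 i2 i3 i4 i5
    have j1 := i4.2.2 (θs i) (i5 _ i2) ⟨_, i3.1⟩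
    have j2 := hqq (√(n i : ℝ) • (θ i - θ₀)) (W i)
    have j3 := hD₁ (√(n i : ℝ) • (θ i - θ₀) - N (W i))
    rw [← j2] at j3
    rw [i1, inv_mul_eq_div, le_div_iff₀ hc₁]
    simp only [hq, hW] at j3 ⊢
    linarith
  rw [tendsto_zero_iff_norm_tendsto_zero]
  have := (Real.continuous_sqrt.tendsto 0).comp t4
  rw [Real.sqrt_zero] at this
  exact this.congr fun i => Real.sqrt_sq (norm_nonneg _)

end SampleLimits

/-! ### Local expansion of the phi-divergence -/

namespace PhiClass
variable {φ : ℝ → ℝ}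

/-- The second derivative is available only at `1`, so l'Hôpital's rule is used once; the remaining
quotient is half the difference quotient of `φ'` at `1`. -/
lemma tendsto_div_sq (hφ : PhiClass φ) :
    Tendsto (fun u => φ u / (u - 1) ^ 2) (𝓝[≠] 1) (𝓝 (deriv (deriv φ) 1 / 2)) := by
  have hd : ∀ u : ℝ, HasDerivAt (fun u : ℝ => (u - 1) ^ 2) (2 * (u - 1)) u := fun u => by
    simpa using ((hasDerivAt_id u).sub_const 1).fun_pow 2
  refine deriv.lhopital_zero_nhdsNE (hφ.differentiable_near.filter_mono nhdsWithin_le_nhds)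
    ?_ ?_ ?_ ?_
  · filter_upwards [self_mem_nhdsWithin] with u hu
    rw [(hd u).deriv]
    exact mul_ne_zero two_ne_zero (sub_ne_zero.2 hu)
  · have := hφ.differentiable_near.self_of_nhds.continuousAt.tendsto
    rw [hφ.map_one] at this
    exact this.mono_left nhdsWithin_le_nhds
  · have := (hd 1).continuousAt.tendsto
    simp only [sub_self, ne_eq, OfNat.ofNat_ne_zero, not_false_eq_true, zero_pow] at this
    exact this.mono_left nhdsWithin_le_nhds
  · have := (hasDerivAt_iff_tendsto_slope.1 hφ.differentiableAt_deriv.hasDerivAt).div_const 2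
    refine this.congr fun u => ?_
    rw [(hd u).deriv, slope_def_field, hφ.deriv_one]
    rw [sub_zero, div_div, mul_comm]

/-- The error is relative to `(a - b)²`, so after summation over the sample it is controlled by `ε ∑
(aⱼ - bⱼ)²`. -/
lemma summand_bound (hφ : PhiClass φ) {ε : ℝ} (hε : 0 < ε) :
    ∃ η > 0, ∀ a b : ℝ, |a| ≤ η → |b| ≤ η →
      |2 / deriv (deriv φ) 1 * ((1 + a)⁻¹ * φ ((1 + a) / (1 + b))) - (a - b) ^ 2| ≤
        ε * (a - b) ^ 2 := by
  set κ := deriv (deriv φ) 1 with hκ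
  have hκ0 : κ ≠ 0 := hφ.deriv2_pos.ne'
  -- The continuous extension of `φ(u)/(u-1)²` to `1`; it exhibits the summand as `(a - b)²` times a
  -- function of `(a, b)` that is continuous with value `1` at the origin.
  set ψ : ℝ → ℝ := Function.update (fun u => φ u / (u - 1) ^ 2) 1 (κ / 2) with hψ
  have hψc : ContinuousAt ψ 1 := continuousAt_update_same.2 hφ.tendsto_div_sq
  have hψ1 : ψ 1 = κ / 2 := by simp [hψ]
  have hφψ : ∀ u, φ u = ψ u * (u - 1) ^ 2 := by
    intro u
    rcases eq_or_ne u 1 with rfl | hu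
    · simp [hφ.map_one]
    · have : (u - 1) ^ 2 ≠ 0 := pow_ne_zero 2 (sub_ne_zero.2 hu)
      simp only [hψ, Function.update_of_ne hu]
      field_simp
  have hcont : ContinuousAt (fun z : ℝ × ℝ => 2 / κ * (1 + z.1)⁻¹ * (1 + z.2)⁻¹ ^ 2 *
      ψ ((1 + z.1) / (1 + z.2))) (0, 0) := by
    have h1 : ContinuousAt (fun z : ℝ × ℝ => (1 + z.1) / (1 + z.2)) (0, 0) :=
      ContinuousAt.div (by fun_prop) (by fun_prop) (by simp)
    have h2 : ContinuousAt (fun z : ℝ × ℝ => ψ ((1 + z.1) / (1 + z.2))) (0, 0) :=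
      ContinuousAt.comp (g := ψ) (f := fun z : ℝ × ℝ => (1 + z.1) / (1 + z.2))
        (by simpa using hψc) h1
    refine ContinuousAt.mul (ContinuousAt.mul (ContinuousAt.mul continuousAt_const ?_) ?_) h2
    · exact ContinuousAt.inv₀ (by fun_prop) (by simp)
    · exact (ContinuousAt.inv₀ (by fun_prop) (by simp)).pow 2
  obtain ⟨δ, hδ, h⟩ := Metric.continuousAt_iff.1 hcont ε hε
  refine ⟨min (δ / 2) (1 / 2), by positivity, fun a b ha hb => ?_⟩
  have hab : dist (a, b) ((0, 0) : ℝ × ℝ) < δ := by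
    rw [Prod.dist_eq, Real.dist_eq, Real.dist_eq, sub_zero, sub_zero]
    have := min_le_left (δ / 2) (1 / 2)
    exact max_lt (by linarith) (by linarith)
  have h1 := h hab
  have hb' : 1 + b ≠ 0 := by
    have := min_le_right (δ / 2) (1 / 2)
    have := (abs_le.1 hb).1
    exact (by linarith : 0 < 1 + b).ne'
  have h2 : (1 + a) / (1 + b) - 1 = (a - b) * (1 + b)⁻¹ := by field_simp; ring
  simp only [add_zero, inv_one, one_pow, div_one, mul_one, hψ1, Real.dist_eq] at h1
  rw [show 2 / κ * (κ / 2) = 1 by field_simp] at h1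
  rw [hφψ, h2]
  calc _ = |2 / κ * (1 + a)⁻¹ * (1 + b)⁻¹ ^ 2 * ψ ((1 + a) / (1 + b)) - 1| * |(a - b) ^ 2| := by
        rw [← abs_mul]; congr 1; ring
    _ ≤ _ := by rw [abs_of_nonneg (sq_nonneg (a - b))]; gcongr

end PhiClass

/-- The weights are reciprocals, so the ratio at the two parameters is inverted, and the factor `n`
cancels. -/
lemma testStat_eq_sum {k p r n : ℕ} (hn : 0 < n) (φ : ℝ → ℝ) (g : E k → E p → E r)
    (x : Fin n → E k) (θ θ₀ : E p) :
    testStat φ g x θ θ₀ = ∑ j, 2 / deriv (deriv φ) 1 *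
      ((1 + inner ℝ (multiplier fun j => g (x j) θ₀) (g (x j) θ₀))⁻¹ *
        φ ((1 + inner ℝ (multiplier fun j => g (x j) θ₀) (g (x j) θ₀)) /
          (1 + inner ℝ (multiplier fun j => g (x j) θ) (g (x j) θ)))) := by
  have : (n : ℝ) ≠ 0 := by positivity
  rw [testStat, phiDiv, Finset.mul_sum]
  refine Finset.sum_congr rfl fun j _ => ?_
  simp only [elWeight]
  have h2 : ∀ a b : ℝ, (n : ℝ)⁻¹ * a⁻¹ / ((n : ℝ)⁻¹ * b⁻¹) = b / a := fun a b => by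
    rw [mul_div_mul_left _ _ (inv_ne_zero this), inv_div_inv]
  rw [h2]
  field_simp

/-! ### Quadratic approximation of the test statistic -/

namespace SampleLimits
variable {I : Type*} {k p r : ℕ} {g : E k → E p → E r} {θ₀ : E p}
    {K₁ K₂ K₃ : E k → ℝ} {l : Filter I} {n : I → ℕ} {x : ∀ i, Fin (n i) → E k}
    {S Sinv : E r →L[ℝ] E r} {D : E p →L[ℝ] E r} {κ C M M' c : ℝ}
    {F : Measure (E k)} {U : Set (E p)} {θ : I → E p}

lemma eventually_abs_inner_multiplier_le (hs : SampleLimits g θ₀ K₁ K₂ K₃ l n x S D κ C M)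
    (h : Regular g F θ₀ U K₁ K₂ K₃) (hκ : 0 ≤ κ) (hc : 0 < c)
    (hSc : ∀ v, c * ‖v‖ ^ 2 ≤ inner ℝ v (S v))
    (hθ : ∀ᶠ i in l, ‖√(n i : ℝ) • (θ i - θ₀)‖ ≤ M') {η : ℝ} (hη : 0 < η) :
    ∀ᶠ i in l, ∀ j,
      |inner ℝ (multiplier fun j => g (x i j) (θ i)) (g (x i j) (θ i))| ≤ η := by
  have hU := hs.eventually_mem h hθ
  obtain ⟨R, hR, hmul⟩ := eventually_hasMultiplier hs.size
    (hs.eventually_mean_norm_pow h hU) (hs.tendsto_sampleSecond h hθ)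
    hc hSc (hs.eventually_norm_sampleMean_le h hκ hθ)
  filter_upwards [hmul, hs.eventually_norm_le h hU (ε := η / R) (by positivity),
    eventually_pos hs.size] with i h1 h2 h0 j
  have hs0 : 0 < √(n i : ℝ) := by positivity
  have h3 := h1.2.1
  rw [norm_smul, Real.norm_of_nonneg hs0.le, mul_comm, ← le_div_iff₀ hs0] at h3
  exact abs_inner_le_of_norm_le h3 (h2 j) (by field_simp; rfl)

/-- The empirical phi-divergence statistic is asymptotically a quadratic form in `√n ȳ`. -/
lemma tendsto_testStat_sub (hs : SampleLimits g θ₀ K₁ K₂ K₃ l n x S D κ C M)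
    (h : Regular g F θ₀ U K₁ K₂ K₃) (hκ : 0 ≤ κ) (hc : 0 < c)
    (hSc : ∀ v, c * ‖v‖ ^ 2 ≤ inner ℝ v (S v)) (hinv : ∀ v, Sinv (S v) = v)
    (hinv' : ∀ v, S (Sinv v) = v) {N : E r →L[ℝ] E p}
    (hθ : ∀ᶠ i in l, ‖√(n i : ℝ) • (θ i - θ₀)‖ ≤ M')
    (hlin : Tendsto (fun i => √(n i : ℝ) • (θ i - θ₀) -
      N (√(n i : ℝ) • sampleMean fun j => g (x i j) θ₀)) l (𝓝 0))
    {φ : ℝ → ℝ} (hφ : PhiClass φ) :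
    Tendsto (fun i => testStat φ g (x i) (θ i) θ₀ -
      inner ℝ (D (N (√(n i : ℝ) • sampleMean fun j => g (x i j) θ₀)))
        (Sinv (D (N (√(n i : ℝ) • sampleMean fun j => g (x i j) θ₀))))) l (𝓝 0) := by
  set W := fun i => √(n i : ℝ) • sampleMean fun j => g (x i j) θ₀ with hW
  have hθ0 : ∀ᶠ i in l, ‖√(n i : ℝ) • ((fun _ : I => θ₀) i - θ₀)‖ ≤ 0 :=
    Eventually.of_forall fun i => by simp
  set t₀ := fun i => multiplier fun j => g (x i j) θ₀ with ht₀
  set t := fun i => multiplier fun j => g (x i j) (θ i) with ht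
  -- The difference of the linear forms at the two parameters is split into `u`, the change of
  -- multiplier, which is the main term, and `w`, the change of `g`, which is negligible in mean
  -- square.
  set u := fun i (j : Fin (n i)) => inner ℝ (t₀ i - t i) (g (x i j) θ₀) with hu
  set w := fun i (j : Fin (n i)) => inner ℝ (t i) (g (x i j) θ₀ - g (x i j) (θ i)) with hw
  have huw : ∀ i j, inner ℝ (t₀ i) (g (x i j) θ₀) - inner ℝ (t i) (g (x i j) (θ i)) =
      u i j + w i j := fun i j => by
    simp only [hu, hw, inner_sub_left, inner_sub_right]; ring
  obtain ⟨R, hR, hmul⟩ := eventually_hasMultiplier hs.size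
    (hs.eventually_mean_norm_pow h (hs.eventually_mem h hθ)) (hs.tendsto_sampleSecond h hθ)
    hc hSc (hs.eventually_norm_sampleMean_le h hκ hθ)
  -- The scaled multipliers are `S⁻¹W` at `θ₀` and `S⁻¹(W + DNW)` at the estimator, up to `o(1)`.
  have hv : Tendsto (fun i => √(n i : ℝ) • (t₀ i - t i) - -(Sinv (D (N (W i))))) l (𝓝 0) := by
    have h1 := tendsto_multiplier_sub hs.size (hs.eventually_mean_norm_pow h (θ := fun _ => θ₀)
      (Eventually.of_forall fun _ => h.mem)) hs.second hc hSc hinv hs.bounded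
    have h2 := tendsto_multiplier_sub hs.size (hs.eventually_mean_norm_pow h
      (hs.eventually_mem h hθ)) (hs.tendsto_sampleSecond h hθ) hc hSc hinv
      (hs.eventually_norm_sampleMean_le h hκ hθ)
    have h3 := (Sinv.continuous.tendsto 0).comp (hs.tendsto_sampleMean_sub h hκ hθ)
    have h4 := ((Sinv.comp D).continuous.tendsto 0).comp hlin
    rw [map_zero] at h3 h4
    refine (((h1.sub h2).sub h3).sub h4 |>.congr fun i => ?_).trans (by simp)
    simp only [Function.comp, ContinuousLinearMap.comp_apply, map_sub, map_add, smul_sub, hW]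
    abel
  have hprop : ProperSpace (E r →L[ℝ] E r) := FiniteDimensional.proper ℝ _
  set T := Sinv.comp (D.comp N) with hT
  have hu2 : Tendsto (fun i => ∑ j, u i j ^ 2 - inner ℝ (D (N (W i))) (Sinv (D (N (W i)))))
      l (𝓝 0) := by
    have h8 := tendsto_sub_of_continuous (X := E r × (E r →L[ℝ] E r)) (l := l)
      (F := fun z => inner ℝ z.1 (z.2 z.1)) (by fun_prop)
      (a := fun i => (√(n i : ℝ) • (t₀ i - t i), sampleSecond fun j => g (x i j) θ₀))
      (b := fun i => (-(Sinv (D (N (W i)))), S)) (M := max (‖T‖ * M) ‖S‖) (by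
        filter_upwards [hs.bounded] with i hi
        rw [Prod.norm_mk, norm_neg]
        gcongr
        exact (T.le_opNorm _).trans (by gcongr))
      (by
        have : Tendsto (fun i => (sampleSecond fun j => g (x i j) θ₀) - S) l (𝓝 0) := by
          simpa using hs.second.sub_const S
        simp only [Prod.mk_sub_mk]
        exact hv.prodMk_nhds this)
    refine h8.congr' ?_
    filter_upwards [eventually_pos hs.size] with i hi
    have hss : √(n i : ℝ) * √(n i : ℝ) = n i := Real.mul_self_sqrt (by positivity)
    simp only [map_smul, map_neg, inner_neg_left, inner_neg_right, neg_neg, hinv',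
      real_inner_smul_left, real_inner_smul_right]
    rw [← mul_assoc, hss, inner_sampleSecond, mul_sampleMean hi, real_inner_comm]
  -- The bound `n ‖t‖² ≤ R²` turns the sum into at most `R²` times a sample mean that tends to zero.
  have hw2 : Tendsto (fun i => ∑ j, w i j ^ 2) l (𝓝 0) := by
    have h1 := (hs.tendsto_mean_norm_sub_sq h hθ).const_mul (R ^ 2)
    rw [mul_zero] at h1
    refine squeeze_zero' (Eventually.of_forall fun i => by positivity) ?_ h1
    filter_upwards [hmul, eventually_pos hs.size] with i h2 h0
    have hs0 : 0 < √(n i : ℝ) := by positivity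
    have h3 := h2.2.1
    rw [norm_smul, Real.norm_of_nonneg hs0.le] at h3
    have h4 : n i * ‖t i‖ ^ 2 ≤ R ^ 2 := by
      rw [← Real.sq_sqrt (Nat.cast_nonneg (n i) : (0 : ℝ) ≤ n i), ← mul_pow]
      gcongr
    have h5 : 0 ≤ sampleMean fun j => ‖g (x i j) (θ i) - g (x i j) θ₀‖ ^ 2 :=
      sampleMean_nonneg fun j => by positivity
    calc ∑ j, w i j ^ 2 ≤ ∑ j, ‖t i‖ ^ 2 * ‖g (x i j) (θ i) - g (x i j) θ₀‖ ^ 2 := by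
          refine Finset.sum_le_sum fun j _ => ?_
          rw [← mul_pow, ← sq_abs, norm_sub_rev]
          gcongr
          exact abs_real_inner_le_norm _ _
      _ = n i * ‖t i‖ ^ 2 * sampleMean fun j => ‖g (x i j) (θ i) - g (x i j) θ₀‖ ^ 2 := by
          rw [← Finset.mul_sum, ← mul_sampleMean h0]; ring
      _ ≤ _ := by gcongr
  set B := ‖D.comp N‖ * M * (‖T‖ * M) + 1 with hB
  have hub : ∀ᶠ i in l, ∑ j, u i j ^ 2 ≤ B := by
    filter_upwards [(Metric.tendsto_nhds.1 hu2) 1 one_pos, hs.bounded] with i h1 h2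
    rw [dist_zero_right, Real.norm_eq_abs] at h1
    have h4 : inner ℝ (D (N (W i))) (Sinv (D (N (W i)))) ≤ ‖D.comp N‖ * M * (‖T‖ * M) :=
      (real_inner_le_norm _ _).trans (mul_le_mul
        (((D.comp N).le_opNorm _).trans (by gcongr)) ((T.le_opNorm _).trans (by gcongr))
        (norm_nonneg _) (mul_nonneg (norm_nonneg _) ((norm_nonneg _).trans h2)))
    linarith [(abs_lt.1 h1).2]
  -- The cross term is handled by Cauchy–Schwarz, with `∑ u²` bounded by `B`.
  have hd2 : Tendsto (fun i => ∑ j, (u i j + w i j) ^ 2 - ∑ j, u i j ^ 2) l (𝓝 0) := by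
    have h1 : Tendsto (fun i => 2 * (√B * √(∑ j, w i j ^ 2)) + ∑ j, w i j ^ 2) l (𝓝 0) := by
      have := (Real.continuous_sqrt.tendsto 0).comp hw2
      rw [Real.sqrt_zero] at this
      simpa using ((this.const_mul √B).const_mul 2).add hw2
    refine squeeze_zero_norm' ?_ h1
    filter_upwards [hub] with i h2
    have h3 : ∑ j, (u i j + w i j) ^ 2 - ∑ j, u i j ^ 2 =
        2 * ∑ j, u i j * w i j + ∑ j, w i j ^ 2 := by
      rw [← Finset.sum_sub_distrib, Finset.mul_sum, ← Finset.sum_add_distrib]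
      exact Finset.sum_congr rfl fun j _ => by ring
    have h4 : |∑ j, u i j * w i j| ≤ √B * √(∑ j, w i j ^ 2) := by
      rw [← Real.sqrt_mul ((Finset.sum_nonneg fun j _ => sq_nonneg (u i j)).trans h2)]
      refine Real.abs_le_sqrt ((Finset.sum_mul_sq_le_sq_mul_sq _ _ _).trans ?_)
      gcongr
    rw [h3, Real.norm_eq_abs]
    refine (abs_add_le _ _).trans (add_le_add ?_ (abs_of_nonneg (by positivity)).le)
    rw [abs_mul, abs_two]
    gcongr
  have hsum : Tendsto (fun i => testStat φ g (x i) (θ i) θ₀ - ∑ j, (u i j + w i j) ^ 2)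
      l (𝓝 0) := by
    refine Metric.tendsto_nhds.2 fun ε hε => ?_
    obtain ⟨η, hη, hbd⟩ := hφ.summand_bound (ε := ε / (2 * (|B| + 2))) (by positivity)
    filter_upwards [hub, (Metric.tendsto_nhds.1 hd2) 1 one_pos, eventually_pos hs.size,
      hs.eventually_abs_inner_multiplier_le h hκ hc hSc hθ hη,
      hs.eventually_abs_inner_multiplier_le h hκ hc hSc hθ0 hη] with i h1 h2 h0 h3 h4
    rw [dist_zero_right, Real.norm_eq_abs] at h2 ⊢
    have hB0 : 0 ≤ B := (Finset.sum_nonneg fun j _ => sq_nonneg (u i j)).trans h1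
    rw [testStat_eq_sum h0, ← Finset.sum_sub_distrib]
    calc _ ≤ ∑ j, ε / (2 * (|B| + 2)) * (u i j + w i j) ^ 2 := by
          refine (Finset.abs_sum_le_sum_abs _ _).trans (Finset.sum_le_sum fun j _ => ?_)
          rw [← huw]
          exact hbd _ _ (h4 j) (h3 j)
      _ = ε / (2 * (|B| + 2)) * ∑ j, (u i j + w i j) ^ 2 := by rw [Finset.mul_sum]
      _ ≤ ε / (2 * (|B| + 2)) * (B + 1) := by gcongr; linarith [(abs_lt.1 h2).2]
      _ < ε / (2 * (|B| + 2)) * (2 * (|B| + 2)) := by gcongr; linarith [le_abs_self B]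
      _ = ε := by field_simp
  refine ((hsum.add hd2).add hu2 |>.congr fun i => ?_).trans (by simp)
  ring

end SampleLimits

/-! ### Setwise convergence of measures with convergence of an envelope -/

section setwise
variable {𝒳 : Type*} [MeasurableSpace 𝒳] {μ : ℕ → Measure 𝒳} {ν : Measure 𝒳}
  [∀ n, IsProbabilityMeasure (μ n)] [IsProbabilityMeasure ν]

/-- By the layer cake formula the integral is that of `t ↦ m {t ≤ f}` over `(0, M]`. These functions
converge for every `t` by setwise convergence and are bounded by `1`. -/
lemma tendsto_integral_of_setwise
    (hμ : ∀ B, MeasurableSet B → Tendsto (fun n => μ n B) atTop (𝓝 (ν B)))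
    {f : 𝒳 → ℝ} (hf : Measurable f) (h0 : ∀ x, 0 ≤ f x) {M : ℝ} (hM : ∀ x, f x ≤ M) :
    Tendsto (fun n => ∫ x, f x ∂μ n) atTop (𝓝 (∫ x, f x ∂ν)) := by
  have hi : ∀ (m : Measure 𝒳) [IsProbabilityMeasure m], Integrable f m := fun m _ =>
    Integrable.of_bound hf.aestronglyMeasurable M (ae_of_all _ fun x => by
      rw [Real.norm_of_nonneg (h0 x)]; exact hM x)
  have hrw : ∀ (m : Measure 𝒳) [IsProbabilityMeasure m],
      ∫ x, f x ∂m = ∫ t in Set.Ioc 0 M, m.real {a | t ≤ f a} := fun m _ =>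
    (hi m).integral_eq_integral_Ioc_meas_le (ae_of_all _ h0) (ae_of_all _ hM)
  simp_rw [fun n => hrw (μ n), hrw ν]
  refine tendsto_integral_of_dominated_convergence (fun _ => 1) (fun n => ?_)
    (integrable_const _) (fun n => ae_of_all _ fun t => ?_) (ae_of_all _ fun t => ?_)
  · have : Antitone fun t => (μ n).real {a | t ≤ f a} := fun s t hst =>
      measureReal_mono fun a (ha : t ≤ f a) => hst.trans ha
    exact this.measurable.aestronglyMeasurable
  · rw [Real.norm_of_nonneg measureReal_nonneg]
    exact measureReal_le_one
  · exact (ENNReal.tendsto_toReal (measure_ne_top _ _)).comp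
      (hμ _ (measurableSet_le measurable_const hf))

/-- Fatou's inequality for varying measures: a truncation `min f m` nearly exhausts the limit
integral, has convergent integrals, and lies below `f`. -/
lemma eventually_integral_gt (hμ : ∀ B, MeasurableSet B → Tendsto (fun n => μ n B) atTop (𝓝 (ν B)))
    {f : 𝒳 → ℝ} (hf : Measurable f) (h0 : ∀ x, 0 ≤ f x) (hfμ : ∀ n, Integrable f (μ n))
    (hfν : Integrable f ν) {ε : ℝ} (hε : 0 < ε) :
    ∀ᶠ n in atTop, ∫ x, f x ∂ν - ε < ∫ x, f x ∂μ n := by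
  have hmeas : ∀ m : ℕ, Measurable fun x => min (f x) (m : ℝ) := fun m => hf.min measurable_const
  have hnn : ∀ (m : ℕ) x, 0 ≤ min (f x) (m : ℝ) := fun m x => le_min (h0 x) (by positivity)
  have h1 : Tendsto (fun m : ℕ => ∫ x, min (f x) (m : ℝ) ∂ν) atTop (𝓝 (∫ x, f x ∂ν)) := by
    refine tendsto_integral_of_dominated_convergence f
      (fun m => (hmeas m).aestronglyMeasurable) hfν
      (fun m => ae_of_all _ fun x => ?_) (ae_of_all _ fun x => ?_)
    · rw [Real.norm_of_nonneg (hnn m x)]; exact min_le_left _ _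
    · refine tendsto_const_nhds.congr' ?_
      filter_upwards [eventually_ge_atTop ⌈f x⌉₊] with m hm
      exact (min_eq_left (Nat.ceil_le.1 hm)).symm
  obtain ⟨m, hm⟩ := (h1.eventually_const_lt
    (show ∫ x, f x ∂ν - ε / 2 < ∫ x, f x ∂ν by linarith)).exists
  have h2 := tendsto_integral_of_setwise hμ (hmeas m) (hnn m) (M := m) fun x => min_le_right _ _
  filter_upwards [h2.eventually_const_lt (show ∫ x, min (f x) (m : ℝ) ∂ν - ε / 2 <
    ∫ x, min (f x) (m : ℝ) ∂ν by linarith)] with n hn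
  have h3 : ∫ x, min (f x) (m : ℝ) ∂μ n ≤ ∫ x, f x ∂μ n :=
    integral_mono_of_nonneg (ae_of_all _ (hnn m)) (hfμ n) (ae_of_all _ fun x => min_le_left _ _)
  linarith

/-- Setwise convergence `μ n → ν` together with convergence of the integrals of an envelope `H`. -/
structure EnvelopeLimit (μ : ℕ → Measure 𝒳) (ν : Measure 𝒳) (H : 𝒳 → ℝ) : Prop where
  setwise : ∀ B, MeasurableSet B → Tendsto (fun n => μ n B) atTop (𝓝 (ν B))
  measurable : Measurable H
  integrable : ∀ n, Integrable H (μ n)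
  integrable_limit : Integrable H ν
  tendsto : Tendsto (fun n => ∫ x, H x ∂μ n) atTop (𝓝 (∫ x, H x ∂ν))

variable {H h : 𝒳 → ℝ}

omit [∀ n, IsProbabilityMeasure (μ n)] [IsProbabilityMeasure ν] in
lemma EnvelopeLimit.integrable_of_le (hH : EnvelopeLimit μ ν H) (hh : Measurable h)
    (hle : ∀ x, |h x| ≤ H x) (n : ℕ) : Integrable h (μ n) :=
  (hH.integrable n).mono' hh.aestronglyMeasurable (ae_of_all _ hle)

omit [∀ n, IsProbabilityMeasure (μ n)] [IsProbabilityMeasure ν] in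
lemma EnvelopeLimit.integrable_limit_of_le (hH : EnvelopeLimit μ ν H) (hh : Measurable h)
    (hle : ∀ x, |h x| ≤ H x) : Integrable h ν :=
  hH.integrable_limit.mono' hh.aestronglyMeasurable (ae_of_all _ hle)

/-- Generalized dominated convergence under setwise convergence. -/
lemma EnvelopeLimit.tendsto_integral (hH : EnvelopeLimit μ ν H) (hh : Measurable h)
    (hle : ∀ x, |h x| ≤ H x) : Tendsto (fun n => ∫ x, h x ∂μ n) atTop (𝓝 (∫ x, h x ∂ν)) := by
  have hμ := hH.integrable_of_le hh hle
  have hν := hH.integrable_limit_of_le hh hle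
  refine Metric.tendsto_nhds.2 fun ε hε => ?_
  -- Fatou's inequality for `H + h` and `H - h` bounds the integral of `h` from both sides once the
  -- integrals of `H` converge.
  filter_upwards [eventually_integral_gt hH.setwise (hH.measurable.add hh)
      (fun x => by simp only [Pi.add_apply]; linarith [(abs_le.1 (hle x)).1])
      (fun n => (hH.integrable n).add (hμ n))
      (hH.integrable_limit.add hν) (half_pos hε),
    eventually_integral_gt hH.setwise (hH.measurable.sub hh)
      (fun x => by simp only [Pi.sub_apply]; linarith [(abs_le.1 (hle x)).2])
      (fun n => (hH.integrable n).sub (hμ n))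
      (hH.integrable_limit.sub hν) (half_pos hε),
    (Metric.tendsto_nhds.1 hH.tendsto) (ε / 2) (half_pos hε)] with n h1 h2 h3
  simp only [Pi.add_apply, Pi.sub_apply] at h1 h2
  rw [integral_add hH.integrable_limit hν, integral_add (hH.integrable n) (hμ n)] at h1
  rw [integral_sub hH.integrable_limit hν, integral_sub (hH.integrable n) (hμ n)] at h2
  rw [Real.dist_eq, abs_lt] at h3 ⊢
  constructor <;> linarith [h3.1, h3.2]

end setwise

/-! ### Laws of large numbers for triangular arrays -/

section lln
variable {𝒳 : Type*} [MeasurableSpace 𝒳]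

lemma integral_sampleMean_comp {Ω : Type*} [MeasurableSpace Ω] {P : Measure Ω} {n : ℕ}
    (hn : 0 < n) {X : Fin n → Ω → 𝒳} {μ : Measure 𝒳} (hX : ∀ i, HasLaw (X i) μ P) {h : 𝒳 → ℝ}
    (hh : Measurable h) (hi : Integrable h μ) :
    Integrable (fun ω => sampleMean fun j => h (X j ω)) P ∧
      ∫ ω, sampleMean (fun j => h (X j ω)) ∂P = ∫ x, h x ∂μ := by
  have h1 : ∀ j, Integrable (fun ω => h (X j ω)) P := fun j => by
    have := hi
    rw [← (hX j).map_eq] at this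
    exact this.comp_aemeasurable (hX j).aemeasurable
  have h2 : ∀ j, ∫ ω, h (X j ω) ∂P = ∫ x, h x ∂μ := fun j =>
    (hX j).integral_comp hh.aestronglyMeasurable
  refine ⟨(integrable_finsetSum _ fun j _ => h1 j).const_mul _, ?_⟩
  have : (n : ℝ) ≠ 0 := by positivity
  simp only [sampleMean, smul_eq_mul]
  rw [integral_const_mul, integral_finsetSum _ fun j _ => h1 j]
  simp only [h2, Finset.sum_const, Finset.card_univ, Fintype.card_fin, nsmul_eq_mul]
  field_simp

/-- The inequality `|z| ≤ 1/s + s z²` with `s = √n` balances against the variance bound `M²/n`. -/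
lemma integral_abs_sampleMean_sub_le {Ω : Type*} [MeasurableSpace Ω] {P : Measure Ω}
    [IsProbabilityMeasure P] {n : ℕ} (hn : 0 < n) {X : Fin n → Ω → 𝒳} {μ : Measure 𝒳}
    [IsProbabilityMeasure μ] (hind : iIndepFun X P)
    (hX : ∀ i, HasLaw (X i) μ P) {h : 𝒳 → ℝ}
    (hh : Measurable h) {M : ℝ} (hM : ∀ x, |h x| ≤ M) :
    ∫ ω, |sampleMean (fun j => h (X j ω)) - ∫ x, h x ∂μ| ∂P ≤ (1 + M ^ 2) / √(n : ℝ) := by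
  have hi : Integrable h μ := Integrable.of_bound hh.aestronglyMeasurable M (ae_of_all _ hM)
  obtain ⟨h1, h2⟩ := integral_sampleMean_comp hn hX hh hi
  set Y := fun ω => sampleMean fun j => h (X j ω) with hY
  have hmeas : ∀ j, AEMeasurable (fun ω => h (X j ω)) P := fun j =>
    hh.comp_aemeasurable (hX j).aemeasurable
  have hLp : ∀ j, MemLp (fun ω => h (X j ω)) 2 P := fun j =>
    MemLp.of_bound (hmeas j).aestronglyMeasurable M (ae_of_all _ fun ω => hM _)
  have hYLp : MemLp Y 2 P := (memLp_finsetSum _ fun j _ => hLp j).const_mul _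
  have hvar : ∀ j, Var[fun ω => h (X j ω); P] ≤ M ^ 2 := fun j => by
    refine (variance_le_expectation_sq (hmeas j).aestronglyMeasurable).trans ?_
    have : ∫ ω, ((fun ω => h (X j ω)) ^ 2) ω ∂P ≤ ∫ _, M ^ 2 ∂P := by
      refine integral_mono_of_nonneg (ae_of_all _ fun ω => by simp; positivity)
        (integrable_const _) (ae_of_all _ fun ω => ?_)
      exact sq_le_sq' (by linarith [(abs_le.1 (hM (X j ω))).1]) (abs_le.1 (hM (X j ω))).2
    simpa using this
  have hVar : Var[Y; P] ≤ M ^ 2 / n := by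
    have e1 : Y = fun ω => (n : ℝ)⁻¹ * (∑ j, fun ω => h (X j ω)) ω := by
      ext ω; simp [hY, sampleMean]
    rw [e1, variance_const_mul, IndepFun.variance_sum (fun j _ => hLp j) fun i _ j _ hij =>
      (hind.indepFun hij).comp hh hh]
    have hn' : (0 : ℝ) < n := by positivity
    calc _ ≤ (n : ℝ)⁻¹ ^ 2 * ∑ _j : Fin n, M ^ 2 := by gcongr with j; exact hvar j
      _ = M ^ 2 / n := by simp; field_simp
  have hVarEq := variance_eq_integral hYLp.aemeasurable
  rw [h2] at hVarEq
  set s := √(n : ℝ) with hs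
  have hs0 : 0 < s := by positivity
  have hss : s ^ 2 = n := Real.sq_sqrt (by positivity)
  set e := ∫ x, h x ∂μ
  have hsq : Integrable (fun ω => (Y ω - e) ^ 2) P := (hYLp.sub (memLp_const e)).integrable_sq
  calc ∫ ω, |Y ω - e| ∂P ≤ ∫ ω, (1 / s + s * (Y ω - e) ^ 2) ∂P := by
        refine integral_mono (h1.sub (integrable_const e)).abs
          ((integrable_const _).add (hsq.const_mul s)) fun ω => ?_
        have h3 : 0 ≤ 1 / s * ((1 - s * |Y ω - e|) ^ 2 + s * |Y ω - e|) := by positivity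
        have h4 : 1 / s * ((1 - s * |Y ω - e|) ^ 2 + s * |Y ω - e|) =
            1 / s + s * (Y ω - e) ^ 2 - |Y ω - e| := by
          rw [← sq_abs (Y ω - e)]; field_simp; ring
        simp only
        linarith
    _ = 1 / s + s * Var[Y; P] := by
        rw [integral_add (integrable_const _) (hsq.const_mul s), integral_const_mul, hVarEq]
        simp
    _ ≤ 1 / s + s * (M ^ 2 / n) := by gcongr
    _ = _ := by rw [← hss]; field_simp

variable {Ω : ℕ → Type*} [∀ n, MeasurableSpace (Ω n)] {P : ∀ n, Measure (Ω n)}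

/-- The filter of events of probability tending to one. -/
def probFilter (P : ∀ n, Measure (Ω n)) : Filter (Σ n, Ω n) where
  sets := {A | Tendsto (fun n => P n {ω | (⟨n, ω⟩ : Σ n, Ω n) ∉ A}) atTop (𝓝 0)}
  univ_sets := by simp
  sets_of_superset {A B} hA hAB := tendsto_of_tendsto_of_tendsto_of_le_of_le tendsto_const_nhds hA
    (fun _ => zero_le) fun n => measure_mono fun ω hω h => hω (hAB h)
  inter_sets {A B} hA hB := by
    have := Tendsto.add hA hB
    rw [add_zero] at this
    refine tendsto_of_tendsto_of_tendsto_of_le_of_le tendsto_const_nhds this (fun _ => zero_le)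
      fun n => (measure_mono fun ω hω => ?_).trans (measure_union_le _ _)
    simp only [Set.mem_inter_iff, not_and_or, Set.mem_ofPred_eq] at hω
    exact hω

lemma eventually_probFilter {p : (Σ n, Ω n) → Prop} : (∀ᶠ z in probFilter P, p z) ↔
    Tendsto (fun n => P n {ω | ¬ p ⟨n, ω⟩}) atTop (𝓝 0) := Iff.rfl

lemma tendsto_fst_probFilter : Tendsto (fun z : Σ n, Ω n => z.1) (probFilter P) atTop := by
  refine tendsto_atTop.2 fun N => eventually_probFilter.2 ?_
  refine tendsto_const_nhds.congr' ?_
  filter_upwards [eventually_ge_atTop N] with n hn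
  simp [hn]

/-- Markov's inequality: convergence in mean implies convergence in probability. -/
lemma tendsto_probFilter_of_integral {Y : ∀ n, Ω n → ℝ} {c : ℝ}
    (hi : ∀ᶠ n in atTop, Integrable (fun ω => Y n ω - c) (P n))
    (h : Tendsto (fun n => ∫ ω, |Y n ω - c| ∂P n) atTop (𝓝 0)) :
    Tendsto (fun z : Σ n, Ω n => Y z.1 z.2) (probFilter P) (𝓝 c) := by
  refine Metric.tendsto_nhds.2 fun ε hε => eventually_probFilter.2 ?_
  have h1 : Tendsto (fun n => ENNReal.ofReal ((∫ ω, |Y n ω - c| ∂P n) / ε)) atTop (𝓝 0) := by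
    have := ENNReal.tendsto_ofReal (h.div_const ε)
    simpa using this
  refine tendsto_of_tendsto_of_tendsto_of_le_of_le' tendsto_const_nhds h1
    (Eventually.of_forall fun _ => zero_le) ?_
  filter_upwards [hi] with n hn
  have h2 := mul_meas_ge_le_lintegral₀ (μ := P n) (f := fun ω => ENNReal.ofReal |Y n ω - c|)
    hn.abs.aemeasurable.ennreal_ofReal (ENNReal.ofReal ε)
  rw [← ofReal_integral_eq_lintegral_ofReal hn.abs (ae_of_all _ fun ω => abs_nonneg _)] at h2
  rw [ENNReal.ofReal_div_of_pos hε, ENNReal.le_div_iff_mul_le (by simp [hε]) (by simp), mul_comm]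
  refine le_trans (mul_le_mul_right (measure_mono fun ω hω => ?_) _) h2
  simp only [not_lt, Set.mem_ofPred_eq, Real.dist_eq] at hω ⊢
  exact ENNReal.ofReal_le_ofReal hω

/-- Weak law of large numbers for triangular arrays whose row laws converge setwise. -/
lemma tendsto_sampleMean_probFilter [∀ n, IsProbabilityMeasure (P n)]
    {μ : ℕ → Measure 𝒳} {ν : Measure 𝒳} [∀ n, IsProbabilityMeasure (μ n)]
    [IsProbabilityMeasure ν] {X : ∀ n, Fin n → Ω n → 𝒳} (hind : ∀ n, iIndepFun (X n) (P n))
    (hX : ∀ n i, HasLaw (X n i) (μ n) (P n)) {H h : 𝒳 → ℝ} (hH : EnvelopeLimit μ ν H)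
    (hh : Measurable h) (hle : ∀ x, |h x| ≤ H x) :
    Tendsto (fun z : Σ n, Ω n => sampleMean fun j => h (X z.1 j z.2)) (probFilter P)
      (𝓝 (∫ x, h x ∂ν)) := by
  have hint : ∀ᶠ n in atTop, Integrable (fun ω => sampleMean fun j => h (X n j ω)) (P n) := by
    filter_upwards [eventually_gt_atTop 0] with n hn
    exact (integral_sampleMean_comp hn (hX n) hh (hH.integrable_of_le hh hle n)).1
  refine tendsto_probFilter_of_integral (Y := fun n ω => sampleMean fun j => h (X n j ω))
    (hint.mono fun n hn => hn.sub (integrable_const _)) ?_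
  have hH0 : ∀ x, 0 ≤ H x := fun x => (abs_nonneg _).trans (hle x)
  -- truncation of `h` where the envelope is large
  set A : ℕ → Set 𝒳 := fun m => {x | (m : ℝ) < H x} with hA
  have hAm : ∀ m, MeasurableSet (A m) := fun m => measurableSet_lt measurable_const hH.measurable
  set τ : ℕ → 𝒳 → ℝ := fun m => (A m).indicator H with hτ
  have hτm : ∀ m, Measurable (τ m) := fun m => hH.measurable.indicator (hAm m)
  have hτ0 : ∀ m x, 0 ≤ τ m x := fun m x => Set.indicator_nonneg (fun x _ => hH0 x) x
  have hτle : ∀ m x, |τ m x| ≤ H x := fun m x => by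
    rw [abs_of_nonneg (hτ0 m x)]
    exact Set.indicator_le_self' (fun _ _ => hH0 _) x
  have hτlim : Tendsto (fun m => ∫ x, τ m x ∂ν) atTop (𝓝 0) := by
    have := tendsto_integral_of_dominated_convergence (μ := ν) (F := τ) (f := fun _ => 0) H
      (fun m => (hτm m).aestronglyMeasurable) hH.integrable_limit
      (fun m => ae_of_all _ (hτle m)) (ae_of_all _ fun x => ?_)
    · simpa using this
    · refine tendsto_const_nhds.congr' ?_
      filter_upwards [eventually_ge_atTop ⌈H x⌉₊] with m hm
      simp [hτ, hA, Nat.ceil_le.1 hm]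
  refine Metric.tendsto_nhds.2 fun ε hε => ?_
  obtain ⟨m, hm⟩ := (hτlim.eventually_lt_const (show (0 : ℝ) < ε / 8 by positivity)).exists
  set h' : 𝒳 → ℝ := (A m)ᶜ.indicator h with hh'
  have hh'm : Measurable h' := hh.indicator (hAm m).compl
  have hsub : ∀ x, |h x - h' x| ≤ τ m x := fun x => by
    by_cases hx : x ∈ A m
    · simp [hh', hτ, hx, hle x]
    · simp [hh', hτ, hx]
  have hh'M : ∀ x, |h' x| ≤ (m : ℝ) := fun x => by
    by_cases hx : x ∈ A m
    · simp [hh', hx]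
    · have h1 : |h' x| = |h x| := by simp [hh', hx]
      rw [h1]
      exact (hle x).trans (not_lt.1 hx)
  -- The tail of the envelope, small under the limit law by choice of `m`, becomes small under the
  -- row laws as well. The errors are `ε/8` for truncating the sample mean, `ε/4` for its
  -- fluctuation, `ε/8` for truncating the expectation and `ε/4` for its convergence.
  filter_upwards [(hH.tendsto_integral (hτm m) (hτle m)).eventually_lt_const hm,
    (Metric.tendsto_nhds.1 (hH.tendsto_integral hh hle)) (ε / 4) (by positivity),
    ((tendsto_const_div_sqrt (l := atTop) (n := id) tendsto_id (1 + (m : ℝ) ^ 2)).eventually_lt_const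
      (show (0 : ℝ) < ε / 4 by positivity)), eventually_gt_atTop 0, hint] with n h1 h2 h3 h0 hin
  have hb := integral_abs_sampleMean_sub_le h0 (hind n) (hX n) hh'm hh'M
  have hti := integral_sampleMean_comp h0 (hX n) (hτm m) (hH.integrable_of_le (hτm m) (hτle m) n)
  have hh'i : Integrable h' (μ n) := Integrable.of_bound hh'm.aestronglyMeasurable m
    (ae_of_all _ hh'M)
  have hbi := (integral_sampleMean_comp h0 (hX n) hh'm hh'i).1
  have hhi := hH.integrable_of_le hh hle n
  have h4 : |∫ x, h' x ∂μ n - ∫ x, h x ∂μ n| < ε / 8 := by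
    rw [← integral_sub hh'i hhi]
    refine lt_of_le_of_lt ((abs_integral_le_integral_abs).trans
      (integral_mono (hh'i.sub hhi).abs (hH.integrable_of_le (hτm m) (hτle m) n) fun x => ?_)) h1
    simp only
    rw [abs_sub_comm]
    exact hsub x
  rw [Real.dist_eq] at h2
  rw [dist_zero_right, Real.norm_of_nonneg (integral_nonneg fun _ => abs_nonneg _)]
  have h5 : ∀ ω, |sampleMean (fun j => h (X n j ω)) - ∫ x, h x ∂ν| ≤
      sampleMean (fun j => τ m (X n j ω)) +
        |sampleMean (fun j => h' (X n j ω)) - ∫ x, h' x ∂μ n| + (ε / 8 + ε / 4) := fun ω => by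
    have e1 : |sampleMean (fun j => h (X n j ω)) - sampleMean (fun j => h' (X n j ω))| ≤
        sampleMean (fun j => τ m (X n j ω)) := by
      rw [← sampleMean_sub]
      exact (norm_sampleMean_le (H := ℝ) _).trans (sampleMean_mono fun j => hsub (X n j ω))
    have e2 : sampleMean (fun j => h (X n j ω)) - ∫ x, h x ∂ν =
      (sampleMean (fun j => h (X n j ω)) - sampleMean (fun j => h' (X n j ω))) +
      (sampleMean (fun j => h' (X n j ω)) - ∫ x, h' x ∂μ n) +
      ((∫ x, h' x ∂μ n - ∫ x, h x ∂μ n) + (∫ x, h x ∂μ n - ∫ x, h x ∂ν)) := by ring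
    rw [e2]
    refine (abs_add_le _ _).trans (add_le_add ((abs_add_le _ _).trans (by gcongr)) ?_)
    exact (abs_add_le _ _).trans (add_le_add h4.le h2.le)
  have hbi' : Integrable (fun ω => |sampleMean (fun j => h' (X n j ω)) - ∫ x, h' x ∂μ n|) (P n) :=
    (hbi.sub (integrable_const (∫ x, h' x ∂μ n))).abs
  have hsum : Integrable (fun ω => sampleMean (fun j => τ m (X n j ω)) +
      |sampleMean (fun j => h' (X n j ω)) - ∫ x, h' x ∂μ n|) (P n) := hti.1.add hbi'
  calc _ ≤ ∫ ω, (sampleMean (fun j => τ m (X n j ω)) +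
        |sampleMean (fun j => h' (X n j ω)) - ∫ x, h' x ∂μ n| + (ε / 8 + ε / 4)) ∂P n :=
        integral_mono (hin.sub (integrable_const _)).abs
          (hsum.add (integrable_const _)) h5
    _ = ∫ x, τ m x ∂μ n + ∫ ω, |sampleMean (fun j => h' (X n j ω)) - ∫ x, h' x ∂μ n| ∂P n +
        (ε / 8 + ε / 4) := by
        rw [integral_add hsum (integrable_const _), integral_add hti.1 hbi', hti.2]
        simp
    _ < ε := by simp only [id] at h3; linarith

end lln

/-! ### Matrices as operators between Euclidean spaces -/

/-- The operator between Euclidean spaces given by a matrix. -/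
noncomputable def mclm {a b : ℕ} (A : Matrix (Fin a) (Fin b) ℝ) : E b →L[ℝ] E a :=
  LinearMap.toContinuousLinearMap (Matrix.toLpLin 2 2 A)

section mclm
variable {a b c : ℕ}

lemma mclm_apply (A : Matrix (Fin a) (Fin b) ℝ) (v : E b) :
    mclm A v = WithLp.toLp 2 (A *ᵥ v.ofLp) :=
  rfl

lemma mclm_mclm (A : Matrix (Fin a) (Fin b) ℝ) (B : Matrix (Fin b) (Fin c) ℝ) (v : E c) :
    mclm A (mclm B v) = mclm (A * B) v := by
  simp [mclm_apply, Matrix.mulVec_mulVec]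

lemma mclm_one (v : E a) : mclm (1 : Matrix (Fin a) (Fin a) ℝ) v = v := by
  simp [mclm_apply]

lemma inner_eq_dotProduct (v w : E a) : inner ℝ v w = v.ofLp ⬝ᵥ w.ofLp := by
  rw [EuclideanSpace.inner_eq_star_dotProduct, dotProduct_comm]; rfl

lemma inner_mclm_left (A : Matrix (Fin a) (Fin b) ℝ) (v : E b) (w : E a) :
    inner ℝ (mclm A v) w = inner ℝ v (mclm Aᵀ w) := by
  rw [inner_eq_dotProduct, inner_eq_dotProduct, mclm_apply, mclm_apply]
  simp only
  rw [Matrix.dotProduct_mulVec, Matrix.vecMul_transpose]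

lemma mclm_single (A : Matrix (Fin a) (Fin b) ℝ) (j : Fin b) (i : Fin a) :
    mclm A (EuclideanSpace.single j 1) i = A i j := by
  simp [mclm_apply]

lemma measurable_coord (i : Fin a) : Measurable fun v : E a => v i :=
  (EuclideanSpace.proj i : E a →L[ℝ] ℝ).measurable

/-- An operator is a finite sum of rank-one maps depending continuously on its columns. This allows
laws of large numbers to be applied entry by entry. -/
lemma tendsto_clm_of_entries {I : Type*} {l : Filter I} {L : I → E b →L[ℝ] E a} {L₀ : E b →L[ℝ] E a}
    (h : ∀ j i, Tendsto (fun z => L z (EuclideanSpace.single j 1) i) l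
      (𝓝 (L₀ (EuclideanSpace.single j 1) i))) : Tendsto L l (𝓝 L₀) := by
  have h1 : ∀ j, Tendsto (fun z => L z (EuclideanSpace.single j 1)) l
      (𝓝 (L₀ (EuclideanSpace.single j 1))) := fun j => by
    have := (PiLp.continuous_toLp 2 (fun _ : Fin a => ℝ)).tendsto _ |>.comp
      (tendsto_pi_nhds.2 (h j))
    exact this
  have h2 : ∀ T : E b →L[ℝ] E a, T = ∑ j, ContinuousLinearMap.smulRightL ℝ (E b) (E a)
      (EuclideanSpace.proj j) (T (EuclideanSpace.single j 1)) := fun T => by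
    ext1 v
    conv_lhs => rw [← (EuclideanSpace.basisFun (Fin b) ℝ).sum_repr v]
    simp [map_sum]
  rw [h2 L₀]
  refine Tendsto.congr (fun z => (h2 (L z)).symm) (tendsto_finsetSum _ fun j _ => ?_)
  exact ((ContinuousLinearMap.smulRightL ℝ (E b) (E a) (EuclideanSpace.proj j)).continuous.tendsto
    _).comp (h1 j)

end mclm

/-! ### Sample limits under local alternatives -/

section model
variable {k p r : ℕ} {g : E k → E p → E r} {F : Measure (E k)} {θ₀ f : E p}
  {U : Set (E p)} {K₁ K₂ K₃ : E k → ℝ} {Fn : ℕ → Measure (E k)}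

namespace Regular
variable (h : Regular g F θ₀ U K₁ K₂ K₃)
include h

/-- The directional derivative is a pointwise limit of difference quotients. Measurability of `g(·,
θ)` is available only for `θ` in `U`, so the increments start at an index `m₀` beyond which they
stay in `U`. -/
lemma measurable_fderiv_apply (v : E p) : Measurable fun x => fderiv ℝ (g x) θ₀ v := by
  have hc : Tendsto (fun m : ℕ => ((m : ℝ)⁻¹) • v) atTop (𝓝 0) := by
    simpa using (tendsto_inv_atTop_nhds_zero_nat (𝕜 := ℝ)).smul_const v
  have hU : ∀ᶠ m : ℕ in atTop, θ₀ + (m : ℝ)⁻¹ • v ∈ U := by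
    have := hc.const_add θ₀
    rw [add_zero] at this
    exact this.eventually (h.isOpen.mem_nhds h.mem)
  obtain ⟨m₀, hm₀⟩ := eventually_atTop.1 hU
  refine measurable_of_tendsto_metrizable (f := fun m x =>
    ((m + m₀ : ℕ) : ℝ) • (g x (θ₀ + ((m + m₀ : ℕ) : ℝ)⁻¹ • v) - g x θ₀)) (fun m => ?_)
    (tendsto_pi_nhds.2 fun x => ?_)
  · exact ((h.measurable _ (hm₀ (m + m₀) (by omega))).sub (h.measurable _ h.mem)).const_smul
      ((m + m₀ : ℕ) : ℝ)
  · refine (h.hasFDerivAt x h.mem).lim v ?_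
    simp only [Real.norm_natCast]
    exact tendsto_natCast_atTop_atTop.comp (tendsto_add_atTop_nat m₀)

lemma measurable_modulus (ρ : ℝ) : Measurable (modulus K₂ K₃ ρ) :=
  (h.measurable_K₂.const_mul 2).min (h.measurable_K₃.const_mul ρ)

lemma abs_modulus_le {ρ : ℝ} (hρ : 0 ≤ ρ) (x : E k) : |modulus K₂ K₃ ρ x| ≤ 2 * K₂ x := by
  have h2 := h.K₂_nonneg x
  have h3 := h.K₃_nonneg x
  rw [abs_of_nonneg (le_min (by positivity) (by positivity))]
  exact min_le_left _ _

lemma integral_modulus_le {ρ : ℝ} (hρ : 0 ≤ ρ) :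
    ∫ x, modulus K₂ K₃ ρ x ∂F ≤ ρ * ∫ x, K₃ x ∂F := by
  rw [← integral_const_mul]
  refine integral_mono_of_nonneg (ae_of_all _ fun x => ?_) (h.integrable_K₃.const_mul ρ)
    (ae_of_all _ fun x => min_le_right _ _)
  have h2 := h.K₂_nonneg x
  have h3 := h.K₃_nonneg x
  exact le_min (by positivity) (by positivity)

lemma integral_K₃_nonneg : 0 ≤ ∫ x, K₃ x ∂F := integral_nonneg h.K₃_nonneg

end Regular

lemma LocalAlternatives.envelope₁ [IsProbabilityMeasure F] [∀ n, IsProbabilityMeasure (Fn n)]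
    (hloc : LocalAlternatives g F θ₀ f K₁ K₂ Fn)
    (h : Regular g F θ₀ U K₁ K₂ K₃) (c : ℝ) : EnvelopeLimit Fn F fun x => c * (1 + K₁ x) where
  setwise := hloc.setwise
  measurable := (h.measurable_K₁.const_add 1).const_mul c
  integrable n := ((integrable_const 1).add (hloc.integrable_K₁ n)).const_mul c
  integrable_limit := ((integrable_const 1).add h.integrable_K₁).const_mul c
  tendsto := by
    simp_rw [integral_const_mul, fun n => integral_add (integrable_const 1) (hloc.integrable_K₁ n),
      integral_add (integrable_const 1) h.integrable_K₁]
    simpa using (hloc.tendsto_K₁.const_add 1).const_mul c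

lemma LocalAlternatives.envelope₂
    (hloc : LocalAlternatives g F θ₀ f K₁ K₂ Fn)
    (h : Regular g F θ₀ U K₁ K₂ K₃) (c : ℝ) : EnvelopeLimit Fn F fun x => c * K₂ x where
  setwise := hloc.setwise
  measurable := h.measurable_K₂.const_mul c
  integrable n := (hloc.integrable_K₂ n).const_mul c
  integrable_limit := h.integrable_K₂.const_mul c
  tendsto := by
    simp_rw [integral_const_mul]
    exact hloc.tendsto_K₂.const_mul c

lemma Regular.abs_inner_fderiv_le (h : Regular g F θ₀ U K₁ K₂ K₃) (v : E p) (u : E r) (x : E k) :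
    |inner ℝ (fderiv ℝ (g x) θ₀ v) u| ≤ ‖u‖ * ‖v‖ * K₂ x := by
  refine (abs_real_inner_le_norm _ _).trans ?_
  have h1 : ‖fderiv ℝ (g x) θ₀ v‖ ≤ K₂ x * ‖v‖ :=
    (ContinuousLinearMap.le_opNorm _ _).trans (by gcongr; exact h.bound_G x θ₀ h.mem)
  calc _ ≤ K₂ x * ‖v‖ * ‖u‖ := by gcongr
    _ = _ := by ring

/-- Everything except boundedness is the weak law with envelope `1 + K₁` for products of components
of `g`, and `2K₂` for the derivative and the modulus. Boundedness is imposed by the principal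
filter. -/
lemma sampleLimits [IsProbabilityMeasure F] [∀ n, IsProbabilityMeasure (Fn n)]
    (h : Regular g F θ₀ U K₁ K₂ K₃)
    (hloc : LocalAlternatives g F θ₀ f K₁ K₂ Fn) {Ω : ℕ → Type*} [∀ n, MeasurableSpace (Ω n)]
    {P : ∀ n, Measure (Ω n)} [∀ n, IsProbabilityMeasure (P n)] {X : ∀ n, Fin n → Ω n → E k}
    (hind : ∀ n, iIndepFun (X n) (P n)) (hX : ∀ n i, HasLaw (X n i) (Fn n) (P n)) (M : ℝ) :
    SampleLimits g θ₀ K₁ K₂ K₃ (probFilter P ⊓ 𝓟 {z : Σ n, Ω n |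
        ‖√(z.1 : ℝ) • sampleMean (fun j => g (X z.1 j z.2) θ₀)‖ ≤ M})
      (fun z => z.1) (fun z j => X z.1 j z.2) (mclm (S11 g F θ₀)) (mclm (S12 g F θ₀))
      (∫ x, K₃ x ∂F) (max (∫ x, K₁ x ∂F) (∫ x, K₂ x ∂F) + 1) M := by
  have hlln₁ : ∀ {u : E k → ℝ}, Measurable u → (∀ x, |u x| ≤ 1 * (1 + K₁ x)) →
      Tendsto (fun z : Σ n, Ω n => sampleMean fun j => u (X z.1 j z.2)) (probFilter P)
        (𝓝 (∫ x, u x ∂F)) := fun hu hle =>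
    tendsto_sampleMean_probFilter hind hX (hloc.envelope₁ h 1) hu hle
  have hlln₂ : ∀ {u : E k → ℝ}, Measurable u → (∀ x, |u x| ≤ 2 * K₂ x) →
      Tendsto (fun z : Σ n, Ω n => sampleMean fun j => u (X z.1 j z.2)) (probFilter P)
        (𝓝 (∫ x, u x ∂F)) := fun hu hle =>
    tendsto_sampleMean_probFilter hind hX (hloc.envelope₂ h 2) hu hle
  have hg : Measurable fun x => g x θ₀ := h.measurable _ h.mem
  refine ⟨tendsto_fst_probFilter.mono_left inf_le_left, ?_, ?_, ?_, ?_, fun ρ hρ ε hε => ?_, ?_⟩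
  · have := hlln₁ h.measurable_K₁ fun x => by
      rw [abs_of_nonneg (h.K₁_nonneg x)]; linarith
    exact (this.mono_left inf_le_left).eventually_le_const
      (lt_of_le_of_lt (le_max_left _ _) (lt_add_one _))
  · have := hlln₂ h.measurable_K₂ fun x => by
      rw [abs_of_nonneg (h.K₂_nonneg x)]; linarith [h.K₂_nonneg x]
    exact (this.mono_left inf_le_left).eventually_le_const
      (lt_of_le_of_lt (le_max_right _ _) (lt_add_one _))
  · refine Tendsto.mono_left (tendsto_clm_of_entries fun j i => ?_) inf_le_left
    have hc : ∀ i, Measurable fun x => g x θ₀ i := fun i =>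
      (measurable_coord i).comp hg
    have := hlln₁ ((hc i).mul (hc j)) fun x => by
      simp only [Pi.mul_apply, abs_mul, one_mul]
      have h1 := PiLp.norm_apply_le (g x θ₀) i
      have h2 := PiLp.norm_apply_le (g x θ₀) j
      rw [Real.norm_eq_abs] at h1 h2
      calc _ ≤ ‖g x θ₀‖ * ‖g x θ₀‖ := by gcongr
        _ ≤ _ := by rw [← pow_two]; exact h.norm_sq_le x h.mem
    rw [mclm_single]
    refine this.congr fun z => ?_
    rw [sampleSecond_apply]
    simp [sampleMean, EuclideanSpace.inner_single_left, mul_comm]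
  · refine Tendsto.mono_left (tendsto_clm_of_entries fun j i => ?_) inf_le_left
    have := hlln₂ (u := fun x => fderiv ℝ (g x) θ₀ (EuclideanSpace.single j 1) i)
      ((measurable_coord i).comp (h.measurable_fderiv_apply _)) fun x => by
      have h1 := PiLp.norm_apply_le (fderiv ℝ (g x) θ₀ (EuclideanSpace.single j 1)) i
      have h2 := (fderiv ℝ (g x) θ₀).le_opNorm (EuclideanSpace.single j 1)
      rw [show ‖EuclideanSpace.single j (1 : ℝ)‖ = 1 by simp, mul_one] at h2
      rw [Real.norm_eq_abs] at h1
      linarith [h.bound_G x θ₀ h.mem, h.K₂_nonneg x]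
    rw [mclm_single]
    refine this.congr fun z => ?_
    simp [sampleMean]
  · have := hlln₂ (h.measurable_modulus ρ) (h.abs_modulus_le hρ.le)
    exact (this.mono_left inf_le_left).eventually_le_const
      (lt_of_le_of_lt (h.integral_modulus_le hρ.le) (lt_add_of_pos_right _ hε))
  · exact eventually_inf_principal.2 (Eventually.of_forall fun z hz => hz)

/-! ### The central limit theorem for the estimating functions -/

/-- Taylor's formula for `|x| ≤ 1`; for `|x| ≥ 1` every term is separately dominated by a multiple
of `|x|³`, with total `7/2 ≤ 4`. -/
lemma norm_exp_mul_I_sub_le (x : ℝ) :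
    ‖Complex.exp (x * Complex.I) - (1 + x * Complex.I - x ^ 2 / 2)‖ ≤ 4 * |x| ^ 3 := by
  rcases le_total |x| 1 with hx | hx
  · have h1 := Complex.exp_bound (x := x * Complex.I) (by simpa using hx) (n := 3) (by norm_num)
    have h2 : ∑ m ∈ Finset.range 3, (x * Complex.I) ^ m / (m.factorial : ℂ) =
        1 + x * Complex.I - x ^ 2 / 2 := by
      simp [Finset.sum_range_succ, mul_pow]; ring
    rw [h2] at h1
    refine h1.trans ?_
    rw [norm_mul, Complex.norm_I, mul_one, Complex.norm_real, Real.norm_eq_abs, mul_comm]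
    gcongr
    norm_num [Nat.factorial]
  · have e1 : ‖Complex.exp (x * Complex.I)‖ = 1 := Complex.norm_exp_ofReal_mul_I x
    have e2 : ‖(1 + x * Complex.I - x ^ 2 / 2 : ℂ)‖ ≤ 1 + |x| + |x| ^ 2 / 2 := by
      refine (norm_sub_le _ _).trans (add_le_add ((norm_add_le _ _).trans ?_) ?_) <;> simp
    have h1 : |x| ≤ |x| ^ 3 := by nlinarith [abs_nonneg x, mul_self_nonneg (|x|)]
    have h2 : |x| ^ 2 ≤ |x| ^ 3 := pow_le_pow_right₀ hx (by norm_num)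
    refine (norm_sub_le _ _).trans ?_
    rw [e1]
    linarith

lemma localParam_sub (n : ℕ) : localParam θ₀ f n - θ₀ = (√(n : ℝ))⁻¹ • f := by
  simp [localParam]

lemma tendsto_localParam : Tendsto (localParam θ₀ f) atTop (𝓝 θ₀) := by
  have : Tendsto (fun n : ℕ => (√(n : ℝ))⁻¹) atTop (𝓝 0) :=
    tendsto_inv_atTop_zero.comp (tendsto_sqrt_atTop tendsto_id)
  have h1 := (this.smul_const f).const_add θ₀
  rw [zero_smul, add_zero] at h1
  exact h1

/-- The drift of the estimating functions at `θ₀` under the local alternatives. -/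
lemma tendsto_sqrt_mul_integral_inner [IsProbabilityMeasure F] [∀ n, IsProbabilityMeasure (Fn n)]
    (h : Regular g F θ₀ U K₁ K₂ K₃)
    (hloc : LocalAlternatives g F θ₀ f K₁ K₂ Fn) (u : E r) :
    Tendsto (fun n : ℕ => √(n : ℝ) * ∫ x, inner ℝ (g x θ₀) u ∂Fn n) atTop
      (𝓝 (-∫ x, inner ℝ (fderiv ℝ (g x) θ₀ f) u ∂F)) := by
  have hGm : Measurable fun x => inner ℝ (fderiv ℝ (g x) θ₀ f) u :=
    (h.measurable_fderiv_apply f).inner_const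
  have h1 := (hloc.envelope₂ h (‖u‖ * ‖f‖)).tendsto_integral hGm (h.abs_inner_fderiv_le f u)
  have hinn : ∀ θ ∈ U, ∀ x, |inner ℝ (g x θ) u| ≤ ‖u‖ * (1 + K₁ x) := fun θ hθ x => by
    refine (abs_real_inner_le_norm _ _).trans ?_
    rw [mul_comm]
    gcongr
    have := h.norm_sq_le x hθ
    nlinarith [sq_nonneg (‖g x θ‖ - 1), norm_nonneg (g x θ), h.K₁_nonneg x]
  have hgi : ∀ n, ∀ θ ∈ U, Integrable (fun x => inner ℝ (g x θ) u) (Fn n) := fun n θ hθ =>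
    (hloc.envelope₁ h ‖u‖).integrable_of_le ((h.measurable θ hθ).inner_const) (hinn θ hθ) n
  have hnormi : ∀ n, ∀ θ ∈ U, Integrable (fun x => g x θ) (Fn n) := fun n θ hθ => by
    refine ((hloc.envelope₁ h 1).integrable n).mono' (h.measurable θ hθ).aestronglyMeasurable
      (ae_of_all _ fun x => ?_)
    have := h.norm_sq_le x hθ
    nlinarith [sq_nonneg (‖g x θ‖ - 1), norm_nonneg (g x θ), h.K₁_nonneg x]
  obtain ⟨ρ, hρ, hρU⟩ := Metric.nhds_basis_closedBall.mem_iff.1 (h.isOpen.mem_nhds h.mem)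
  have hK := h.integral_K₃_nonneg
  set κ := ∫ x, K₃ x ∂F with hκ
  have h2 : Tendsto (fun n : ℕ => √(n : ℝ) * ∫ x, inner ℝ (g x θ₀) u ∂Fn n +
      ∫ x, inner ℝ (fderiv ℝ (g x) θ₀ f) u ∂Fn n) atTop (𝓝 0) := by
    refine Metric.tendsto_nhds.2 fun ε hε => ?_
    set η := ε / (4 * (‖f‖ + 1) * (‖u‖ + 1)) with hη
    have hηpos : 0 < η := by positivity
    set δ := min ρ (η / (κ + 1)) with hδ
    have hδpos : 0 < δ := by positivity
    have hδη : δ * κ ≤ η := by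
      calc δ * κ ≤ η / (κ + 1) * (κ + 1) := by gcongr; exacts [min_le_right _ _, by linarith]
        _ = η := by field_simp
    have hδU : Metric.closedBall θ₀ δ ⊆ U :=
      (Metric.closedBall_subset_closedBall (min_le_left _ _)).trans hρU
    have h3 := (hloc.envelope₂ h 2).tendsto_integral (h.measurable_modulus δ)
      (h.abs_modulus_le hδpos.le)
    filter_upwards [h3.eventually_le_const (lt_of_le_of_lt (h.integral_modulus_le hδpos.le)
        (lt_add_of_pos_right _ hηpos)),
      tendsto_localParam.eventually (Metric.closedBall_mem_nhds θ₀ hδpos),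
      eventually_gt_atTop 0] with n i1 i2 i3
    set s := √(n : ℝ) with hs
    have hs0 : 0 < s := by positivity
    have hθU := hδU i2
    have hzero : ∫ x, inner ℝ (g x (localParam θ₀ f n)) u ∂Fn n = 0 := by
      have : ∀ x, inner ℝ (g x (localParam θ₀ f n)) u =
          inner ℝ u (g x (localParam θ₀ f n)) := fun x => real_inner_comm _ _
      simp_rw [this]
      rw [integral_inner (hnormi n _ hθU), hloc.unbiased n, inner_zero_right]
    have hGi := (hloc.envelope₂ h (‖u‖ * ‖f‖)).integrable_of_le hGm (h.abs_inner_fderiv_le f u) n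
    have hmi := (hloc.envelope₂ h 2).integrable_of_le (h.measurable_modulus δ)
      (h.abs_modulus_le hδpos.le) n
    -- Unbiasedness at the local parameter allows its zero mean to be subtracted. The integrand
    -- becomes `√n` times the first-order Taylor remainder at `θ₀`, with opposite sign; hence the
    -- minus sign in the drift.
    have e1 : s * ∫ x, inner ℝ (g x θ₀) u ∂Fn n + ∫ x, inner ℝ (fderiv ℝ (g x) θ₀ f) u ∂Fn n =
        ∫ x, (s * (inner ℝ (g x θ₀) u - inner ℝ (g x (localParam θ₀ f n)) u) +
          inner ℝ (fderiv ℝ (g x) θ₀ f) u) ∂Fn n := by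
      have hi : Integrable (fun x => s * (inner ℝ (g x θ₀) u -
          inner ℝ (g x (localParam θ₀ f n)) u)) (Fn n) :=
        ((hgi n _ h.mem).sub (hgi n _ hθU)).const_mul s
      rw [integral_add hi hGi, integral_const_mul,
        integral_sub (hgi n _ h.mem) (hgi n _ hθU), hzero, sub_zero]
    rw [dist_zero_right, e1]
    have hpt : ∀ x, ‖s * (inner ℝ (g x θ₀) u - inner ℝ (g x (localParam θ₀ f n)) u) +
        inner ℝ (fderiv ℝ (g x) θ₀ f) u‖ ≤ ‖f‖ * ‖u‖ * modulus K₂ K₃ δ x := fun x => by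
      have j1 := h.norm_sub_sub_le hδU x i2
      rw [localParam_sub, map_smul] at j1
      have j2 : s * (inner ℝ (g x θ₀) u - inner ℝ (g x (localParam θ₀ f n)) u) +
          inner ℝ (fderiv ℝ (g x) θ₀ f) u = -(s * inner ℝ (g x (localParam θ₀ f n) - g x θ₀ -
            s⁻¹ • fderiv ℝ (g x) θ₀ f) u) := by
        rw [inner_sub_left, inner_sub_left, real_inner_smul_left]
        field_simp; ring
      rw [j2, norm_neg, norm_mul, Real.norm_of_nonneg hs0.le]
      rw [norm_smul, norm_inv, Real.norm_of_nonneg hs0.le] at j1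
      calc _ ≤ s * (modulus K₂ K₃ δ x * (s⁻¹ * ‖f‖) * ‖u‖) := by
            gcongr
            exact (norm_inner_le_norm _ _).trans (by gcongr)
        _ = _ := by field_simp
    calc _ ≤ ∫ x, ‖f‖ * ‖u‖ * modulus K₂ K₃ δ x ∂Fn n :=
          norm_integral_le_of_norm_le (hmi.const_mul _) (ae_of_all _ hpt)
      _ = ‖f‖ * ‖u‖ * ∫ x, modulus K₂ K₃ δ x ∂Fn n := integral_const_mul _ _
      _ ≤ ‖f‖ * ‖u‖ * (2 * η) := by gcongr; linarith
      _ ≤ (‖f‖ + 1) * (‖u‖ + 1) * (2 * η) := by gcongr <;> linarith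
      _ = ε / 2 := by rw [hη]; field_simp; norm_num
      _ < ε := by linarith
  have := h2.sub h1
  rw [zero_sub] at this
  exact this.congr fun n => by ring

end model

section clt
variable {k p r : ℕ} {g : E k → E p → E r} {F : Measure (E k)} {θ₀ f : E p}
  {U : Set (E p)} {K₁ K₂ K₃ : E k → ℝ} {Fn : ℕ → Measure (E k)}

/-- The limit of `n (χₙ - 1)`, with `χₙ` the characteristic function of one rescaled summand,
follows from the second-order expansion, whose remainder is at most `4 ‖u‖³ ∫ K₁ / √n`; then `(1 +
zₙ/n)ⁿ → e^z`. No centring is made: the drift stays in the linear term. -/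
lemma tendsto_charFun_pow [IsProbabilityMeasure F] [∀ n, IsProbabilityMeasure (Fn n)]
    (h : Regular g F θ₀ U K₁ K₂ K₃)
    (hloc : LocalAlternatives g F θ₀ f K₁ K₂ Fn) (u : E r) :
    Tendsto (fun n : ℕ => charFun ((Fn n).map fun x => g x θ₀) ((√(n : ℝ))⁻¹ • u) ^ n) atTop
      (𝓝 (Complex.exp ((-∫ x, inner ℝ (fderiv ℝ (g x) θ₀ f) u ∂F : ℝ) * Complex.I -
        (∫ x, inner ℝ (g x θ₀) u ^ 2 ∂F : ℝ) / 2))) := by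
  have hgm : Measurable fun x => g x θ₀ := h.measurable _ h.mem
  have hm : Measurable fun x => inner ℝ (g x θ₀) u := hgm.inner_const
  have hle2 : ∀ x, |inner ℝ (g x θ₀) u ^ 2| ≤ ‖u‖ ^ 2 * (1 + K₁ x) := fun x => by
    rw [abs_pow]
    calc _ ≤ (‖g x θ₀‖ * ‖u‖) ^ 2 := by gcongr; exact abs_real_inner_le_norm _ _
      _ = ‖u‖ ^ 2 * ‖g x θ₀‖ ^ 2 := by ring
      _ ≤ _ := by gcongr; exact h.norm_sq_le x h.mem
  have hle3 : ∀ x, |inner ℝ (g x θ₀) u| ^ 3 ≤ ‖u‖ ^ 3 * K₁ x := fun x => by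
    calc _ ≤ (‖g x θ₀‖ * ‖u‖) ^ 3 := by gcongr; exact abs_real_inner_le_norm _ _
      _ = ‖u‖ ^ 3 * ‖g x θ₀‖ ^ 3 := by ring
      _ ≤ _ := by gcongr; exact h.bound_g x _ h.mem
  have hi2 := (hloc.envelope₁ h (‖u‖ ^ 2)).integrable_of_le (hm.pow_const 2) hle2
  have hi1 : ∀ n, Integrable (fun x => inner ℝ (g x θ₀) u) (Fn n) := fun n =>
    (((memLp_two_iff_integrable_sq hm.aestronglyMeasurable).2 (hi2 n))).integrable one_le_two
  have hq := (hloc.envelope₁ h (‖u‖ ^ 2)).tendsto_integral (hm.pow_const 2) hle2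
  have he := tendsto_sqrt_mul_integral_inner h hloc u
  set t₁ := -∫ x, inner ℝ (fderiv ℝ (g x) θ₀ f) u ∂F
  set t₂ := ∫ x, inner ℝ (g x θ₀) u ^ 2 ∂F
  have hmain : Tendsto (fun n : ℕ => (n : ℂ) *
      (charFun ((Fn n).map fun x => g x θ₀) ((√(n : ℝ))⁻¹ • u) - 1)) atTop
      (𝓝 ((t₁ : ℂ) * Complex.I - (t₂ : ℂ) / 2)) := by
    have h1 : Tendsto (fun n : ℕ =>
        ((√(n : ℝ) * ∫ x, inner ℝ (g x θ₀) u ∂Fn n : ℝ) : ℂ) * Complex.I -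
        ((∫ x, inner ℝ (g x θ₀) u ^ 2 ∂Fn n : ℝ) : ℂ) / 2) atTop
        (𝓝 ((t₁ : ℂ) * Complex.I - (t₂ : ℂ) / 2)) :=
      ((Complex.continuous_ofReal.tendsto _ |>.comp he).mul_const _).sub
        ((Complex.continuous_ofReal.tendsto _ |>.comp hq).div_const _)
    have h2 : Tendsto (fun n : ℕ => (4 * ‖u‖ ^ 3 * ∫ x, K₁ x ∂Fn n) / √(n : ℝ)) atTop (𝓝 0) :=
      (hloc.tendsto_K₁.const_mul (4 * ‖u‖ ^ 3)).div_atTop (tendsto_sqrt_atTop tendsto_id)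
    have h3 : Tendsto (fun n : ℕ => (n : ℂ) *
        (charFun ((Fn n).map fun x => g x θ₀) ((√(n : ℝ))⁻¹ • u) - 1) -
        (((√(n : ℝ) * ∫ x, inner ℝ (g x θ₀) u ∂Fn n : ℝ) : ℂ) * Complex.I -
        ((∫ x, inner ℝ (g x θ₀) u ^ 2 ∂Fn n : ℝ) : ℂ) / 2)) atTop (𝓝 0) := by
      refine squeeze_zero_norm' ?_ h2
      filter_upwards [eventually_gt_atTop 0] with n hn
      set s := √(n : ℝ) with hs
      have hs0 : 0 < s := by positivity
      have hss : s * s = n := Real.mul_self_sqrt (by positivity)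
      set Y := fun x => s⁻¹ * inner ℝ (g x θ₀) u with hY
      have hYm : Measurable Y := hm.const_mul _
      have hY1 : Integrable (fun x => ((Y x : ℝ) : ℂ)) (Fn n) := ((hi1 n).const_mul _).ofReal
      have hY2r : Integrable (fun x => Y x ^ 2) (Fn n) := by
        simp only [hY, mul_pow]; exact (hi2 n).const_mul _
      have hY2 : Integrable (fun x => ((Y x : ℝ) : ℂ) ^ 2) (Fn n) := by
        simpa using hY2r.ofReal (𝕜 := ℂ)
      have hexp : Integrable (fun x => Complex.exp ((Y x : ℂ) * Complex.I)) (Fn n) := by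
        refine Integrable.of_bound (by fun_prop) 1 (ae_of_all _ fun x => ?_)
        exact (Complex.norm_exp_ofReal_mul_I _).le
      have hcf : charFun ((Fn n).map fun x => g x θ₀) (s⁻¹ • u) =
          ∫ x, Complex.exp ((Y x : ℂ) * Complex.I) ∂Fn n := by
        rw [charFun_apply, integral_map hgm.aemeasurable (by fun_prop)]
        simp only [real_inner_smul_right, hY]
      have e1 : ∫ x, ((Y x : ℝ) : ℂ) ∂Fn n = (s⁻¹ * ∫ x, inner ℝ (g x θ₀) u ∂Fn n : ℝ) := by
        rw [integral_complex_ofReal, integral_const_mul]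
      have e2 : ∫ x, ((Y x : ℝ) : ℂ) ^ 2 ∂Fn n =
          (s⁻¹ ^ 2 * ∫ x, inner ℝ (g x θ₀) u ^ 2 ∂Fn n : ℝ) := by
        simp_rw [← Complex.ofReal_pow]
        rw [integral_complex_ofReal]
        simp_rw [hY, mul_pow]
        rw [integral_const_mul]
      have e3 : ∫ x, (Complex.exp ((Y x : ℂ) * Complex.I) -
          (1 + Y x * Complex.I - (Y x : ℂ) ^ 2 / 2)) ∂Fn n =
          ∫ x, Complex.exp ((Y x : ℂ) * Complex.I) ∂Fn n -
          (1 + (∫ x, ((Y x : ℝ) : ℂ) ∂Fn n) * Complex.I -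
            (∫ x, ((Y x : ℝ) : ℂ) ^ 2 ∂Fn n) / 2) := by
        have i1 : Integrable (fun x => (Y x : ℂ) * Complex.I) (Fn n) := hY1.mul_const _
        have i2 : Integrable (fun x => (Y x : ℂ) ^ 2 / 2) (Fn n) := hY2.div_const _
        have i3 : Integrable (fun x => 1 + (Y x : ℂ) * Complex.I) (Fn n) :=
          (integrable_const _).add i1
        have i4 : Integrable (fun x => 1 + (Y x : ℂ) * Complex.I - (Y x : ℂ) ^ 2 / 2) (Fn n) :=
          i3.sub i2
        rw [integral_sub hexp i4, integral_sub i3 i2, integral_add (integrable_const _) i1,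
          integral_mul_const, integral_div]
        simp
      have e4 : (n : ℂ) * (charFun ((Fn n).map fun x => g x θ₀) (s⁻¹ • u) - 1) -
          (((s * ∫ x, inner ℝ (g x θ₀) u ∂Fn n : ℝ) : ℂ) * Complex.I -
          ((∫ x, inner ℝ (g x θ₀) u ^ 2 ∂Fn n : ℝ) : ℂ) / 2) =
          (n : ℂ) * ∫ x, (Complex.exp ((Y x : ℂ) * Complex.I) -
          (1 + Y x * Complex.I - (Y x : ℂ) ^ 2 / 2)) ∂Fn n := by
        rw [e3, hcf, e1, e2]
        have hsC : (n : ℂ) = (s : ℂ) * s := by rw [← Complex.ofReal_mul, hss]; simp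
        have hsC0 : (s : ℂ) ≠ 0 := by exact_mod_cast hs0.ne'
        rw [hsC]
        push_cast
        generalize ∫ x, Complex.exp ((Y x : ℂ) * Complex.I) ∂Fn n = c
        field_simp
        ring
      rw [e4, norm_mul, Complex.norm_natCast]
      have e5 : ‖∫ x, (Complex.exp ((Y x : ℂ) * Complex.I) -
          (1 + Y x * Complex.I - (Y x : ℂ) ^ 2 / 2)) ∂Fn n‖ ≤
          ∫ x, 4 * s⁻¹ ^ 3 * (‖u‖ ^ 3 * K₁ x) ∂Fn n := by
        refine norm_integral_le_of_norm_le (((hloc.integrable_K₁ n).const_mul _).const_mul _)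
          (ae_of_all _ fun x => (norm_exp_mul_I_sub_le (Y x)).trans ?_)
        rw [hY, abs_mul, abs_of_pos (inv_pos.2 hs0), mul_pow, mul_assoc]
        gcongr
        exact hle3 x
      rw [integral_const_mul, integral_const_mul] at e5
      calc _ ≤ (n : ℝ) * (4 * s⁻¹ ^ 3 * (‖u‖ ^ 3 * ∫ x, K₁ x ∂Fn n)) := by gcongr
        _ = _ := by rw [← hss]; field_simp
    simpa using h3.add h1
  exact (Complex.tendsto_one_add_pow_exp_of_tendsto hmain).congr fun n => by
    rw [add_sub_cancel]

lemma integral_inner_fderiv [IsProbabilityMeasure F]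
    (h : Regular g F θ₀ U K₁ K₂ K₃) (f : E p) (u : E r) :
    ∫ x, inner ℝ (fderiv ℝ (g x) θ₀ f) u ∂F = inner ℝ u (mclm (S12 g F θ₀) f) := by
  have hint : ∀ j i, Integrable (fun x => fderiv ℝ (g x) θ₀ (EuclideanSpace.single j 1) i) F :=
    fun j i => by
    refine (h.integrable_K₂).mono' ((measurable_coord i).comp
      (h.measurable_fderiv_apply _)).aestronglyMeasurable (ae_of_all _ fun x => ?_)
    have h1 := PiLp.norm_apply_le (fderiv ℝ (g x) θ₀ (EuclideanSpace.single j 1)) i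
    have h2 := (fderiv ℝ (g x) θ₀).le_opNorm (EuclideanSpace.single j 1)
    rw [show ‖EuclideanSpace.single j (1 : ℝ)‖ = 1 by simp, mul_one] at h2
    linarith [h.bound_G x θ₀ h.mem]
  have hpt : ∀ x, inner ℝ (fderiv ℝ (g x) θ₀ f) u =
      ∑ i, ∑ j, (u i * f j) * fderiv ℝ (g x) θ₀ (EuclideanSpace.single j 1) i := fun x => by
    conv_lhs => rw [← (EuclideanSpace.basisFun (Fin p) ℝ).sum_repr f]
    simp only [map_sum, map_smul, EuclideanSpace.basisFun_repr, EuclideanSpace.basisFun_apply]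
    rw [inner_eq_dotProduct, dotProduct]
    refine Finset.sum_congr rfl fun i _ => ?_
    simp only [WithLp.ofLp_sum, Finset.sum_apply, WithLp.ofLp_smul, Pi.smul_apply, smul_eq_mul,
      Finset.sum_mul]
    exact Finset.sum_congr rfl fun j _ => by ring
  simp_rw [hpt]
  rw [integral_finsetSum _ fun i _ => integrable_finsetSum _ fun j _ => (hint j i).const_mul _,
    inner_eq_dotProduct, dotProduct, mclm_apply]
  refine Finset.sum_congr rfl fun i _ => ?_
  rw [integral_finsetSum _ fun j _ => (hint j i).const_mul _]
  simp only [Matrix.mulVec, dotProduct, Finset.mul_sum]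
  refine Finset.sum_congr rfl fun j _ => ?_
  rw [integral_const_mul]
  simp only [S12, Matrix.of_apply]
  ring

lemma integral_inner_sq [IsProbabilityMeasure F]
    (h : Regular g F θ₀ U K₁ K₂ K₃) (u : E r) :
    ∫ x, inner ℝ (g x θ₀) u ^ 2 ∂F = u.ofLp ⬝ᵥ S11 g F θ₀ *ᵥ u.ofLp := by
  have hc : ∀ i, Measurable fun x => g x θ₀ i := fun i =>
    (measurable_coord i).comp (h.measurable _ h.mem)
  have hint : ∀ i j, Integrable (fun x => g x θ₀ i * g x θ₀ j) F := fun i j => by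
    refine ((integrable_const 1).add h.integrable_K₁).mono' ((hc i).mul (hc j)).aestronglyMeasurable
      (ae_of_all _ fun x => ?_)
    have h1 := PiLp.norm_apply_le (g x θ₀) i
    have h2 := PiLp.norm_apply_le (g x θ₀) j
    rw [norm_mul]
    calc _ ≤ ‖g x θ₀‖ * ‖g x θ₀‖ := by gcongr
      _ ≤ _ := by rw [← pow_two]; exact h.norm_sq_le x h.mem
  have hpt : ∀ x, inner ℝ (g x θ₀) u ^ 2 =
      ∑ i, ∑ j, (u i * u j) * (g x θ₀ i * g x θ₀ j) := fun x => by
    rw [inner_eq_dotProduct, dotProduct, pow_two, Finset.sum_mul_sum]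
    exact Finset.sum_congr rfl fun i _ => Finset.sum_congr rfl fun j _ => by ring
  simp_rw [hpt]
  rw [integral_finsetSum _ fun i _ => integrable_finsetSum _ fun j _ => (hint i j).const_mul _,
    dotProduct]
  refine Finset.sum_congr rfl fun i _ => ?_
  rw [integral_finsetSum _ fun j _ => (hint i j).const_mul _]
  simp only [Matrix.mulVec, dotProduct, Finset.mul_sum]
  refine Finset.sum_congr rfl fun j _ => ?_
  rw [integral_const_mul]
  simp only [S11, Matrix.of_apply]
  ring

/-- Central limit theorem for `n^{-1/2} ∑ᵢ g(Xᵢ, θ₀)` under local alternatives. -/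
lemma tendstoInDistribution_sampleMean [IsProbabilityMeasure F] [∀ n, IsProbabilityMeasure (Fn n)]
    (h : Regular g F θ₀ U K₁ K₂ K₃)
    (hloc : LocalAlternatives g F θ₀ f K₁ K₂ Fn) {Ω : ℕ → Type*} [∀ n, MeasurableSpace (Ω n)]
    {P : ∀ n, Measure (Ω n)} [∀ n, IsProbabilityMeasure (P n)] {X : ∀ n, Fin n → Ω n → E k}
    (hind : ∀ n, iIndepFun (X n) (P n)) (hX : ∀ n i, HasLaw (X n i) (Fn n) (P n)) :
    TendstoInDistribution (fun (n : ℕ) ω => √(n : ℝ) • sampleMean (fun j => g (X n j ω) θ₀)) atTop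
      (id : E r → E r) P (multivariateGaussian (-mclm (S12 g F θ₀) f) (S11 g F θ₀)) := by
  have hgm : Measurable fun x => g x θ₀ := h.measurable _ h.mem
  have hmeas : ∀ n j, AEMeasurable (fun ω => g (X n j ω) θ₀) (P n) := fun n j =>
    hgm.comp_aemeasurable (hX n j).aemeasurable
  have hWeq : ∀ n : ℕ, (fun ω => √(n : ℝ) • sampleMean (fun j => g (X n j ω) θ₀)) =
      fun ω => (√(n : ℝ))⁻¹ • ∑ j, g (X n j ω) θ₀ := fun n => by
    ext1 ω
    rw [sampleMean, smul_smul]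
    congr 1
    rcases eq_or_ne (n : ℝ) 0 with h0 | h0
    · simp [h0]
    · have : √(n : ℝ) ≠ 0 := by positivity
      field_simp
      exact Real.sq_sqrt (by positivity)
  have hsum : ∀ n, AEMeasurable (fun ω => ∑ j, g (X n j ω) θ₀) (P n) := fun n =>
    Finset.aemeasurable_fun_sum _ fun j _ => hmeas n j
  refine ⟨fun n => ?_, aemeasurable_id,
    ProbabilityMeasure.tendsto_iff_tendsto_charFun.2 fun u => ?_⟩
  · rw [hWeq]
    exact (hsum n).const_smul (√(n : ℝ))⁻¹
  · have hlim := tendsto_charFun_pow h hloc u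
    simp only [ProbabilityMeasure.coe_mk, Measure.map_id]
    rw [charFun_multivariateGaussian h.posDef.posSemidef, inner_neg_right,
      ← integral_inner_fderiv h, ← integral_inner_sq h]
    convert hlim using 2 with n
    rw [hWeq, charFun_map_smul_comp (hsum n),
      iIndepFun.charFun_map_fun_sum_eq_prod (X := fun j ω => g (X n j ω) θ₀) (hmeas n)
        ((hind n).comp (fun _ x => g x θ₀) fun _ => hgm)]
    rw [Finset.prod_apply]
    have : ∀ j, (P n).map (fun ω => g (X n j ω) θ₀) = (Fn n).map fun x => g x θ₀ := fun j => by
      rw [← (hX n j).map_eq, AEMeasurable.map_map_of_aemeasurable hgm.aemeasurable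
        (hX n j).aemeasurable]
      rfl
    simp [this]

end clt

/-! ### Linear algebra of the limiting experiment -/

/-- The constant is the minimum over the unit sphere, and homogeneity extends the bound. In
dimension zero the sphere is empty and any constant works. -/
lemma exists_pos_mul_norm_sq_le {d : ℕ} {q : E d → ℝ} (hq : Continuous q)
    (hhom : ∀ (t : ℝ) v, q (t • v) = t ^ 2 * q v) (hpos : ∀ v, v ≠ 0 → 0 < q v) :
    ∃ c, 0 < c ∧ ∀ v, c * ‖v‖ ^ 2 ≤ q v := by
  have hq0 : q 0 = 0 := by simpa using hhom 0 0
  rcases (Metric.sphere (0 : E d) 1).eq_empty_or_nonempty with he | hne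
  · refine ⟨1, one_pos, fun v => ?_⟩
    have hv : v = 0 := by
      by_contra hv
      have : (‖v‖⁻¹ • v) ∈ Metric.sphere (0 : E d) 1 := by
        simp [norm_smul, hv]
      rw [he] at this
      exact this
    simp [hv, hq0]
  · obtain ⟨w, hw, hmin⟩ := (isCompact_sphere (0 : E d) 1).exists_isMinOn hne hq.continuousOn
    have hw1 : ‖w‖ = 1 := by simpa using hw
    refine ⟨q w, hpos w (by rintro rfl; simp at hw1), fun v => ?_⟩
    rcases eq_or_ne v 0 with rfl | hv
    · simp [hq0]
    · have hmem : (‖v‖⁻¹ • v) ∈ Metric.sphere (0 : E d) 1 := by simp [norm_smul, hv]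
      have h1 : q w ≤ q (‖v‖⁻¹ • v) := hmin hmem
      rw [hhom, inv_pow, inv_mul_eq_div, le_div_iff₀ (by positivity)] at h1
      exact h1

open scoped MatrixOrder in
lemma exists_transpose_mul_self {d : ℕ} {J : Matrix (Fin d) (Fin d) ℝ} (hJ : J.PosDef) :
    ∃ L : Matrix (Fin d) (Fin d) ℝ, Lᵀ * L = J := by
  refine ⟨CFC.sqrt J, ?_⟩
  have h1 : star (CFC.sqrt J) = CFC.sqrt J := (CFC.sqrt_nonneg J).isSelfAdjoint
  rw [Matrix.star_eq_conjTranspose, Matrix.conjTranspose_eq_transpose_of_trivial] at h1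
  rw [h1]
  exact CFC.sqrt_mul_sqrt_self _ hJ.posSemidef.nonneg

section info
variable {p r : ℕ} {S : Matrix (Fin r) (Fin r) ℝ} {D : Matrix (Fin r) (Fin p) ℝ}

lemma mulVec_injective_of_rank (hD : D.rank = p) : Function.Injective D.mulVec := by
  have h1 := LinearMap.finrank_range_add_finrank_ker D.mulVecLin
  have h2 : Module.finrank ℝ (LinearMap.range D.mulVecLin) = p := hD
  rw [h2, Module.finrank_fin_fun] at h1
  have h3 : Module.finrank ℝ (LinearMap.ker D.mulVecLin) = 0 := by omega
  exact LinearMap.ker_eq_bot.1 (Submodule.finrank_eq_zero.1 h3)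

lemma posDef_information (hS : S.PosDef) (hD : D.rank = p) : (Dᵀ * S⁻¹ * D).PosDef := by
  have := hS.inv.conjTranspose_mul_mul_same (mulVec_injective_of_rank hD)
  rwa [Matrix.conjTranspose_eq_transpose_of_trivial] at this

lemma transpose_inv_of_posDef {d : ℕ} {A : Matrix (Fin d) (Fin d) ℝ} (hA : A.PosDef) :
    (A⁻¹)ᵀ = A⁻¹ := by
  have := hA.inv.isHermitian
  rwa [Matrix.IsHermitian, Matrix.conjTranspose_eq_transpose_of_trivial] at this

/-- The influence matrix `-(DᵀS⁻¹D)⁻¹DᵀS⁻¹` of the empirical maximum likelihood estimator. -/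
noncomputable def influence (S : Matrix (Fin r) (Fin r) ℝ) (D : Matrix (Fin r) (Fin p) ℝ) :
    Matrix (Fin p) (Fin r) ℝ := -((Dᵀ * S⁻¹ * D)⁻¹ * (Dᵀ * S⁻¹))

lemma influence_mul (hS : S.PosDef) (hD : D.rank = p) : influence S D * D = -1 := by
  have hJ := posDef_information hS hD
  rw [influence, Matrix.neg_mul, Matrix.mul_assoc, Matrix.nonsing_inv_mul _
    ((Matrix.isUnit_iff_isUnit_det _).1 hJ.isUnit)]

/-- The sandwich covariance collapses to the inverse information because the weight `S⁻¹` matches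
the covariance `S`. -/
lemma influence_mul_mul_transpose (hS : S.PosDef) (hD : D.rank = p) :
    influence S D * S * (influence S D)ᵀ = (Dᵀ * S⁻¹ * D)⁻¹ := by
  have hJ := posDef_information hS hD
  have hSu := (Matrix.isUnit_iff_isUnit_det _).1 hS.isUnit
  have hJu := (Matrix.isUnit_iff_isUnit_det _).1 hJ.isUnit
  set J := Dᵀ * S⁻¹ * D with hJdef
  have h1 : (influence S D)ᵀ = -(S⁻¹ * D * J⁻¹) := by
    rw [influence, Matrix.transpose_neg, Matrix.transpose_mul, Matrix.transpose_mul,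
      transpose_inv_of_posDef hS, transpose_inv_of_posDef hJ, Matrix.transpose_transpose]
  have h2 : influence S D * S = -(J⁻¹ * Dᵀ) := by
    rw [influence, ← hJdef, Matrix.neg_mul, Matrix.mul_assoc, Matrix.mul_assoc Dᵀ,
      Matrix.nonsing_inv_mul _ hSu, Matrix.mul_one]
  rw [h1, h2, Matrix.neg_mul, Matrix.mul_neg, neg_neg, Matrix.mul_assoc,
    ← Matrix.mul_assoc Dᵀ, ← Matrix.mul_assoc Dᵀ,
    ← hJdef, Matrix.mul_nonsing_inv _ hJu, Matrix.mul_one]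

lemma inner_mclm_eq_norm_sq {L : Matrix (Fin p) (Fin p) ℝ} (hL : Lᵀ * L = Dᵀ * S⁻¹ * D) (v : E p) :
    inner ℝ (mclm D v) (mclm S⁻¹ (mclm D v)) = ‖mclm L v‖ ^ 2 := by
  rw [inner_mclm_left, mclm_mclm, mclm_mclm, ← hL, ← mclm_mclm, ← inner_mclm_left,
    real_inner_self_eq_norm_sq]

/-- The law of the limiting quadratic form. -/
lemma map_norm_sq_multivariateGaussian (hp : 0 < p) (hS : S.PosDef) (hD : D.rank = p)
    {L : Matrix (Fin p) (Fin p) ℝ} (hL : Lᵀ * L = Dᵀ * S⁻¹ * D) (f : E p) :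
    (multivariateGaussian (-mclm D f) S).map (fun w => ‖mclm (L * influence S D) w‖ ^ 2) =
      noncentralChiSq p (f.ofLp ⬝ᵥ ((Dᵀ * S⁻¹ * D) *ᵥ f.ofLp)) := by
  have hJ := posDef_information hS hD
  have hJu := (Matrix.isUnit_iff_isUnit_det _).1 hJ.isUnit
  set δ := f.ofLp ⬝ᵥ ((Dᵀ * S⁻¹ * D) *ᵥ f.ofLp) with hδ
  set A := L * influence S D with hA
  have hLu : IsUnit L.det := by
    rw [← hL, Matrix.det_mul] at hJu
    exact isUnit_of_mul_isUnit_right hJu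
  -- `A` whitens: the covariance is `L J⁻¹ Lᵀ`, and `J = LᵀL` with `L` invertible.
  have hAA : A * S * Aᵀ = 1 := by
    rw [hA, Matrix.transpose_mul, Matrix.mul_assoc L, Matrix.mul_assoc L,
      ← Matrix.mul_assoc (influence S D * S),
      influence_mul_mul_transpose hS hD, ← hL, Matrix.mul_inv_rev, Matrix.mul_assoc,
      Matrix.nonsing_inv_mul _ (by rwa [Matrix.det_transpose]), Matrix.mul_one,
      Matrix.mul_nonsing_inv _ hLu]
  have hAD : mclm A (-mclm D f) = mclm L f := by
    rw [map_neg, mclm_mclm, hA, Matrix.mul_assoc, influence_mul hS hD, mclm_apply, mclm_apply,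
      Matrix.mul_neg, Matrix.mul_one, Matrix.neg_mulVec, WithLp.toLp_neg, neg_neg]
  have hnorm : ‖mclm L f‖ ^ 2 = δ := by
    rw [← real_inner_self_eq_norm_sq, inner_mclm_left, mclm_mclm, hL, inner_eq_dotProduct, hδ]
    rfl
  set e : E p := EuclideanSpace.single ⟨0, hp⟩ √δ with he
  have hen : ‖mclm L f‖ = ‖e‖ := by
    rw [he, PiLp.norm_single, Real.norm_of_nonneg (Real.sqrt_nonneg _), ← hnorm,
      Real.sqrt_sq (norm_nonneg _)]
  -- A reflection moves the mean `Lf` onto the first axis, at distance `√δ`. It preserves norms and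
  -- the identity covariance, so the mean takes the form used to define the noncentral law.
  set R := Submodule.reflection (ℝ ∙ (mclm L f - e))ᗮ with hR
  have hRe : R (mclm L f) = e := Submodule.reflection_sub hen
  have hmeas : Measurable fun w : E r => R (mclm A w) :=
    (R.continuous.comp (mclm A).continuous).measurable
  have hlaw : (multivariateGaussian (-mclm D f) S).map (fun w => R (mclm A w)) =
      (Measure.pi fun i : Fin p => gaussianReal (if i.val = 0 then √δ else 0) 1).map
        (WithLp.toLp 2) := by
    have hprob : IsProbabilityMeasure ((multivariateGaussian (-mclm D f) S).map
      (fun w => R (mclm A w))) := Measure.isProbabilityMeasure_map hmeas.aemeasurable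
    have hprob' : IsProbabilityMeasure ((Measure.pi fun i : Fin p =>
        gaussianReal (if i.val = 0 then √δ else 0) 1).map (WithLp.toLp 2 : (Fin p → ℝ) → E p)) :=
      Measure.isProbabilityMeasure_map (by fun_prop)
    refine Measure.ext_of_charFun (funext fun u => ?_)
    have h1 : ∀ w, inner ℝ (R (mclm A w)) u = inner ℝ w (mclm Aᵀ (R.symm u)) := fun w => by
      rw [← inner_mclm_left, ← R.inner_map_map (mclm A w) (R.symm u), R.apply_symm_apply]
    rw [charFun_apply, integral_map hmeas.aemeasurable (by fun_prop)]
    simp_rw [h1]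
    rw [← charFun_apply, charFun_multivariateGaussian hS.posSemidef, real_inner_comm, ← h1,
      hAD, hRe]
    have h2 : (mclm Aᵀ (R.symm u)).ofLp ⬝ᵥ S *ᵥ (mclm Aᵀ (R.symm u)).ofLp = ∑ i, u i ^ 2 := by
      have : S *ᵥ (mclm Aᵀ (R.symm u)).ofLp = (mclm S (mclm Aᵀ (R.symm u))).ofLp := rfl
      rw [this, ← inner_eq_dotProduct, inner_mclm_left, Matrix.transpose_transpose, mclm_mclm,
        mclm_mclm, hAA, mclm_one, real_inner_self_eq_norm_sq, R.symm.norm_map,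
        EuclideanSpace.real_norm_sq_eq]
    have hpi := charFun_pi (μ := fun i : Fin p => gaussianReal (if i.val = 0 then √δ else 0) 1) u
    rw [h2]
    refine Eq.trans ?_ hpi.symm
    simp_rw [charFun_gaussianReal, ← Complex.exp_sum]
    congr 1
    rw [Finset.sum_sub_distrib]
    congr 1
    · rw [he, EuclideanSpace.inner_single_left, Finset.sum_eq_single ⟨0, hp⟩]
      · simp [mul_comm]
      · intro b _ hb
        have : b.val ≠ 0 := fun h => hb (Fin.ext h)
        simp [this]
      · simp
    · simp [Finset.sum_div]
  have hsq : Measurable fun v : E p => ‖v‖ ^ 2 := by fun_prop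
  have hcomp : (fun w => ‖mclm A w‖ ^ 2) = (fun v : E p => ‖v‖ ^ 2) ∘ fun w => R (mclm A w) := by
    ext w; simp
  rw [hcomp, ← Measure.map_map hsq hmeas, hlaw, Measure.map_map hsq (by fun_prop), noncentralChiSq]
  congr 1
  ext z
  simp [EuclideanSpace.real_norm_sq_eq]

end info

lemma ncp_eq {k p r : ℕ} {g : E k → E p → E r} {F : Measure (E k)} {θ₀ : E p}
    (hS : (S11 g F θ₀).PosDef) (hD : (S12 g F θ₀).rank = p) (f : E p) :
    ncp g F θ₀ f = f.ofLp ⬝ᵥ (((S12 g F θ₀)ᵀ * (S11 g F θ₀)⁻¹ * S12 g F θ₀) *ᵥ f.ofLp) := by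
  rw [ncp, V, Matrix.nonsing_inv_nonsing_inv _
    ((Matrix.isUnit_iff_isUnit_det _).1 (posDef_information hS hD).isUnit)]

/-- The noncentral chi-squared law has no atoms. -/
lemma noncentralChiSq_singleton {p : ℕ} (hp : 0 < p) (δ c : ℝ) : noncentralChiSq p δ {c} = 0 := by
  obtain ⟨q, rfl⟩ : ∃ q, p = q + 1 := ⟨p - 1, by omega⟩
  have hm : Measurable fun z : Fin (q + 1) → ℝ => ∑ i, z i ^ 2 := by fun_prop
  rw [noncentralChiSq, Measure.map_apply hm (measurableSet_singleton c)]
  set μ : Fin (q + 1) → Measure ℝ := fun i => gaussianReal (if i.val = 0 then √δ else 0) 1 with hμ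
  have hmp := (measurePreserving_piFinSuccAbove μ 0).symm
  have hA := hm (measurableSet_singleton c)
  rw [← hmp.measure_preimage hA.nullMeasurableSet,
    Measure.prod_apply_symm (hmp.measurable hA)]
  -- With all coordinates but the first fixed, the first is confined to the two points `±√(c - ∑
  -- yⱼ²)`, a null set for a nondegenerate Gaussian law.
  refine lintegral_eq_zero_of_ae_eq_zero (ae_of_all _ fun y => ?_)
  have hno : NullSingletonClass (gaussianReal (if (0 : Fin (q + 1)).val = 0 then √δ else 0) 1) :=
    nullSingletonClass_gaussianReal one_ne_zero
  refine Set.Finite.measure_zero (Set.Finite.subset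
    (Set.toFinite {√(c - ∑ j, y j ^ 2), -√(c - ∑ j, y j ^ 2)}) fun x hx => ?_) (μ 0)
  have hx' : x ^ 2 + ∑ j, y j ^ 2 = c := by
    simpa [MeasurableEquiv.piFinSuccAbove_symm_apply, Fin.insertNthEquiv, Fin.sum_univ_succ]
      using hx
  have : √(c - ∑ j, y j ^ 2) = |x| := by
    rw [← hx', add_sub_cancel_right, Real.sqrt_sq_eq_abs]
  rw [this]
  rcases abs_choice x with h | h <;> simp [h]

/-! ### Convergence in probability and in law on a sequence of probability spaces -/

section slutsky
variable {Ω : ℕ → Type*} [∀ n, MeasurableSpace (Ω n)] {P : ∀ n, Measure (Ω n)}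
  [∀ n, IsProbabilityMeasure (P n)] {Ω' : Type*} [MeasurableSpace Ω'] {ν : Measure Ω'}
  [IsProbabilityMeasure ν]

/-- A property that holds with probability tending to one where a tight sequence is bounded holds
with probability tending to one. -/
lemma eventually_probFilter_of_tight {r : ℕ} {W : ∀ n, Ω n → E r} {Z : Ω' → E r}
    (hW : TendstoInDistribution W atTop Z P ν) {q : (Σ n, Ω n) → Prop}
    (h : ∀ M : ℝ, ∀ᶠ z in probFilter P ⊓ 𝓟 {z | ‖W z.1 z.2‖ ≤ M}, q z) :
    ∀ᶠ z in probFilter P, q z := by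
  refine eventually_probFilter.2 (ENNReal.tendsto_nhds_zero.2 fun η hη => ?_)
  have hη2 : 0 < η / 2 := ENNReal.half_pos hη.ne'
  have : IsProbabilityMeasure (ν.map Z) := Measure.isProbabilityMeasure_map hW.aemeasurable_limit
  have hcl : ∀ m : ℕ, IsClosed {v : E r | (m : ℝ) ≤ ‖v‖} := fun m =>
    isClosed_le continuous_const continuous_norm
  have htail : Tendsto (fun m : ℕ => ν.map Z {v : E r | (m : ℝ) ≤ ‖v‖}) atTop (𝓝 0) := by
    have h1 := tendsto_measure_iInter_atTop (μ := ν.map Z)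
      (s := fun m : ℕ => {v : E r | (m : ℝ) ≤ ‖v‖})
      (fun m => (hcl m).measurableSet.nullMeasurableSet)
      (fun m m' hm v hv => (Nat.cast_le.2 hm).trans (show (m' : ℝ) ≤ ‖v‖ from hv))
      ⟨0, measure_ne_top _ _⟩
    have h2 : ⋂ m : ℕ, {v : E r | (m : ℝ) ≤ ‖v‖} = ∅ := by
      ext v
      simpa using exists_nat_gt ‖v‖
    rwa [h2, measure_empty] at h1
  -- The limit law has small mass outside a large ball; the portmanteau theorem for the closed
  -- complement transfers this to all late `n`.
  obtain ⟨m, hm⟩ := (htail.eventually (gt_mem_nhds hη2)).exists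
  have h3 : ∀ᶠ n in atTop, P n {ω | (m : ℝ) ≤ ‖W n ω‖} < η / 2 := by
    have h4 := ProbabilityMeasure.limsup_measure_closed_le_of_tendsto hW.tendsto (hcl m)
    filter_upwards [eventually_lt_of_limsup_lt (h4.trans_lt hm)] with n hn
    simpa [Measure.map_apply_of_aemeasurable (hW.forall_aemeasurable n) (hcl m).measurableSet]
      using hn
  have h5 : ∀ᶠ n in atTop, P n {ω | ¬ (‖W n ω‖ ≤ m → q ⟨n, ω⟩)} < η / 2 :=
    (eventually_probFilter.1 (eventually_inf_principal.1 (h m))).eventually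
      (gt_mem_nhds hη2)
  filter_upwards [h3, h5] with n hn3 hn5
  calc P n {ω | ¬ q ⟨n, ω⟩}
      ≤ P n ({ω | (m : ℝ) ≤ ‖W n ω‖} ∪ {ω | ¬ (‖W n ω‖ ≤ m → q ⟨n, ω⟩)}) := by
        refine measure_mono fun ω hω => ?_
        by_cases hle : ‖W n ω‖ ≤ m
        · exact Or.inr fun hi => hω (hi hle)
        · exact Or.inl (not_le.1 hle).le
    _ ≤ η / 2 + η / 2 := (measure_union_le _ _).trans (add_le_add hn3.le hn5.le)
    _ = η := ENNReal.add_halves η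

/-- Slutsky's lemma on a sequence of probability spaces. -/
lemma tendstoInDistribution_of_tendsto_sub {T Q : ∀ n, Ω n → ℝ} {Z : Ω' → ℝ}
    (hQ : TendstoInDistribution Q atTop Z P ν) (hT : ∀ n, AEMeasurable (T n) (P n))
    (h : Tendsto (fun z : Σ n, Ω n => T z.1 z.2 - Q z.1 z.2) (probFilter P) (𝓝 0)) :
    TendstoInDistribution T atTop Z P ν := by
  -- All experiments are realized on one product space. Coordinate projections preserve the laws of
  -- the variables and of their differences, so Slutsky's lemma on a single space applies.
  have hmp := fun n => measurePreserving_eval_infinitePi P n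
  have hae : ∀ {Y : ∀ n, Ω n → ℝ}, (∀ n, AEMeasurable (Y n) (P n)) → ∀ n,
      AEMeasurable (fun ω : ∀ n, Ω n => Y n (ω n)) (Measure.infinitePi P) := fun hY n =>
    AEMeasurable.comp_quasiMeasurePreserving (hY n) (hmp n).quasiMeasurePreserving
  have hlaw : ∀ {Y : ∀ n, Ω n → ℝ}, (∀ n, AEMeasurable (Y n) (P n)) → ∀ n,
      (Measure.infinitePi P).map (fun ω : ∀ n, Ω n => Y n (ω n)) = (P n).map (Y n) :=
    fun {Y} hY n => by
    have h1 : AEMeasurable (Y n) ((Measure.infinitePi P).map (Function.eval n)) := by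
      rw [(hmp n).map_eq]; exact hY n
    rw [← (hmp n).map_eq, AEMeasurable.map_map_of_aemeasurable h1 (hmp n).aemeasurable]
    rfl
  have hQ' : TendstoInDistribution (fun n (ω : ∀ n, Ω n) => Q n (ω n)) atTop Z
      (fun _ => Measure.infinitePi P) ν := by
    refine ⟨hae hQ.forall_aemeasurable, hQ.aemeasurable_limit, ?_⟩
    exact hQ.tendsto.congr fun n => Subtype.ext (hlaw hQ.forall_aemeasurable n).symm
  have hT' := tendstoInDistribution_of_tendstoInMeasure_sub
    (fun n (ω : ∀ n, Ω n) => T n (ω n)) Z hQ' ?_ (hae hT)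
  · refine ⟨hT, hQ.aemeasurable_limit, ?_⟩
    exact hT'.tendsto.congr fun n => Subtype.ext (hlaw hT n)
  · refine tendstoInMeasure_iff_norm.2 fun ε hε => ?_
    have h1 := eventually_probFilter.1 (Metric.tendsto_nhds.1 h ε hε)
    refine h1.congr fun n => ?_
    have hTQ : AEMeasurable (fun ω => T n ω - Q n ω) (P n) := (hT n).sub (hQ.forall_aemeasurable n)
    have hset : NullMeasurableSet {ω | ¬ dist (T n ω - Q n ω) 0 < ε} (P n) := by
      simp only [not_lt, dist_zero_right]
      exact nullMeasurableSet_le aemeasurable_const hTQ.norm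
    rw [← (hmp n).measure_preimage hset]
    congr 1
    ext ω
    simp

end slutsky

/-! ### Limit of the test statistic -/

section limit
variable {k p r : ℕ} {g : E k → E p → E r} {F : Measure (E k)} {θ₀ f : E p}
  {U : Set (E p)} {K₁ K₂ K₃ : E k → ℝ}

lemma exists_pos_forall_mul_le_inner_mclm {d : ℕ} {A : Matrix (Fin d) (Fin d) ℝ} (hA : A.PosDef) :
    ∃ c > 0, ∀ v, c * ‖v‖ ^ 2 ≤ inner ℝ v (mclm A v) := by
  refine exists_pos_mul_norm_sq_le (q := fun v => inner ℝ v (mclm A v)) (by fun_prop)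
    (fun a v => ?_) fun v hv => ?_
  · simp only [map_smul, inner_smul_left, inner_smul_right]
    simp
    ring
  · rw [inner_eq_dotProduct, mclm_apply]
    simpa using hA.dotProduct_mulVec_pos (x := v.ofLp) (by simpa using hv)

lemma exists_pos_forall_mul_le_norm_mclm {r p : ℕ} {D : Matrix (Fin r) (Fin p) ℝ}
    (hD : D.rank = p) : ∃ c > 0, ∀ v, c * ‖v‖ ≤ ‖mclm D v‖ := by
  obtain ⟨c, hc, h⟩ := exists_pos_mul_norm_sq_le (q := fun v : E p => ‖mclm D v‖ ^ 2) (by fun_prop)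
    (fun a v => by simp [norm_smul, mul_pow]) fun v hv => by
      have : mclm D v ≠ 0 := fun h0 => hv (by
        have h1 : D *ᵥ v.ofLp = D *ᵥ 0 := by
          simpa [mclm_apply] using h0
        simpa using mulVec_injective_of_rank hD h1)
      positivity
  refine ⟨√c, by positivity, fun v => ?_⟩
  rw [← abs_of_nonneg (norm_nonneg (mclm D v)), ← Real.sqrt_sq_eq_abs]
  refine Real.le_sqrt_of_sq_le ?_
  rw [mul_pow, Real.sq_sqrt hc.le]
  exact h v

end limit

/-! ### Choice of the localization radius and assembly of the expansions -/

section limit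
variable {k p r : ℕ} {g : E k → E p → E r} {F : Measure (E k)} {θ₀ f : E p}
  {U : Set (E p)} {K₁ K₂ K₃ : E k → ℝ}

/-- On this ball the mean oscillation of the derivative is at most a quarter of the lower bound of
`S₁₂`, which leaves room for sampling errors in the consistency proof. The radius involves neither
`f` nor the laws of the alternatives. -/
lemma Regular.exists_radius (h : Regular g F θ₀ U K₁ K₂ K₃) :
    ∃ ρ₀ > 0, Metric.closedBall θ₀ ρ₀ ⊆ U ∧ ∃ c₀ > 0, (∀ v, c₀ * ‖v‖ ≤ ‖mclm (S12 g F θ₀) v‖) ∧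
      ρ₀ * ∫ x, K₃ x ∂F ≤ c₀ / 4 := by
  obtain ⟨ρ, hρ, hρU⟩ := Metric.nhds_basis_closedBall.mem_iff.1 (h.isOpen.mem_nhds h.mem)
  obtain ⟨c₀, hc₀, hD⟩ := exists_pos_forall_mul_le_norm_mclm h.rank_eq
  have hκ := h.integral_K₃_nonneg
  set κ := ∫ x, K₃ x ∂F
  refine ⟨min ρ (c₀ / 4 / (κ + 1)), by positivity,
    (Metric.closedBall_subset_closedBall (min_le_left _ _)).trans hρU, c₀, hc₀, hD, ?_⟩
  calc min ρ (c₀ / 4 / (κ + 1)) * κ ≤ c₀ / 4 / (κ + 1) * (κ + 1) := by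
        gcongr
        · exact min_le_right _ _
        · linarith
    _ = c₀ / 4 := by field_simp

/-- These are the normal equations of weighted least squares: `influence S D` sends `w` to the
minimizer of `h ↦ (w + Dh)ᵀS⁻¹(w + Dh)`. -/
lemma mclm_add_influence {S : Matrix (Fin r) (Fin r) ℝ} {D : Matrix (Fin r) (Fin p) ℝ}
    (hS : S.PosDef) (hD : D.rank = p) (v : E p) (w : E r) :
    inner ℝ (mclm D v) (mclm S⁻¹ (w + mclm D (mclm (influence S D) w))) = 0 := by
  have hJu := (Matrix.isUnit_iff_isUnit_det _).1 (posDef_information hS hD).isUnit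
  have hmat : Dᵀ * S⁻¹ * D * influence S D = -(Dᵀ * S⁻¹) := by
    rw [influence, Matrix.mul_neg, ← Matrix.mul_assoc, Matrix.mul_nonsing_inv _ hJu, Matrix.one_mul]
  rw [inner_mclm_left, map_add, map_add, mclm_mclm, mclm_mclm, mclm_mclm, mclm_mclm, hmat]
  simp [mclm_apply, Matrix.neg_mulVec]

/-- Quadratic approximation of the test statistic along a filter on which the samples behave
regularly. -/
lemma SampleLimits.tendsto_testStat_sub_norm_sq {I : Type*} {l : Filter I} {n : I → ℕ}
    {x : ∀ i, Fin (n i) → E k} {C M : ℝ} {θ : I → E p} {ρ : I → ℝ} {ρ₀ c₀ : ℝ}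
    (h : Regular g F θ₀ U K₁ K₂ K₃)
    (hs : SampleLimits g θ₀ K₁ K₂ K₃ l n x (mclm (S11 g F θ₀)) (mclm (S12 g F θ₀))
      (∫ x, K₃ x ∂F) C M)
    (hρ₀ : 0 < ρ₀) (hρU : Metric.closedBall θ₀ ρ₀ ⊆ U) (hc₀ : 0 < c₀)
    (hD : ∀ v, c₀ * ‖v‖ ≤ ‖mclm (S12 g F θ₀) v‖) (hρκ : ρ₀ * ∫ x, K₃ x ∂F ≤ c₀ / 4)
    {Θ : Set (E p)} (hU : U ⊆ Θ) (hρ : ∀ i, ρ i ≤ ρ₀)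
    (hρn : Tendsto (fun i => √(n i : ℝ) * ρ i) l atTop)
    (hEMLE : ∀ᶠ i in l, IsEMLE g (x i) (Θ ∩ Metric.closedBall θ₀ (ρ i)) (θ i))
    {L : Matrix (Fin p) (Fin p) ℝ}
    (hL : Lᵀ * L = (S12 g F θ₀)ᵀ * (S11 g F θ₀)⁻¹ * S12 g F θ₀)
    {φ : ℝ → ℝ} (hφ : PhiClass φ) :
    Tendsto (fun i => testStat φ g (x i) (θ i) θ₀ -
      ‖mclm (L * influence (S11 g F θ₀) (S12 g F θ₀))
        (√(n i : ℝ) • sampleMean fun j => g (x i j) θ₀)‖ ^ 2) l (𝓝 0) := by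
  obtain ⟨c, hc, hSc⟩ := exists_pos_forall_mul_le_inner_mclm h.posDef
  obtain ⟨c₁, hc₁, hD₁⟩ := exists_pos_forall_mul_le_inner_mclm
    (posDef_information h.posDef h.rank_eq)
  have hκ := h.integral_K₃_nonneg
  have hSu := (Matrix.isUnit_iff_isUnit_det _).1 h.posDef.isUnit
  have hinv : ∀ v, mclm (S11 g F θ₀)⁻¹ (mclm (S11 g F θ₀) v) = v := fun v => by
    rw [mclm_mclm, Matrix.nonsing_inv_mul _ hSu, mclm_one]
  have hinv' : ∀ v, mclm (S11 g F θ₀) (mclm (S11 g F θ₀)⁻¹ v) = v := fun v => by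
    rw [mclm_mclm, Matrix.mul_nonsing_inv _ hSu, mclm_one]
  have hsym : ∀ u v, inner ℝ u (mclm (S11 g F θ₀)⁻¹ v) = inner ℝ v (mclm (S11 g F θ₀)⁻¹ u) :=
    fun u v => by
      rw [real_inner_comm, inner_mclm_left, transpose_inv_of_posDef h.posDef]
  -- Since `√n ρₙ → ∞`, the maximization set eventually contains every ball of radius `R/√n`, so
  -- `θ₀` and the quadratic minimizer compete.
  have hA : ∀ R, ∀ᶠ i in l, ∀ θ, ‖√(n i : ℝ) • (θ - θ₀)‖ ≤ R →
      θ ∈ Θ ∩ Metric.closedBall θ₀ (ρ i) := fun R => by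
    filter_upwards [hρn.eventually_ge_atTop R, eventually_pos hs.size] with i h1 h2 θ hθ
    have hs0 : 0 < √(n i : ℝ) := by positivity
    rw [norm_smul, Real.norm_of_nonneg hs0.le] at hθ
    have h3 : θ ∈ Metric.closedBall θ₀ (ρ i) := by
      rw [mem_closedBall_iff_norm]
      exact le_of_mul_le_mul_left (hθ.trans h1) hs0
    exact ⟨hU (hρU (Metric.closedBall_subset_closedBall (hρ i) h3)), h3⟩
  have hmul₀ : ∀ᶠ i in l, HasMultiplier fun j => g (x i j) θ₀ := by
    obtain ⟨R, -, hR⟩ := eventually_hasMultiplier hs.size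
      (hs.eventually_mean_norm_pow h (θ := fun _ => θ₀) (Eventually.of_forall fun _ => h.mem))
      hs.second hc hSc hs.bounded
    exact hR.mono fun i hi => ⟨_, hi.1⟩
  obtain ⟨M', hM'⟩ := hs.eventually_norm_emle_le h hκ hc hSc hinv hinv' hρ₀ hρU hc₀ hD hρκ
    (hEMLE.mono fun i hi => Metric.closedBall_subset_closedBall (hρ i) hi.1.2)
    (hEMLE.mono fun i hi => hi.2.1) (by
      filter_upwards [hEMLE, hmul₀, hA 0] with i h1 h2 h3
      exact h1.2.2 θ₀ (h3 θ₀ (by simp)) h2)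
  have hlin := hs.tendsto_emle_sub h hκ hc hSc hinv hinv' hsym
    (mclm_add_influence h.posDef h.rank_eq) hc₁
    (fun v => by
      rw [inner_mclm_left, mclm_mclm, mclm_mclm]
      exact hD₁ v) hM' hA hEMLE
  refine (hs.tendsto_testStat_sub h hκ hc hSc hinv hinv' hM' hlin hφ).congr fun i => ?_
  rw [inner_mclm_eq_norm_sq hL, mclm_mclm]

end limit

end EmpPhi

/-! ### The limit law and the limiting power -/

theorem theorem4 {k p r : ℕ} (hp : 0 < p)
    (Θ : Set (EmpPhi.E p)) (g : EmpPhi.E k → EmpPhi.E p → EmpPhi.E r)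
    (F : Measure (EmpPhi.E k)) [IsProbabilityMeasure F]
    (θ₀ : EmpPhi.E p) (U : Set (EmpPhi.E p)) (hU : U ⊆ Θ) (K₁ K₂ K₃ : EmpPhi.E k → ℝ)
    (hreg : EmpPhi.Regular g F θ₀ U K₁ K₂ K₃) :
    ∃ ρ₀ : ℝ, 0 < ρ₀ ∧
      ∀ (f : EmpPhi.E p) (Fn : ℕ → Measure (EmpPhi.E k)),
        (∀ n, 1 ≤ n → EmpPhi.localParam θ₀ f n ∈ Θ) →
        (∀ n, IsProbabilityMeasure (Fn n)) →
        EmpPhi.LocalAlternatives g F θ₀ f K₁ K₂ Fn →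
      -- i.i.d. samples `X n 0, …, X n (n-1)` from `Fn n`
      ∀ (Ω : ℕ → Type*) [∀ n, MeasurableSpace (Ω n)] (P : ∀ n, Measure (Ω n))
        [∀ n, IsProbabilityMeasure (P n)] (X : ∀ n, Fin n → Ω n → EmpPhi.E k),
        (∀ n, iIndepFun (X n) (P n)) →
        (∀ n i, HasLaw (X n i) (Fn n) (P n)) →
      -- empirical maximum likelihood estimators, localized in balls of radius `ρ n` around `θ₀`
      ∀ (ρ : ℕ → ℝ) (θhat : ∀ n, Ω n → EmpPhi.E p),
        (∀ n, ρ n ≤ ρ₀) →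
        Tendsto (fun n : ℕ => √(n : ℝ) * ρ n) atTop atTop →
        Tendsto (fun n => P n {ω | ¬ EmpPhi.IsEMLE g (fun i => X n i ω)
          (Θ ∩ Metric.closedBall θ₀ (ρ n)) (θhat n ω)}) atTop (𝓝 0) →
      ∀ φ : ℝ → ℝ, EmpPhi.PhiClass φ →
        (∀ n, AEMeasurable
          (fun ω => EmpPhi.testStat φ g (fun i => X n i ω) (θhat n ω) θ₀) (P n)) →
        -- convergence in law to the noncentral chi-squared distribution
        TendstoInDistribution
          (fun n ω => EmpPhi.testStat φ g (fun i => X n i ω) (θhat n ω) θ₀) atTop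
          (id : ℝ → ℝ) P (EmpPhi.noncentralChiSq p (EmpPhi.ncp g F θ₀ f)) ∧
        -- the limiting power at level `α`, an expression without `φ`
        ∀ α c : ℝ, 0 < α → α < 1 → cdf (EmpPhi.chiSq p) c = 1 - α →
          Tendsto (fun n => (P n).real
            {ω | c < EmpPhi.testStat φ g (fun i => X n i ω) (θhat n ω) θ₀}) atTop
            (𝓝 (1 - cdf (EmpPhi.noncentralChiSq p (EmpPhi.ncp g F θ₀ f)) c)) := by
  obtain ⟨ρ₀, hρ₀, hρU, c₀, hc₀, hD, hρκ⟩ := hreg.exists_radius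
  obtain ⟨L, hL⟩ := EmpPhi.exists_transpose_mul_self
    (EmpPhi.posDef_information hreg.posDef hreg.rank_eq)
  refine ⟨ρ₀, hρ₀, fun f Fn _ hFn hloc Ω _ P _ X hind hX ρ θhat hρ hρn hEMLE φ hφ hT => ?_⟩
  set A := EmpPhi.mclm (L * EmpPhi.influence (EmpPhi.S11 g F θ₀) (EmpPhi.S12 g F θ₀)) with hA
  have hW := EmpPhi.tendstoInDistribution_sampleMean hreg hloc hind hX
  have hcont : Continuous fun w => ‖A w‖ ^ 2 := by fun_prop
  have hlaw := EmpPhi.map_norm_sq_multivariateGaussian hp hreg.posDef hreg.rank_eq hL f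
  rw [← EmpPhi.ncp_eq hreg.posDef hreg.rank_eq f] at hlaw
  have hQ : TendstoInDistribution (fun (n : ℕ) ω => ‖A (√(n : ℝ) •
      EmpPhi.sampleMean (fun j => g (X n j ω) θ₀))‖ ^ 2) atTop (id : ℝ → ℝ) P
      (EmpPhi.noncentralChiSq p (EmpPhi.ncp g F θ₀ f)) := by
    have h1 := hW.continuous_comp hcont
    refine ⟨h1.forall_aemeasurable, aemeasurable_id, ?_⟩
    convert! h1.tendsto using 2
    refine congrArg 𝓝 (Subtype.ext ?_)
    show Measure.map id _ = Measure.map (_ ∘ id) _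
    rw [Measure.map_id, ← hlaw]
    rfl
  have hsub : Tendsto (fun z : Σ n, Ω n =>
      EmpPhi.testStat φ g (fun i => X z.1 i z.2) (θhat z.1 z.2) θ₀ -
        ‖A (√(z.1 : ℝ) • EmpPhi.sampleMean (fun j => g (X z.1 j z.2) θ₀))‖ ^ 2)
      (EmpPhi.probFilter P) (𝓝 0) := by
    -- Tightness of `W` is applied to the event of an error below `ε`, so it suffices to argue where
    -- `‖W‖ ≤ M`, for each fixed `M`.
    refine Metric.tendsto_nhds.2 fun ε hε =>
      EmpPhi.eventually_probFilter_of_tight hW fun M => ?_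
    have hs := EmpPhi.sampleLimits hreg hloc hind hX M
    have h1 := EmpPhi.SampleLimits.tendsto_testStat_sub_norm_sq hreg hs
      (θ := fun z : Σ n, Ω n => θhat z.1 z.2) (ρ := fun z : Σ n, Ω n => ρ z.1)
      hρ₀ hρU hc₀ hD hρκ hU (fun z => hρ z.1)
      (hρn.comp hs.size)
      ((EmpPhi.eventually_probFilter.2 hEMLE).filter_mono inf_le_left) hL hφ
    exact Metric.tendsto_nhds.1 h1 ε hε
  have hlim := EmpPhi.tendstoInDistribution_of_tendsto_sub hQ hT hsub
  refine ⟨hlim, fun α c _ _ _ => ?_⟩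
  -- The rejection region is a half-line whose boundary `{c}` is null for the limit law, so
  -- convergence in law gives convergence of the power.
  have h1 := ProbabilityMeasure.tendsto_measure_of_null_frontier_of_tendsto' hlim.tendsto
    (E := Set.Ioi c) (by
      rw [frontier_Ioi]
      simpa using EmpPhi.noncentralChiSq_singleton hp _ c)
  have h2 := (ENNReal.tendsto_toReal (by
    simp only [ProbabilityMeasure.coe_mk, Measure.map_id]
    exact measure_ne_top _ _)).comp h1
  have h3 : ((EmpPhi.noncentralChiSq p (EmpPhi.ncp g F θ₀ f)).map id (Set.Ioi c)).toReal =
      1 - cdf (EmpPhi.noncentralChiSq p (EmpPhi.ncp g F θ₀ f)) c := by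
    rw [Measure.map_id, cdf_eq_real, ← Set.compl_Iic, ← measureReal_def,
      probReal_compl_eq_one_sub measurableSet_Iic]
  rw [← h3]
  refine h2.congr fun n => ?_
  simp only [Function.comp, ProbabilityMeasure.coe_mk]
  rw [Measure.map_apply_of_aemeasurable (hT n) measurableSet_Ioi]
  rfl
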